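/- Throughout, $\langle\xi\rangle=(1+|\xi|^2)^{1/2}$, and $\widehat u(\xi)=(2\pi)^{-d/2}\langle u,e^{-i\langle\cdot,\xi\rangle}\rangle$ for a compactly supported distribution $u$ on $\mathbf R^d$. **Weights and symbols.** $\mathscr P(\mathbf R^n)$ is the set of positive measurable functions $\omega$ on $\mathbf R^n$ for which there are constants $C,N$ such that $\omega(x+y)\le C\,\omega(x)(1+|y|)^N$ for all $x,y$. A weight $v\in\mathscr P(\mathbf R^n)$ is submultiplicative if it is even and $v(x+y)\le C\,v(x)v(y)$ for some constant $C$ and all $x,y$. For $\rho>0$, $\mathscr P_{\rho,0}(\mathbf R^{2d})$ is the set of all $\omega_0\in\mathscr P(\mathbf R^{2d})\cap C^\infty(\mathbf R^{2d})$ such that $\langle\xi\rangle^{\rho|\beta|}\,\partial_x^\alpha\partial_\xi^\beta\omega_0(x,\xi)/\omega_0(x,\xi)$ is bounded for all multi-indices $\alpha,\beta$, and for such $\omega_0$, $S^{(\omega_0)}_{\rho,0}(\mathbf R^{2d})$ is the set of all $a\in C^\infty(\mathbf R^{2d})$ such that for all $\alpha,\beta$ there is a constant $C_{\alpha,\beta}$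 with $|\partial_x^\alpha\partial_\xi^\beta a(x,\xi)|\le C_{\alpha,\beta}\,\omega_0(x,\xi)\langle\xi\rangle^{-\rho|\beta|}$. The symbol $a$ is (locally) elliptic with respect to $\omega_0$ if for every compact $K\subseteq\mathbf R^d$ there are $c,R>0$ with $|a(x,\xi)|\ge c\,\omega_0(x,\xi)$ for $x\in K$, $|\xi|\ge R$. **BF-spaces.** A translation invariant BF-space on $\mathbf R^d$ (with respect to a submultiplicative $v\in\mathscr P(\mathbf R^d)$) is a Banach space $\mathscr B$ of (classes of) complex-valued measurable functions on $\mathbf R^d$ for which there is a constant $C$ such that: (1) $\mathscr S(\mathbf R^d)\subseteq\mathscr B\subseteq\mathscr S'(\mathbf R^d)$ with continuous embeddings; (2) if $x\in\mathbf R^d$ and $f\in\mathscr B$, then $f(\cdot-x)\in\mathscr B$ and $\|f(\cdot-x)\|_{\mathscr B}\le C\,v(x)\|f\|_{\mathscr B}$; (3) if $g\in\mathscr B$, $f$ is measurable and $|f|\le|g|$ a.e., then $f\in\mathscr B$ and $\|f\|_{\mathscr B}\le C\|g\|_{\mathscr B}$. **Wave-front sets.** For $\omega\in\mathscr P(\mathbf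 R^{2d})$ and $f\in\mathscr S'(\mathbf R^d)$, fix any $z\in\mathbf R^d$. Then $\mathrm{WF}_{\mathscr F\mathscr B(\omega)}(f)$ is the set of all $(x_0,\xi_0)\in\mathbf R^d\times(\mathbf R^d\setminus 0)$ such that for every $\varphi\in C_0^\infty(\mathbf R^d)$ with $\varphi(x_0)\ne0$ and every open cone $\Gamma\subseteq\mathbf R^d\setminus0$ containing $\xi_0$, the function $\xi\mapsto\widehat{\varphi f}(\xi)\,\omega(z,\xi)\,\chi_\Gamma(\xi)$ does not belong to $\mathscr B$. The set does not depend on $z$. **Theorem.** Let $\rho>0$, $\omega\in\mathscr P(\mathbf R^{2d})$, $\omega_0\in\mathscr P_{\rho,0}(\mathbf R^{2d})$, let $a\in S^{(\omega_0)}_{\rho,0}(\mathbf R^{2d})$ be elliptic with respect to $\omega_0$, and let $\mathscr B$ be a translation invariant BF-space on $\mathbf R^d$. Then the operator $$(\mathrm{Op}(a)\varphi)(x)=(2\pi)^{-d}\int\!\!\int a(x,\xi)\varphi(y)e^{i\langle x-y,\xi\rangle}\,dy\,d\xi,\qquad\varphi\in\mathscr S(\mathbf R^d),$$ maps $\mathscr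 S(\mathbf R^d)$ to itself and extends uniquely to a continuous linear operator $\mathrm{Op}(a)$ on $\mathscr S'(\mathbf R^d)$, and for every $f\in\mathscr S'(\mathbf R^d)$, $$\mathrm{WF}_{\mathscr F\mathscr B(\omega/\omega_0)}(\mathrm{Op}(a)f)=\mathrm{WF}_{\mathscr F\mathscr B(\omega)}(f).$$ -/

import Mathlib

open MeasureTheory Set
open scoped SchwartzMap

noncomputable section

namespace FourierBF

/-- Euclidean space `ℝᵈ`. -/
abbrev E (d : ℕ) : Type := EuclideanSpace ℝ (Fin d)

/-! ### Weights and symbol classes -/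

/-- `ω` is `v`-moderate: `ω (x + y) ≤ C ω(x) v(y)` for some constant `C`. -/
def IsModerate {V : Type*} [Add V] (ω v : V → ℝ) : Prop :=
  ∃ C : ℝ, ∀ x y : V, ω (x + y) ≤ C * ω x * v y

/-- The class `𝒫(V)` of polynomially moderate weights: positive measurable functions which are
`v`-moderate for some polynomial `v`. Every positive polynomial is dominated by a multiple of some
`(1 + ‖y‖) ^ N`, so only these need be considered. Local boundedness of `ω` and of `1 / ω` follows
from the moderateness. -/
structure IsPolyModerate {V : Type*} [NormedAddCommGroup V] [MeasurableSpace V]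
    (ω : V → ℝ) : Prop where
  pos : ∀ x, 0 < ω x
  measurable : Measurable ω
  moderate : ∃ N : ℕ, IsModerate ω (fun y => (1 + ‖y‖) ^ N)

/-- Submultiplicative weights in `𝒫(V)`; as usual they are taken to be even. -/
structure IsSubmultiplicativeWeight {V : Type*} [NormedAddCommGroup V] [MeasurableSpace V]
    (v : V → ℝ) : Prop where
  polyModerate : IsPolyModerate v
  submultiplicative : IsModerate v v
  even : ∀ x, v (-x) = v x

/-- The Japanese bracket `⟨ξ⟩ = (1 + |ξ|²)^{1/2}`. -/
def bracket {d : ℕ} (ξ : E d) : ℝ := Real.sqrt (1 + ‖ξ‖ ^ 2)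

/-- The mixed partial derivative `∂_{x_{i 1}} ⋯ ∂_{x_{i m}} ∂_{ξ_{j 1}} ⋯ ∂_{ξ_{j n}} a` at `p`.
For a smooth `a` on `ℝᵈ × ℝᵈ`, letting `i` and `j` run through all tuples of
lengths `m` and `n` gives exactly the derivatives `∂_x^α ∂_ξ^β a` with `|α| = m`, `|β| = n`. -/
def mixedPartial {d : ℕ} {F : Type*} [NormedAddCommGroup F] [NormedSpace ℝ F]
    (a : E d × E d → F) {m n : ℕ} (i : Fin m → Fin d) (j : Fin n → Fin d) (p : E d × E d) : F :=
  iteratedFDeriv ℝ (m + n) a p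
    (Fin.append (fun k => ((EuclideanSpace.single (i k) (1 : ℝ), 0) : E d × E d))
      (fun k => ((0, EuclideanSpace.single (j k) (1 : ℝ)) : E d × E d)))

/-- The class `S^{(ω)}_{ρ,δ}(ℝ²ᵈ)`: smooth `a` with
`|∂_x^α ∂_ξ^β a(x, ξ)| ≤ C_{α,β} ω(x, ξ) ⟨ξ⟩^{-ρ|β| + δ|α|}`. -/
structure IsSymbol {d : ℕ} {F : Type*} [NormedAddCommGroup F] [NormedSpace ℝ F]
    (ρ δ : ℝ) (ω : E d × E d → ℝ) (a : E d × E d → F) : Prop where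
  smooth : ContDiff ℝ ((⊤ : ℕ∞) : WithTop ℕ∞) a
  bound : ∀ (m n : ℕ) (i : Fin m → Fin d) (j : Fin n → Fin d), ∃ C : ℝ, ∀ x ξ : E d,
    ‖mixedPartial a i j (x, ξ)‖ ≤ C * ω (x, ξ) * bracket ξ ^ (-ρ * (n : ℝ) + δ * (m : ℝ))

/-- The class `𝒫_{ρ,δ}(ℝ²ᵈ)`: smooth weights `ω ∈ 𝒫(ℝ²ᵈ)` such that
`⟨ξ⟩^{ρ|β| - δ|α|} ∂_x^α ∂_ξ^β ω / ω` is bounded for all `α`, `β`. -/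
structure IsSmoothWeight {d : ℕ} (ρ δ : ℝ) (ω : E d × E d → ℝ) : Prop where
  polyModerate : IsPolyModerate ω
  smooth : ContDiff ℝ ((⊤ : ℕ∞) : WithTop ℕ∞) ω
  bound : ∀ (m n : ℕ) (i : Fin m → Fin d) (j : Fin n → Fin d), ∃ C : ℝ, ∀ x ξ : E d,
    |bracket ξ ^ (ρ * (n : ℝ) - δ * (m : ℝ)) * (mixedPartial ω i j (x, ξ) / ω (x, ξ))| ≤ C

/-- `a` is (locally) elliptic with respect to `ω₀`. -/
def IsLocallyElliptic {d : ℕ} (ω₀ : E d × E d → ℝ) (a : E d × E d → ℂ) : Prop :=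
  ∀ K : Set (E d), IsCompact K → ∃ c > 0, ∃ R > 0, ∀ x ∈ K, ∀ ξ : E d, R ≤ ‖ξ‖ →
    c * ω₀ (x, ξ) ≤ ‖a (x, ξ)‖

/-! ### Translation invariant BF-spaces -/

/-- `ι : B → L⁰(ℝᵈ)` exhibits the Banach space `B` as a translation invariant BF-space on `ℝᵈ` with
respect to `v`: `ι` is the inclusion of `B` in the space of (classes modulo a.e. equality of)
measurable functions. The inclusion `B ⊆ 𝒮'` means that each `f ∈ B` acts on `φ ∈ 𝒮` as
`∫ f φ`; its continuity is expressed by `continuous_pairing` (weak-* continuity, which for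
a linear map from a Banach space to `𝒮'` is the same as continuity into the strong dual). -/
structure IsInvariantBFSpace {d : ℕ} {B : Type*} [NormedAddCommGroup B] [NormedSpace ℂ B]
    (v : E d → ℝ) (ι : B →ₗ[ℂ] (E d →ₘ[volume] ℂ)) : Prop where
  complete : CompleteSpace B
  injective : Function.Injective ι
  weight : IsSubmultiplicativeWeight v
  schwartz_le : ∃ J : 𝓢(E d, ℂ) →L[ℂ] B, ∀ φ : 𝓢(E d, ℂ), ι (J φ) =ᵐ[volume] φ
  integrable_pairing : ∀ (f : B) (φ : 𝓢(E d, ℂ)), Integrable (fun x => ι f x * φ x)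
  continuous_pairing : ∀ φ : 𝓢(E d, ℂ), Continuous (fun f : B => ∫ x, ι f x * φ x)
  translation : ∃ C : ℝ, ∀ (x : E d) (f : B), ∃ g : B,
    ι g =ᵐ[volume] (fun y => ι f (y - x)) ∧ ‖g‖ ≤ C * v x * ‖f‖
  solid : ∃ C : ℝ, ∀ (g : B) (f : E d →ₘ[volume] ℂ), (∀ᵐ x, ‖f x‖ ≤ ‖ι g x‖) →
    ∃ f' : B, ι f' = f ∧ ‖f'‖ ≤ C * ‖g‖

/-! ### Fourier transform of localizations and wave-front sets -/

/-- The function `y ↦ φ(y) e^{-i⟨y, ξ⟩}`, for a compactly supported `φ ∈ 𝒮`, as an element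
of `𝒮`. -/
def modulate {d : ℕ} (φ : 𝓢(E d, ℂ)) (hφ : HasCompactSupport φ) (ξ : E d) : 𝓢(E d, ℂ) :=
  HasCompactSupport.toSchwartzMap
    (f := fun y => φ y * Complex.exp (-Complex.I * ((inner ℝ y ξ : ℝ) : ℂ)))
    hφ.mul_right
    ((φ.smooth ⊤).mul (Complex.contDiff_exp.comp (contDiff_const.mul
      (Complex.ofRealCLM.contDiff.comp (contDiff_id.inner ℝ contDiff_const)))))

/-- The Fourier transform of the compactly supported distribution `φ f`, which is the smooth
function `(φ f)^(ξ) = (2π)^{-d/2} ⟨φ f, e^{-i⟨·, ξ⟩}⟩ = (2π)^{-d/2} ⟨f, φ e^{-i⟨·, ξ⟩}⟩`. -/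
def fourierLocal {d : ℕ} (f : 𝓢'(E d, ℂ)) (φ : 𝓢(E d, ℂ)) (hφ : HasCompactSupport φ)
    (ξ : E d) : ℂ :=
  (((2 * Real.pi) ^ (-(d : ℝ) / 2) : ℝ) : ℂ) * f (modulate φ hφ ξ)

/-- Open cones in `ℝᵈ ∖ 0`. -/
structure IsOpenCone {d : ℕ} (Γ : Set (E d)) : Prop where
  isOpen : IsOpen Γ
  zero_notMem : (0 : E d) ∉ Γ
  smul_mem : ∀ t : ℝ, 0 < t → ∀ ξ ∈ Γ, t • ξ ∈ Γ

/-- `|φ f|_{ℱB(ω, Γ)} < ∞`, that is, `(φ f)^ ω(z, ·) χ_Γ` belongs to `B`. The choice of the point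
`z` at which the weight is frozen is immaterial. -/
def FiniteOnCone {d : ℕ} {B : Type*} [NormedAddCommGroup B] [NormedSpace ℂ B]
    (ι : B →ₗ[ℂ] (E d →ₘ[volume] ℂ)) (ω : E d × E d → ℝ) (z : E d)
    (f : 𝓢'(E d, ℂ)) (φ : 𝓢(E d, ℂ)) (hφ : HasCompactSupport φ) (Γ : Set (E d)) : Prop :=
  ∃ b : B, ι b =ᵐ[volume] Γ.indicator (fun ξ => fourierLocal f φ hφ ξ * (ω (z, ξ) : ℂ))

/-- The wave-front set `WF_{ℱB(ω)}(f) ⊆ ℝᵈ × (ℝᵈ ∖ 0)`, computed with the weight frozen at `z`: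
`(x₀, ξ₀)` belongs to it when, for every `φ ∈ C₀^∞(ℝᵈ)` with `φ(x₀) ≠ 0`, there is no
open cone `Γ ∋ ξ₀` with `|φ f|_{ℱB(ω, Γ)} < ∞`. -/
def waveFrontSet {d : ℕ} {B : Type*} [NormedAddCommGroup B] [NormedSpace ℂ B]
    (ι : B →ₗ[ℂ] (E d →ₘ[volume] ℂ)) (ω : E d × E d → ℝ) (z : E d)
    (f : 𝓢'(E d, ℂ)) : Set (E d × E d) :=
  {p | p.2 ≠ 0 ∧ ∀ (φ : 𝓢(E d, ℂ)) (hφ : HasCompactSupport φ), φ p.1 ≠ 0 →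
    ¬ ∃ Γ : Set (E d), IsOpenCone Γ ∧ p.2 ∈ Γ ∧ FiniteOnCone ι ω z f φ hφ Γ}

/-! ### Pseudo-differential operators -/

/-- The Kohn–Nirenberg operator on `𝒮`:
`(Op(a)φ)(x) = (2π)^{-d} ∫ (∫ a(x, ξ) φ(y) e^{i⟨x - y, ξ⟩} dy) dξ`. -/
def opSchwartz {d : ℕ} (a : E d × E d → ℂ) (φ : 𝓢(E d, ℂ)) (x : E d) : ℂ :=
  (((2 * Real.pi) ^ (-(d : ℝ)) : ℝ) : ℂ) *
    ∫ ξ : E d, ∫ y : E d,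
      a (x, ξ) * φ y * Complex.exp (Complex.I * ((inner ℝ (x - y) ξ : ℝ) : ℂ))

/-- `A` is an extension of `Op(a)` from `𝒮` to a continuous linear operator on `𝒮'`: for each
`φ ∈ 𝒮` the function `Op(a)φ` is in `𝒮` and `A` maps `φ` (as a distribution) to it. -/
def IsOpExtension {d : ℕ} (a : E d × E d → ℂ) (A : 𝓢'(E d, ℂ) →L[ℂ] 𝓢'(E d, ℂ)) : Prop :=
  ∀ φ : 𝓢(E d, ℂ), ∃ ψ : 𝓢(E d, ℂ), (∀ x, ψ x = opSchwartz a φ x) ∧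
    A (φ : 𝓢'(E d, ℂ)) = (ψ : 𝓢'(E d, ℂ))

end FourierBF

end

/-! The argument works with sizes of localized Fourier transforms `locF f ψ ξ`, the value of f on ψ
e^{-i⟨·,ξ⟩}. It uses no symbolic calculus, no composition of operators and no asymptotic sums.

Any continuous extension A of Op(a) is given by transposition: A f φ = (2π)^{-d} f(FS(T φ)), where T
θ(η) = ∫ θ(x) a(x,η) e^{i⟨x,η⟩} dx (`existsUnique_isOpExtension`). On θ e^{-i⟨·,ξ⟩} the phase
becomes ⟨x, η − ξ⟩, so integration by parts concentrates T near η = ξ, with size W(η) = ω₀(x₀,η).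
Freezing the weight at x₀ costs only powers of 1 + |x|, which cut-offs absorb.

Pseudolocality. Average a symbol in η against k, where ∫ k(ζ) e^{i⟨z,ζ⟩} dζ is a cut-off near z = 0.
The averaged symbol has kernel supported near the diagonal, and the difference from the original
gains (1+|η|)^{-ρ}, by the mean value theorem. Iteration (`SymBound.exists_gain_pow`) replaces the
symbol off the diagonal by one of arbitrarily low order. Hence only f near the support of the
cut-off matters, up to rapidly decreasing errors, and `SymBound.exists_direct_bound` bounds `locF (A
f) φ` by the convolution of a decaying kernel with |`locF f ψ`| W. This is the inclusion of WF(A f)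
in WF(f).

Converse. Test g = A f on u_ξ e^{-i⟨·,ξ⟩} with u_ξ = χ / a(·,ξ), a parametrix with the frequency
frozen at ξ. Since T(u_ξ e^{-i⟨·,ξ⟩})(η) = ∫ χ (a(x,η)/a(x,ξ)) e^{i⟨x,η−ξ⟩} dx, replacing a(x,η) by
a(x,ξ) reproduces `locF f χ ξ`, and the error gains (1+|ξ|)^{-ρ}. Thus `locF f χ` is controlled by g
with weight 1/W, by f itself with a gain of ρ, and by a rapidly decreasing term
(`SymBound.exists_parametrix_bound`). Every f has the required regularity for a sufficiently weak
weight, because `locF` grows polynomially; finitely many gains of ρ reach the desired weight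
(`IsInvariantBFSpace.locBF_of_image`).

BF-spaces. Only solidity, completeness and translation bounds are available, so convolutions are
discretized: a Fourier series expansion on a ball containing supp ψ expresses `locF f ψ (ξ − η)`
through its values on ξ minus a lattice (`exists_sampling`). The convolution is then dominated by a
lattice sum of translates with rapidly decreasing coefficients. Short translations of a smaller cone
stay in the larger one; long ones meet the decay of the coefficients
(`IsInvariantBFSpace.exists_of_le_lattice`). -/

noncomputable section

namespace FourierBF

open scoped ContDiff

/-! ### Iterated directional derivatives -/

section DirectionalDerivatives

variable {P : Type*} [NormedAddCommGroup P] [NormedSpace ℝ P]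

/-- The directional derivative of `b` along `v`. -/
def dirD (v : P) (b : P → ℂ) : P → ℂ := fun p => fderiv ℝ b p v

/-- The iterated directional derivative of `b` along the vectors of a list. -/
def dirDs : List P → (P → ℂ) → P → ℂ
  | [], b => b
  | v :: l, b => dirDs l (dirD v b)

theorem contDiff_dirD {b : P → ℂ} (hb : ContDiff ℝ ∞ b) (v : P) : ContDiff ℝ ∞ (dirD v b) :=
  (hb.fderiv_right (m := ∞) (by simp)).clm_apply contDiff_const

theorem differentiable_of_contDiff {b : P → ℂ} (hb : ContDiff ℝ ∞ b) : Differentiable ℝ b :=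
  hb.differentiable (by simp)

theorem dirD_dirD_comm {b : P → ℂ} (hb : ContDiff ℝ ∞ b) (v w : P) :
    dirD v (dirD w b) = dirD w (dirD v b) := by
  funext p
  have h1 : DifferentiableAt ℝ (fderiv ℝ b) p :=
    ((hb.fderiv_right (m := ∞) (by simp)).differentiable (by simp)) p
  have h2 : IsSymmSndFDerivAt ℝ b p :=
    hb.contDiffAt.isSymmSndFDerivAt (by simpa using WithTop.coe_le_coe.2 (le_top : (2 : ℕ∞) ≤ ⊤))
  have key : ∀ v w : P, dirD v (dirD w b) p = fderiv ℝ (fderiv ℝ b) p v w := by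
    intro v w
    unfold dirD
    rw [fderiv_clm_apply h1 (differentiableAt_const w)]
    simp
  rw [key, key, h2.eq]

theorem dirDs_append (l l' : List P) (b : P → ℂ) : dirDs (l ++ l') b = dirDs l' (dirDs l b) := by
  induction l generalizing b with
  | nil => rfl
  | cons v l ih => exact ih _

theorem dirDs_perm {l l' : List P} (h : l.Perm l') {b : P → ℂ} (hb : ContDiff ℝ ∞ b) :
    dirDs l b = dirDs l' b := by
  induction h generalizing b with
  | nil => rfl
  | cons v _ ih => exact ih (contDiff_dirD hb v)
  | swap v w l => simp only [dirDs]; rw [dirD_dirD_comm hb]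
  | trans _ _ ih1 ih2 => rw [ih1 hb, ih2 hb]

theorem dirD_dirDs {l : List P} {v : P} {b : P → ℂ} (hb : ContDiff ℝ ∞ b) :
    dirD v (dirDs l b) = dirDs (v :: l) b := by
  rw [dirDs_perm (List.perm_append_singleton v l).symm hb, dirDs_append]; rfl

theorem dirD_add {b c : P → ℂ} (hb : Differentiable ℝ b) (hc : Differentiable ℝ c) (v : P) :
    dirD v (fun p => b p + c p) = fun p => dirD v b p + dirD v c p := by
  funext p; simp [dirD, fderiv_fun_add (hb p) (hc p)]

theorem dirD_sub {b c : P → ℂ} (hb : Differentiable ℝ b) (hc : Differentiable ℝ c) (v : P) :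
    dirD v (fun p => b p - c p) = fun p => dirD v b p - dirD v c p := by
  funext p; simp [dirD, fderiv_fun_sub (hb p) (hc p)]

theorem dirD_mul {b c : P → ℂ} (hb : Differentiable ℝ b) (hc : Differentiable ℝ c) (v : P) :
    dirD v (fun p => b p * c p) = fun p => dirD v b p * c p + b p * dirD v c p := by
  funext p; simp [dirD, fderiv_fun_mul (hb p) (hc p)]; ring

theorem dirDs_add {b c : P → ℂ} (hb : ContDiff ℝ ∞ b) (hc : ContDiff ℝ ∞ c) (l : List P) :
    dirDs l (fun p => b p + c p) = fun p => dirDs l b p + dirDs l c p := by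
  induction l generalizing b c with
  | nil => rfl
  | cons v l ih =>
    simp only [dirDs]
    rw [dirD_add (differentiable_of_contDiff hb) (differentiable_of_contDiff hc),
      ih (contDiff_dirD hb v) (contDiff_dirD hc v)]

theorem dirDs_sub {b c : P → ℂ} (hb : ContDiff ℝ ∞ b) (hc : ContDiff ℝ ∞ c) (l : List P) :
    dirDs l (fun p => b p - c p) = fun p => dirDs l b p - dirDs l c p := by
  induction l generalizing b c with
  | nil => rfl
  | cons v l ih =>
    simp only [dirDs]
    rw [dirD_sub (differentiable_of_contDiff hb) (differentiable_of_contDiff hc),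
      ih (contDiff_dirD hb v) (contDiff_dirD hc v)]

/-- The bridge from `mixedPartial`, which is stated with `iteratedFDeriv`, to lists of directions,
where reordering and the Leibniz rule are inductions. -/
theorem iteratedFDeriv_apply_eq_dirDs {b : P → ℂ} (hb : ContDiff ℝ ∞ b) (n : ℕ) (m : Fin n → P)
    (p : P) : iteratedFDeriv ℝ n b p m = dirDs (List.ofFn m) b p := by
  induction n generalizing p with
  | zero => simp [dirDs]
  | succ n ih =>
    rw [iteratedFDeriv_succ_apply_left, List.ofFn_succ, ← dirD_dirDs hb]
    have h1 : dirDs (List.ofFn fun i => m i.succ) b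
        = fun q => iteratedFDeriv ℝ n b q (Fin.tail m) := by
      funext q; rw [ih]; rfl
    have h2 : DifferentiableAt ℝ (iteratedFDeriv ℝ n b) p :=
      (hb.differentiable_iteratedFDeriv (m := n) (by exact_mod_cast WithTop.coe_lt_top _)) p
    rw [h1, dirD]
    have := (ContinuousMultilinearMap.apply ℝ (fun _ : Fin n => P) ℂ (Fin.tail m)).hasFDerivAt.comp p
      h2.hasFDerivAt
    have h3 := this.fderiv
    simp only [Function.comp_def, ContinuousMultilinearMap.apply_apply] at h3
    rw [h3]; rfl

/-! ### Coordinates -/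

/-- A finite family of vectors with coordinate functionals: `w = ∑ i, coord i w • vec i`. -/
structure Coordinates (Idx : Type) [Fintype Idx] (P : Type*) [NormedAddCommGroup P]
    [NormedSpace ℝ P] where
  /-- the vectors -/
  vec : Idx → P
  /-- the coordinate functionals -/
  coord : Idx → P →L[ℝ] ℝ
  sum_eq : ∀ w : P, ∑ i, coord i w • vec i = w

variable {Idx : Type} [Fintype Idx] (κ : Coordinates Idx P)

theorem fderiv_eq_sum_dirD (b : P → ℂ) (p : P) :
    fderiv ℝ b p = ∑ i, (κ.coord i).smulRight (dirD (κ.vec i) b p) := by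
  ext w
  conv_lhs => rw [← κ.sum_eq w]
  simp [dirD]

/-- The full derivative is a finite combination of coordinate derivatives, which stay in the class,
so differentiability bootstraps to smoothness. It is meant for parameter integrals, whose
derivatives are integrals of the same kind with another amplitude. -/
theorem contDiff_of_dirD_mem (S : Set (P → ℂ)) (hd : ∀ b ∈ S, Differentiable ℝ b)
    (hS : ∀ b ∈ S, ∀ i, dirD (κ.vec i) b ∈ S) {b : P → ℂ} (hb : b ∈ S) : ContDiff ℝ ∞ b := by
  suffices h : ∀ n : ℕ, ∀ b ∈ S, ContDiff ℝ n b from contDiff_infty.2 fun n => h n b hb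
  intro n
  induction n with
  | zero => intro b hb; exact contDiff_zero.2 (hd b hb).continuous
  | succ n ih =>
    intro b hb
    rw [show ((n + 1 : ℕ) : WithTop ℕ∞) = n + 1 by push_cast; rfl, contDiff_succ_iff_fderiv]
    refine ⟨hd b hb, by simp, ?_⟩
    have : fderiv ℝ b = fun p => ∑ i, (κ.coord i).smulRight (dirD (κ.vec i) b p) :=
      funext (fderiv_eq_sum_dirD κ b)
    rw [this]
    refine ContDiff.sum fun i _ => ?_
    exact (ContinuousLinearMap.smulRightL ℝ P ℂ (κ.coord i)).contDiff.comp (ih _ (hS b hb i))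

theorem norm_iteratedFDeriv_le_of_dirDs (n : ℕ) : ∃ C : ℝ, 0 ≤ C ∧ ∀ (b : P → ℂ),
    ContDiff ℝ ∞ b → ∀ (p : P) (M : ℝ),
    (∀ l : List Idx, l.length = n → ‖dirDs (l.map κ.vec) b p‖ ≤ M) →
    ‖iteratedFDeriv ℝ n b p‖ ≤ C * M := by
  induction n with
  | zero =>
    refine ⟨1, zero_le_one, fun b hb p M h => ?_⟩
    simpa [dirDs] using h [] rfl
  | succ n ih =>
    obtain ⟨C, hC, h⟩ := ih
    refine ⟨∑ i, ‖ContinuousLinearMap.smulRightL ℝ P ℂ (κ.coord i)‖ * C,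
      Finset.sum_nonneg fun i _ => by positivity, fun b hb p M hM => ?_⟩
    rw [← norm_iteratedFDeriv_fderiv]
    have e : fderiv ℝ b = fun p => ∑ i, (ContinuousLinearMap.smulRightL ℝ P ℂ (κ.coord i))
        (dirD (κ.vec i) b p) := funext (fderiv_eq_sum_dirD κ b)
    have hs : ∀ i, ContDiff ℝ n (dirD (κ.vec i) b) := fun i =>
      (contDiff_dirD hb _).of_le (by exact_mod_cast le_top)
    have hc : ∀ i, ContDiff ℝ n fun p => (ContinuousLinearMap.smulRightL ℝ P ℂ (κ.coord i))
        (dirD (κ.vec i) b p) := fun i => (ContinuousLinearMap.contDiff _).comp (hs i)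
    rw [e, iteratedFDeriv_fun_sum_apply (fun i _ => (hc i).contDiffAt), Finset.sum_mul]
    refine (norm_sum_le _ _).trans (Finset.sum_le_sum fun i _ => ?_)
    refine (ContinuousLinearMap.norm_iteratedFDeriv_comp_left
      (ContinuousLinearMap.smulRightL ℝ P ℂ (κ.coord i)) (hs i).contDiffAt le_rfl).trans ?_
    rw [mul_assoc]
    refine mul_le_mul_of_nonneg_left (h _ (contDiff_dirD hb _) p M fun l hl => ?_) (norm_nonneg _)
    exact hM (i :: l) (by simp [hl])

end DirectionalDerivatives

/-- The `i`-th unit vector. -/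
def unitVec {d : ℕ} (i : Fin d) : E d := EuclideanSpace.single i 1

theorem sum_coord_smul_unitVec {d : ℕ} (w : E d) : ∑ i, w i • unitVec i = w := by
  ext j
  simp [unitVec, Pi.single_apply]

/-- The standard coordinates on `ℝᵈ`. -/
def stdCoord (d : ℕ) : Coordinates (Fin d) (E d) where
  vec := unitVec
  coord := fun i => EuclideanSpace.proj i
  sum_eq := fun w => sum_coord_smul_unitVec w

/-- The standard coordinates on `ℝᵈ × ℝᵈ`. -/
def prodCoord (d : ℕ) : Coordinates (Fin d ⊕ Fin d) (E d × E d) where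
  vec := Sum.elim (fun i => (unitVec i, 0)) (fun i => (0, unitVec i))
  coord := Sum.elim (fun i => (EuclideanSpace.proj i).comp (ContinuousLinearMap.fst ℝ _ _))
    (fun i => (EuclideanSpace.proj i).comp (ContinuousLinearMap.snd ℝ _ _))
  sum_eq := fun w => by
    rw [Fintype.sum_sum_type]
    refine Prod.ext ?_ ?_
    · simp [Prod.fst_sum, sum_coord_smul_unitVec]
    · simp [Prod.snd_sum, sum_coord_smul_unitVec]

end FourierBF

end

noncomputable section

namespace FourierBF

open scoped ContDiff

/-! ### Polynomial decay -/

section Decay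

variable {V : Type*} [NormedAddCommGroup V]

/-- The function `x ↦ (1 + ‖x‖) ^ (-M)`. -/
def dec (M : ℕ) (x : V) : ℝ := ((1 + ‖x‖) ^ M)⁻¹

theorem one_le_one_add_norm (x : V) : 1 ≤ 1 + ‖x‖ := by linarith [norm_nonneg x]

theorem one_add_norm_add_le (x y : V) : 1 + ‖x + y‖ ≤ (1 + ‖x‖) * (1 + ‖y‖) := by
  nlinarith [norm_add_le x y, norm_nonneg x, norm_nonneg y, mul_nonneg (norm_nonneg x) (norm_nonneg y)]

theorem one_add_norm_sub_le (x y : V) : 1 + ‖x - y‖ ≤ (1 + ‖x‖) * (1 + ‖y‖) := by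
  simpa [sub_eq_add_neg] using one_add_norm_add_le x (-y)

theorem one_add_norm_add_pow_le (x y : V) (M : ℕ) :
    (1 + ‖x + y‖) ^ M ≤ (1 + ‖x‖) ^ M * (1 + ‖y‖) ^ M := by
  rw [← mul_pow]; gcongr; exact one_add_norm_add_le x y

theorem one_add_norm_sub_pow_le (x y : V) (M : ℕ) :
    (1 + ‖x - y‖) ^ M ≤ (1 + ‖x‖) ^ M * (1 + ‖y‖) ^ M := by
  rw [← mul_pow]; gcongr; exact one_add_norm_sub_le x y

theorem dec_pos (M : ℕ) (x : V) : 0 < dec M x := by unfold dec; positivity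

theorem dec_nonneg (M : ℕ) (x : V) : 0 ≤ dec M x := (dec_pos M x).le

theorem dec_le_one (M : ℕ) (x : V) : dec M x ≤ 1 :=
  inv_le_one_of_one_le₀ (one_le_pow₀ (one_le_one_add_norm x))

theorem dec_anti {M N : ℕ} (h : M ≤ N) (x : V) : dec N x ≤ dec M x :=
  inv_anti₀ (by positivity) (pow_le_pow_right₀ (one_le_one_add_norm x) h)

theorem dec_add (M N : ℕ) (x : V) : dec (M + N) x = dec M x * dec N x := by
  simp [dec, pow_add, mul_comm]

theorem pow_mul_dec (M : ℕ) (x : V) : (1 + ‖x‖) ^ M * dec M x = 1 :=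
  mul_inv_cancel₀ (by positivity)

theorem dec_add_mul_pow (M N : ℕ) (x : V) : dec (M + N) x * (1 + ‖x‖) ^ N = dec M x := by
  rw [dec_add, mul_assoc, mul_comm (dec N x), pow_mul_dec, mul_one]

theorem dec_neg (M : ℕ) (x : V) : dec M (-x) = dec M x := by simp [dec]

theorem dec_sub_comm (M : ℕ) (x y : V) : dec M (x - y) = dec M (y - x) := by
  rw [← dec_neg, neg_sub]

/-- Peetre's inequality, written for the inverse powers. -/
theorem dec_mul_dec_le_left (M : ℕ) (x y : V) : dec M x * dec M y ≤ dec M (x + y) := by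
  unfold dec
  rw [← mul_inv]
  exact inv_anti₀ (by positivity) (one_add_norm_add_pow_le x y M)

theorem dec_le_of_sub (M : ℕ) (x y : V) : dec M (x - y) ≤ dec M x * (1 + ‖y‖) ^ M := by
  have := dec_mul_dec_le_left M (x - y) y
  rw [sub_add_cancel] at this
  calc dec M (x - y) = dec M (x - y) * ((1 + ‖y‖) ^ M * dec M y) := by rw [pow_mul_dec, mul_one]
    _ = dec M (x - y) * dec M y * (1 + ‖y‖) ^ M := by ring
    _ ≤ _ := by gcongr

theorem continuous_dec (M : ℕ) : Continuous (dec M : V → ℝ) := by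
  unfold dec
  exact Continuous.inv₀ (by fun_prop) (fun x => by positivity)

end Decay

theorem integrable_dec {d M : ℕ} (hM : d < M) : Integrable (fun x : E d => dec M x) := by
  have := integrable_one_add_norm (E := E d) (μ := volume) (r := M) (by simpa using hM)
  refine this.congr (ae_of_all _ fun x => ?_)
  simp only [dec]
  rw [Real.rpow_neg (by positivity), Real.rpow_natCast]

/-! ### Moderate weights -/

section Moderate

variable {V : Type*} [NormedAddCommGroup V] [MeasurableSpace V]

theorem IsPolyModerate.exists_le {w : V → ℝ} (h : IsPolyModerate w) :
    ∃ (N : ℕ) (C : ℝ), 0 < C ∧ ∀ x y, w (x + y) ≤ C * w x * (1 + ‖y‖) ^ N := by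
  obtain ⟨N, C, hC⟩ := h.moderate
  refine ⟨N, C, ?_, hC⟩
  have := hC 0 0
  simp only [add_zero, norm_zero, one_pow, mul_one] at this
  nlinarith [h.pos 0]

theorem IsPolyModerate.exists_le_pow {w : V → ℝ} (h : IsPolyModerate w) :
    ∃ (N : ℕ) (C : ℝ), 0 < C ∧ ∀ x, w x ≤ C * (1 + ‖x‖) ^ N := by
  obtain ⟨N, C, hC, hN⟩ := h.exists_le
  refine ⟨N, C * w 0, mul_pos hC (h.pos 0), fun x => ?_⟩
  simpa using hN 0 x

theorem IsPolyModerate.mul {w w' : V → ℝ} (h : IsPolyModerate w) (h' : IsPolyModerate w') :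
    IsPolyModerate (fun x => w x * w' x) := by
  obtain ⟨N, C, hC, hN⟩ := h.exists_le
  obtain ⟨N', C', hC', hN'⟩ := h'.exists_le
  refine ⟨fun x => mul_pos (h.pos x) (h'.pos x), h.measurable.mul h'.measurable,
    N + N', C * C', fun x y => ?_⟩
  calc w (x + y) * w' (x + y) ≤ (C * w x * (1 + ‖y‖) ^ N) * (C' * w' x * (1 + ‖y‖) ^ N') :=
        mul_le_mul (hN x y) (hN' x y) (h'.pos _).le
          (by have := h.pos x; positivity)
    _ = _ := by ring

theorem IsPolyModerate.inv {w : V → ℝ} (h : IsPolyModerate w) :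
    IsPolyModerate (fun x => (w x)⁻¹) := by
  obtain ⟨N, C, hC, hN⟩ := h.exists_le
  refine ⟨fun x => inv_pos.2 (h.pos x), h.measurable.inv, N, C, fun x y => ?_⟩
  have := hN (x + y) (-y)
  rw [add_neg_cancel_right, norm_neg] at this
  have h1 := h.pos x
  have h2 := h.pos (x + y)
  rw [inv_le_iff_one_le_mul₀ h2]
  calc 1 = w x * (w x)⁻¹ := (mul_inv_cancel₀ h1.ne').symm
    _ ≤ (C * w (x + y) * (1 + ‖y‖) ^ N) * (w x)⁻¹ := by gcongr
    _ = _ := by ring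

theorem IsPolyModerate.div {w w' : V → ℝ} (h : IsPolyModerate w) (h' : IsPolyModerate w') :
    IsPolyModerate (fun x => w x / w' x) := by
  simpa only [div_eq_mul_inv] using h.mul h'.inv

theorem isPolyModerate_one_add_norm_rpow [BorelSpace V] (s : ℝ) :
    IsPolyModerate (fun x : V => (1 + ‖x‖) ^ s) := by
  have key : ∀ s : ℝ, 0 ≤ s → IsPolyModerate (fun x : V => (1 + ‖x‖) ^ s) := by
    intro s hs
    refine ⟨fun x => by positivity, by fun_prop, ⌈s⌉₊, 1, fun x y => ?_⟩
    rw [one_mul]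
    calc (1 + ‖x + y‖) ^ s ≤ ((1 + ‖x‖) * (1 + ‖y‖)) ^ s :=
          Real.rpow_le_rpow (by positivity) (one_add_norm_add_le x y) hs
      _ = (1 + ‖x‖) ^ s * (1 + ‖y‖) ^ s := Real.mul_rpow (by positivity) (by positivity)
      _ ≤ (1 + ‖x‖) ^ s * (1 + ‖y‖) ^ ((⌈s⌉₊ : ℕ) : ℝ) := by
          gcongr
          · exact one_le_one_add_norm y
          · exact Nat.le_ceil s
      _ = _ := by rw [Real.rpow_natCast]
  rcases le_total 0 s with hs | hs
  · exact key s hs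
  · have := (key (-s) (by linarith)).inv
    refine (funext fun x => ?_ : (fun x : V => (1 + ‖x‖) ^ s) = _) ▸ this
    rw [Real.rpow_neg (by positivity), inv_inv]

end Moderate

theorem IsPolyModerate.slice {d : ℕ} {w : E d × E d → ℝ} (h : IsPolyModerate w) (z : E d) :
    IsPolyModerate (fun ξ => w (z, ξ)) := by
  obtain ⟨N, C, hC, hN⟩ := h.exists_le
  refine ⟨fun x => h.pos _, h.measurable.comp measurable_prodMk_left, N, C, fun x y => ?_⟩
  have := hN (z, x) (0, y)
  simpa [Prod.norm_def] using this

/-- This is why the base point z is immaterial, and why a symbol can be measured by the weight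
frozen at one point. -/
theorem IsPolyModerate.slice_le {d : ℕ} {w : E d × E d → ℝ} (h : IsPolyModerate w) :
    ∃ (N : ℕ) (C : ℝ), 0 < C ∧ ∀ x z ξ, w (x, ξ) ≤ C * w (z, ξ) * (1 + ‖x - z‖) ^ N := by
  obtain ⟨N, C, hC, hN⟩ := h.exists_le
  refine ⟨N, C, hC, fun x z ξ => ?_⟩
  have := hN (z, ξ) (x - z, 0)
  simpa [Prod.norm_def] using this

/-! ### Smooth cut-off functions -/

/-- A smooth function with values in `[0, 1]`, equal to `1` on the ball of radius `r` and supported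
in the ball of radius `2 r` around `c`. -/
def bump {d : ℕ} (c : E d) (r : ℝ) (hr : 0 < r) : ContDiffBump c :=
  ⟨r, 2 * r, hr, by linarith⟩

/-- `bump` as a Schwartz function. -/
def sbump {d : ℕ} (c : E d) (r : ℝ) (hr : 0 < r) : 𝓢(E d, ℂ) :=
  HasCompactSupport.toSchwartzMap (f := fun x => ((bump c r hr x : ℝ) : ℂ))
    ((bump c r hr).hasCompactSupport.comp_left Complex.ofReal_zero)
    (Complex.ofRealCLM.contDiff.comp (bump c r hr).contDiff)

section Bump

variable {d : ℕ} (c : E d) (r : ℝ) (hr : 0 < r)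

theorem sbump_apply (x : E d) : sbump c r hr x = ((bump c r hr x : ℝ) : ℂ) := rfl

theorem hasCompactSupport_sbump : HasCompactSupport (sbump c r hr) :=
  (bump c r hr).hasCompactSupport.comp_left Complex.ofReal_zero

theorem sbump_eq_one {x : E d} (hx : x ∈ Metric.closedBall c r) : sbump c r hr x = 1 := by
  rw [sbump_apply, (bump c r hr).one_of_mem_closedBall hx, Complex.ofReal_one]

theorem sbump_eq_zero {x : E d} (hx : 2 * r ≤ dist x c) : sbump c r hr x = 0 := by
  rw [sbump_apply, (bump c r hr).zero_of_le_dist hx, Complex.ofReal_zero]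

theorem tsupport_sbump_subset : tsupport (sbump c r hr) ⊆ Metric.closedBall c (2 * r) := by
  refine closure_minimal (fun x hx => ?_) Metric.isClosed_closedBall
  by_contra h
  exact hx (sbump_eq_zero c r hr (by simpa using (not_le.1 h).le))

end Bump

/-! ### The lattice `δ ℤᵈ` -/

/-- The lattice point `δ k`. -/
def latt {d : ℕ} (δ : ℝ) (k : Fin d → ℤ) : E d := WithLp.toLp 2 (fun i => δ * (k i : ℝ))

theorem summable_dec_latt {d M : ℕ} {δ : ℝ} (hδ : 0 < δ) (hM : d < M) :
    Summable (fun k : Fin d → ℤ => dec M (latt δ k)) := by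
  let b := (EuclideanSpace.basisFun (Fin d) ℝ).toBasis
  let L := Submodule.span ℤ (Set.range b)
  have hrank : Module.finrank ℤ L = d := by
    rw [ZLattice.rank ℝ L]; simp
  have h1 := ZLattice.summable_norm_pow_inv L M (by rw [hrank]; exact hM)
  have hmem : ∀ k : Fin d → ℤ, latt 1 k ∈ L := by
    intro k
    have : latt 1 k = ∑ i, k i • b i := by
      ext j
      simp [latt, b, Pi.single_apply]
    rw [this]
    exact Submodule.sum_mem _ fun i _ => Submodule.smul_mem _ _ (Submodule.subset_span ⟨i, rfl⟩)
  have hinj : Function.Injective (fun k : Fin d → ℤ => (⟨latt 1 k, hmem k⟩ : L)) := by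
    intro k l h
    have h' : latt 1 k = latt 1 l := congrArg Subtype.val h
    funext i
    have := congrArg (fun x : E d => x i) h'
    simpa [latt] using this
  have h2 := (h1.comp_injective hinj).mul_left ((δ⁻¹) ^ M)
  refine Summable.of_norm_bounded_eventually h2 ?_
  -- The comparison with ‖κ‖^{-M} fails only at the lattice point 0, hence a bound off a finite set.
  rw [Filter.eventually_cofinite]
  refine (Set.finite_singleton (0 : Fin d → ℤ)).subset fun k hk => ?_
  by_contra hk0
  refine hk ?_
  have hl : latt δ k = δ • latt 1 k := by ext j; simp [latt]
  have hne : latt 1 k ≠ 0 := by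
    intro h0
    refine hk0 (Set.mem_singleton_iff.2 (hinj (Subtype.ext ?_)))
    simp only [h0]
    ext j; simp [latt]
  have hp : 0 < ‖latt 1 k‖ := norm_pos_iff.2 hne
  rw [Real.norm_of_nonneg (dec_nonneg _ _), dec, hl, norm_smul, Real.norm_of_nonneg hδ.le]
  simp only [Function.comp_apply, Submodule.coe_norm]
  rw [← mul_pow, ← mul_inv, ← inv_pow]
  gcongr
  linarith

theorem norm_le_sum_abs {d : ℕ} (x : E d) : ‖x‖ ≤ ∑ i, |x i| := by
  conv_lhs => rw [← sum_coord_smul_unitVec x]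
  refine (norm_sum_le _ _).trans (Finset.sum_le_sum fun i _ => ?_)
  simp [norm_smul, unitVec]

theorem exists_latt_near {d : ℕ} (x : E d) : ∃ k : Fin d → ℤ, ‖x - latt 1 k‖ ≤ d := by
  refine ⟨fun i => round (x i), (norm_le_sum_abs _).trans ?_⟩
  calc ∑ i, |(x - latt 1 fun i => round (x i)) i| ≤ ∑ i : Fin d, (1 : ℝ) := by
        refine Finset.sum_le_sum fun i _ => ?_
        simp only [latt, one_mul, PiLp.sub_apply]
        exact (abs_sub_round (x i)).trans (by norm_num)
    _ = d := by simp

end FourierBF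

end

noncomputable section

namespace FourierBF

open scoped ContDiff

/-! ### Translation invariant BF-spaces -/

section BFSpace

variable {d : ℕ} {B : Type*} [NormedAddCommGroup B] [NormedSpace ℂ B]
  {v : E d → ℝ} {ι : B →ₗ[ℂ] (E d →ₘ[volume] ℂ)}

/-- The functional `f ↦ ∫ f φ` on `B`. -/
def IsInvariantBFSpace.pairingCLM (hB : IsInvariantBFSpace v ι) (φ : 𝓢(E d, ℂ)) : B →L[ℂ] ℂ where
  toFun f := ∫ x, ι f x * φ x
  map_add' f g := by
    rw [← integral_add (hB.integrable_pairing f φ) (hB.integrable_pairing g φ)]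
    refine integral_congr_ae ?_
    rw [map_add]
    filter_upwards [AEEqFun.coeFn_add (ι f) (ι g)] with x hx
    rw [hx, Pi.add_apply, add_mul]
  map_smul' c f := by
    rw [RingHom.id_apply, smul_eq_mul, ← integral_const_mul]
    refine integral_congr_ae ?_
    rw [map_smul]
    filter_upwards [AEEqFun.coeFn_smul c (ι f)] with x hx
    rw [hx, Pi.smul_apply, smul_eq_mul, mul_assoc]
  cont := hB.continuous_pairing φ

theorem IsInvariantBFSpace.locallyIntegrable (hB : IsInvariantBFSpace v ι) (f : B) :
    LocallyIntegrable (ι f) volume := by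
  rw [locallyIntegrable_iff]
  intro K hK
  obtain ⟨r, hr⟩ := hK.isBounded.subset_closedBall 0
  have hr1 : 0 < max r 1 := lt_max_of_lt_right one_pos
  refine ((hB.integrable_pairing f (sbump 0 (max r 1) hr1)).integrableOn (s := K)).congr ?_
  filter_upwards [ae_restrict_mem hK.measurableSet] with x hx
  rw [sbump_eq_one _ _ _ (Metric.closedBall_subset_closedBall (le_max_left _ _) (hr hx)), mul_one]

/-- The real number valued test function `g` as a Schwartz function. -/
theorem exists_schwartz_of_real {g : E d → ℝ} (hg : ContDiff ℝ ∞ g) (hs : HasCompactSupport g) :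
    ∃ φ : 𝓢(E d, ℂ), ∀ x, φ x = (g x : ℂ) :=
  ⟨HasCompactSupport.toSchwartzMap (f := fun x => (g x : ℂ)) (hs.comp_left Complex.ofReal_zero)
    (Complex.ofRealCLM.contDiff.comp hg), fun _ => rfl⟩

/-- Solidity places each absolute value |b k| in B with comparable norm, so these sum in B by
completeness. The point is that the abstract sum S is a.e. the pointwise sum; this is seen by
testing, since convergence in B implies convergence of the pairings. -/
theorem IsInvariantBFSpace.exists_enorm_tsum (hB : IsInvariantBFSpace v ι) {K : Type*} [Countable K]
    (b : K → B) (hb : Summable fun k => ‖b k‖) :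
    ∃ S : B, ∀ᵐ x, ∑' k, ‖ι (b k) x‖ₑ = ‖ι S x‖ₑ ∧ ι S x = (‖ι S x‖ : ℂ) := by
  have := hB.complete
  obtain ⟨C, hC⟩ := hB.solid
  have habs : ∀ f : B, ∃ f' : B, ι f' =ᵐ[volume] (fun x => ((‖ι f x‖ : ℝ) : ℂ)) ∧
      ‖f'‖ ≤ C * ‖f‖ := by
    intro f
    have hm : AEStronglyMeasurable (fun x => ((‖ι f x‖ : ℝ) : ℂ)) volume :=
      Complex.continuous_ofReal.comp_aestronglyMeasurable (ι f).aestronglyMeasurable.norm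
    obtain ⟨f', h1, h2⟩ := hC f (AEEqFun.mk _ hm) (by
      filter_upwards [AEEqFun.coeFn_mk _ hm] with x hx
      rw [hx]; simp)
    refine ⟨f', ?_, h2⟩
    rw [h1]
    exact AEEqFun.coeFn_mk _ hm
  choose a ha haC using habs
  have hsum : Summable fun k => ‖a (b k)‖ :=
    Summable.of_nonneg_of_le (fun _ => norm_nonneg _) (fun k => haC (b k)) (hb.mul_left C)
  have hS := hsum.of_norm.hasSum
  set S := ∑' k, a (b k)
  -- integrals against test functions
  have hint : ∀ φ : 𝓢(E d, ℂ), Summable fun k => ∫ x, ι (a (b k)) x * φ x := by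
    intro φ
    exact ((hB.pairingCLM φ).hasSum hS).summable
  have hnorm : ∀ (r : ℝ) (hr : 0 < r), Summable fun k => ∫ x, ‖ι (b k) x‖ * bump (0 : E d) r hr x := by
    intro r hr
    have h1 := hint (sbump 0 r hr)
    have h2 : (fun k => ∫ x, ι (a (b k)) x * sbump 0 r hr x) =
        fun k => ((∫ x, ‖ι (b k) x‖ * bump (0 : E d) r hr x : ℝ) : ℂ) := by
      funext k
      rw [← integral_complex_ofReal]
      refine integral_congr_ae ?_
      filter_upwards [ha (b k)] with x hx
      rw [hx, sbump_apply, Complex.ofReal_mul]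
    rw [h2] at h1
    exact_mod_cast Complex.summable_ofReal.1 h1
  have hintb : ∀ (r : ℝ) (hr : 0 < r) k, Integrable fun x => ‖ι (b k) x‖ * bump (0 : E d) r hr x := by
    intro r hr k
    refine (hB.integrable_pairing (b k) (sbump 0 r hr)).norm.congr (ae_of_all _ fun x => ?_)
    simp only [norm_mul, sbump_apply, Complex.norm_real, Real.norm_eq_abs,
      abs_of_nonneg (bump (0 : E d) r hr).nonneg]
  -- local integrability of the sum
  have hfin : ∀ r : ℝ, ∫⁻ x in Metric.closedBall (0 : E d) r, ∑' k, ‖ι (b k) x‖ₑ < ⊤ := by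
    intro r
    rw [lintegral_tsum fun k => (ι (b k)).aestronglyMeasurable.enorm.restrict]
    have hr1 : 0 < max r 1 := lt_max_of_lt_right one_pos
    have hle : ∀ k, ∫⁻ x in Metric.closedBall (0 : E d) r, ‖ι (b k) x‖ₑ ≤
        ENNReal.ofReal (∫ x, ‖ι (b k) x‖ * bump (0 : E d) (max r 1) hr1 x) := by
      intro k
      rw [ofReal_integral_eq_lintegral_ofReal (hintb _ hr1 k)
        (ae_of_all _ fun x => mul_nonneg (norm_nonneg _) (bump (0 : E d) _ hr1).nonneg)]
      refine le_trans ?_ (setLIntegral_le_lintegral (Metric.closedBall (0 : E d) r) _)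
      refine setLIntegral_mono' Metric.isClosed_closedBall.measurableSet fun x hx => ?_
      rw [(bump (0 : E d) _ hr1).one_of_mem_closedBall
        (Metric.closedBall_subset_closedBall (le_max_left _ _) hx), mul_one, ofReal_norm]
    refine (ENNReal.tsum_le_tsum hle).trans_lt ?_
    rw [← ENNReal.ofReal_tsum_of_nonneg (fun k => integral_nonneg fun x =>
      mul_nonneg (norm_nonneg _) (bump (0 : E d) _ hr1).nonneg) (hnorm _ hr1)]
    exact ENNReal.ofReal_lt_top
  have hmeas : AEMeasurable (fun x => ∑' k, ‖ι (b k) x‖ₑ) volume :=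
    AEMeasurable.tsum fun k => (ι (b k)).aestronglyMeasurable.enorm
  have haefin : ∀ᵐ x, ∑' k, ‖ι (b k) x‖ₑ < ⊤ := by
    have : ∀ n : ℕ, ∀ᵐ x, x ∈ Metric.closedBall (0 : E d) n → ∑' k, ‖ι (b k) x‖ₑ < ⊤ := by
      intro n
      rw [← ae_restrict_iff' Metric.isClosed_closedBall.measurableSet]
      exact ae_lt_top' hmeas.restrict (hfin n).ne
    filter_upwards [ae_all_iff.2 this] with x hx
    obtain ⟨n, hn⟩ := exists_nat_ge ‖x‖
    exact hx n (by simpa using hn)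
  let G : E d → ℝ := fun x => (∑' k, ‖ι (b k) x‖ₑ).toReal
  have hGm : AEStronglyMeasurable G volume := hmeas.ennreal_toReal.aestronglyMeasurable
  have hGsum : ∀ᵐ x, G x = ∑' k, ‖ι (b k) x‖ ∧ ENNReal.ofReal (G x) = ∑' k, ‖ι (b k) x‖ₑ := by
    filter_upwards [haefin] with x hx
    refine ⟨?_, ENNReal.ofReal_toReal hx.ne⟩
    simp only [G]
    rw [ENNReal.tsum_toReal_eq fun k => enorm_ne_top]
    simp
  have hGloc : LocallyIntegrable (fun x => (G x : ℂ)) volume := by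
    rw [locallyIntegrable_iff]
    intro K hK
    obtain ⟨r, hr⟩ := hK.isBounded.subset_closedBall 0
    refine IntegrableOn.mono_set ?_ hr
    refine ⟨(Complex.continuous_ofReal.comp_aestronglyMeasurable hGm).restrict, ?_⟩
    refine lt_of_le_of_lt (lintegral_mono_ae ?_) (hfin r)
    filter_upwards [ae_restrict_of_ae hGsum] with x hx
    rw [← ofReal_norm, Complex.norm_real, Real.norm_of_nonneg ENNReal.toReal_nonneg, hx.2]
  -- Two locally integrable functions with equal integrals against all test functions agree a.e. On
  -- one side the sum leaves the pairing by continuity on B, on the other by summability of the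
  -- integrals of absolute values.
  have hEq : ∀ᵐ x, ι S x = (G x : ℂ) := by
    refine ae_eq_of_integral_contDiff_smul_eq (hB.locallyIntegrable S) hGloc fun g hg hgs => ?_
    obtain ⟨φ, hφ⟩ := exists_schwartz_of_real hg hgs
    have h1 : ∫ x, g x • ι S x = hB.pairingCLM φ S := by
      refine integral_congr_ae (ae_of_all _ fun x => ?_)
      simp only [hφ, Complex.real_smul, mul_comm]
    rw [h1]
    refine ((hB.pairingCLM φ).hasSum hS).unique ?_
    obtain ⟨r, hr⟩ := hgs.isCompact.isBounded.subset_closedBall 0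
    have hr1 : 0 < max r 1 := lt_max_of_lt_right one_pos
    obtain ⟨M, hM⟩ := hgs.exists_bound_of_continuous hg.continuous
    have hM0 : 0 ≤ M := (norm_nonneg _).trans (hM 0)
    have hgb : ∀ x, |g x| ≤ M * bump (0 : E d) (max r 1) hr1 x := by
      intro x
      by_cases hx : x ∈ tsupport g
      · rw [(bump (0 : E d) _ hr1).one_of_mem_closedBall
          (Metric.closedBall_subset_closedBall (le_max_left _ _) (hr hx)), mul_one]
        exact hM x
      · rw [image_eq_zero_of_notMem_tsupport hx, abs_zero]
        exact mul_nonneg hM0 (bump (0 : E d) _ hr1).nonneg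
    have hsw := hasSum_integral_of_summable_integral_norm (μ := (volume : Measure (E d)))
      (F := fun k x => ι (a (b k)) x * φ x)
      (fun k => hB.integrable_pairing _ _) (by
        refine Summable.of_nonneg_of_le (fun k => integral_nonneg fun x => norm_nonneg _)
          (fun k => ?_) ((hnorm _ hr1).mul_left M)
        rw [← integral_const_mul]
        refine integral_mono_ae (hB.integrable_pairing _ _).norm ((hintb _ hr1 k).const_mul M) ?_
        filter_upwards [ha (b k)] with x hx
        simp only [hx, hφ, norm_mul, Complex.norm_real, Real.norm_eq_abs, abs_norm]
        calc ‖ι (b k) x‖ * |g x| ≤ ‖ι (b k) x‖ * (M * bump (0 : E d) (max r 1) hr1 x) := by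
              gcongr; exact hgb x
          _ = _ := by ring)
    suffices e : ∫ x, g x • (G x : ℂ) = ∫ x, ∑' k, ι (a (b k)) x * φ x by rw [e]; exact hsw
    refine integral_congr_ae ?_
    filter_upwards [hGsum, ae_all_iff.2 fun k => ha (b k)] with x hx hak
    simp only [hak, hφ]
    rw [tsum_mul_right, hx.1, Complex.ofReal_tsum, Complex.real_smul, mul_comm]
  refine ⟨S, ?_⟩
  filter_upwards [hEq, hGsum] with x hx hGx
  have hn : ‖ι S x‖ = G x := by
    rw [hx, Complex.norm_real, Real.norm_of_nonneg ENNReal.toReal_nonneg]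
  exact ⟨by rw [← ofReal_norm, hn, hGx.2], by rw [hn]; exact hx⟩

theorem IsInvariantBFSpace.exists_of_enorm_le_tsum (hB : IsInvariantBFSpace v ι) {K : Type*}
    [Countable K] (b : K → B) (hb : Summable fun k => ‖b k‖) {H : E d → ℂ}
    (hH : AEStronglyMeasurable H volume) (hle : ∀ᵐ x, ‖H x‖ₑ ≤ ∑' k, ‖ι (b k) x‖ₑ) :
    ∃ h : B, ι h =ᵐ[volume] H := by
  obtain ⟨S, hS⟩ := hB.exists_enorm_tsum b hb
  obtain ⟨C, hC⟩ := hB.solid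
  obtain ⟨f, hf, -⟩ := hC S (AEEqFun.mk H hH) (by
    filter_upwards [AEEqFun.coeFn_mk H hH, hle, hS] with x h1 h2 h3
    rw [h1, ← enorm_le_iff_norm_le, ← h3.1]
    exact h2)
  exact ⟨f, by rw [hf]; exact AEEqFun.coeFn_mk H hH⟩

theorem IsInvariantBFSpace.exists_of_norm_le_add (hB : IsInvariantBFSpace v ι) (b₁ b₂ : B)
    {H : E d → ℂ} (hH : AEStronglyMeasurable H volume)
    (hle : ∀ᵐ x, ‖H x‖ₑ ≤ ‖ι b₁ x‖ₑ + ‖ι b₂ x‖ₑ) : ∃ h : B, ι h =ᵐ[volume] H := by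
  refine hB.exists_of_enorm_le_tsum (fun k : Bool => bif k then b₁ else b₂) .of_finite hH ?_
  filter_upwards [hle] with x hx
  simpa [tsum_bool, add_comm] using hx

theorem IsInvariantBFSpace.exists_of_norm_le (hB : IsInvariantBFSpace v ι) (b : B)
    {H : E d → ℂ} (hH : AEStronglyMeasurable H volume) (c : ℝ)
    (hle : ∀ᵐ x, ‖H x‖ ≤ c * ‖ι b x‖) : ∃ h : B, ι h =ᵐ[volume] H := by
  refine hB.exists_of_norm_le_add ((c : ℂ) • b) 0 hH ?_
  rw [map_smul]
  filter_upwards [hle, AEEqFun.coeFn_smul (c : ℂ) (ι b)] with x hx h2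
  refine le_add_right ?_
  rw [h2, enorm_le_iff_norm_le, Pi.smul_apply, norm_smul, Complex.norm_real]
  exact hx.trans (mul_le_mul_of_nonneg_right (le_abs_self c) (norm_nonneg _))

/-- The integer translates of one bump cover ℝᵈ, and their norms in B grow at most polynomially, so
a weighted sum of them dominates `dec M`. -/
theorem IsInvariantBFSpace.exists_dec (hB : IsInvariantBFSpace v ι) :
    ∃ M₀ : ℕ, ∀ M ≥ M₀, ∃ b : B, ι b =ᵐ[volume] fun ξ => ((dec M ξ : ℝ) : ℂ) := by
  obtain ⟨N, C, hC, hN⟩ := hB.weight.polyModerate.exists_le_pow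
  obtain ⟨C', hC'⟩ := hB.translation
  obtain ⟨J, hJ⟩ := hB.schwartz_le
  -- N offsets the growth of v along the lattice, and d + 1 makes the lattice sum converge.
  refine ⟨N + (d + 1), fun M hM => ?_⟩
  have hd : (0 : ℝ) < d + 1 := by positivity
  let β := sbump (0 : E d) (d + 1) hd
  choose g hg hgC using fun k : Fin d → ℤ => hC' (latt 1 k) (J β)
  -- The loss in Peetre's inequality between x and a lattice point at distance at most d.
  let c : ℝ := ((d : ℝ) + 1) ^ M
  let b : (Fin d → ℤ) → B := fun k => ((c * dec M (latt 1 k : E d) : ℝ) : ℂ) • g k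
  have hsum : Summable fun k => ‖b k‖ := by
    refine Summable.of_nonneg_of_le (fun _ => norm_nonneg _) (fun k => ?_)
      ((summable_dec_latt (d := d) one_pos (Nat.lt_succ_self d)).mul_left
        (c * |C'| * C * ‖J β‖))
    have h1 : 0 < v (latt 1 k) := hB.weight.polyModerate.pos _
    simp only [b]
    rw [norm_smul, Complex.norm_real, Real.norm_of_nonneg
      (mul_nonneg (by positivity) (dec_nonneg _ _))]
    calc c * dec M (latt 1 k : E d) * ‖g k‖
        ≤ c * dec (N + (d + 1)) (latt 1 k : E d) * (|C'| * (C * (1 + ‖(latt 1 k : E d)‖) ^ N) * ‖J β‖) := by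
          refine mul_le_mul ?_ ((hgC k).trans ?_) (norm_nonneg _) (mul_nonneg (by positivity) (dec_nonneg _ _))
          · exact mul_le_mul_of_nonneg_left (dec_anti hM _) (by positivity)
          · refine mul_le_mul_of_nonneg_right ?_ (norm_nonneg _)
            exact mul_le_mul (le_abs_self _) (hN _) h1.le (abs_nonneg _)
      _ = c * |C'| * C * ‖J β‖ * (dec (d + 1 + N) (latt 1 k : E d) * (1 + ‖(latt 1 k : E d)‖) ^ N) := by
          rw [add_comm N]; ring
      _ = _ := by rw [dec_add_mul_pow]
  refine hB.exists_of_enorm_le_tsum b hsum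
    (Complex.continuous_ofReal.comp (continuous_dec M)).aestronglyMeasurable ?_
  have htr : ∀ k, ∀ᵐ x, ι (J β) (x - latt 1 k) = β (x - latt 1 k) := fun k =>
    (measurePreserving_sub_right volume (latt 1 k)).quasiMeasurePreserving.ae (hJ β)
  filter_upwards [ae_all_iff.2 hg, ae_all_iff.2 htr, ae_all_iff.2 fun k =>
    AEEqFun.coeFn_smul ((c * dec M (latt 1 k : E d) : ℝ) : ℂ) (ι (g k))] with x h1 h2 h3
  obtain ⟨k, hk⟩ := exists_latt_near x
  refine le_trans ?_ (ENNReal.le_tsum k)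
  simp only [b, map_smul, h3, Pi.smul_apply, h1, h2]
  rw [enorm_le_iff_norm_le, smul_eq_mul, show β (x - latt 1 k) = 1 from
    sbump_eq_one _ _ _ (by simpa using hk.trans (by linarith)), mul_one, Complex.norm_real,
    Complex.norm_real, Real.norm_of_nonneg (dec_nonneg _ _),
    Real.norm_of_nonneg (mul_nonneg (by positivity) (dec_nonneg _ _))]
  calc dec M x = dec M (latt 1 k - (latt 1 k - x)) := by congr 1; abel
    _ ≤ dec M (latt 1 k : E d) * (1 + ‖latt 1 k - x‖) ^ M := dec_le_of_sub _ _ _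
    _ ≤ dec M (latt 1 k : E d) * ((d : ℝ) + 1) ^ M := by
        have := dec_nonneg M (latt 1 k : E d)
        rw [norm_sub_rev, add_comm (d : ℝ)]
        gcongr
    _ = _ := mul_comm _ _

/-- The closed cone `Γ₁` lies in the interior of `Γ` uniformly. -/
def ConeInside {d : ℕ} (Γ₁ Γ : Set (E d)) : Prop :=
  ∃ ε > 0, ε ≤ 1 ∧ ∀ ξ ∈ Γ₁, ∀ η, ‖η‖ < ε * ‖ξ‖ → ξ - η ∈ Γ

/-- Γ₁ is the cone over a small ball around ξ₀. A ball of twice the radius still generates a subcone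
of Γ, and homogeneity turns the margin into a multiple of |ξ|. -/
theorem exists_coneInside {Γ : Set (E d)} (hΓ : IsOpenCone Γ) {ξ₀ : E d} (hξ : ξ₀ ∈ Γ) :
    ∃ Γ₁ : Set (E d), IsOpenCone Γ₁ ∧ ξ₀ ∈ Γ₁ ∧ Γ₁ ⊆ Γ ∧ ConeInside Γ₁ Γ := by
  have h0 : ξ₀ ≠ 0 := fun h => hΓ.zero_notMem (h ▸ hξ)
  have hp : 0 < ‖ξ₀‖ := norm_pos_iff.2 h0
  obtain ⟨r', hr', hball⟩ := Metric.isOpen_iff.1 hΓ.isOpen ξ₀ hξ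
  -- The first bound leaves a margin r for the perturbation; the second keeps 0 out of the ball and
  -- its points of norm at most 2‖ξ₀‖, whence ε = r / (2‖ξ₀‖).
  let r := min (r' / 2) (‖ξ₀‖ / 2)
  have hr : 0 < r := by positivity
  have hr1 : r ≤ r' / 2 := min_le_left _ _
  have hr2 : r ≤ ‖ξ₀‖ / 2 := min_le_right _ _
  have hmem : ∀ (t : ℝ) (ht : 0 < t) (y : E d), ‖y - ξ₀‖ < r' → t • y ∈ Γ := fun t ht y hy =>
    hΓ.smul_mem t ht y (hball (by simpa [dist_eq_norm] using hy))
  refine ⟨{ξ | ∃ t : ℝ, 0 < t ∧ t • ξ ∈ Metric.ball ξ₀ r}, ⟨?_, ?_, ?_⟩, ⟨1, one_pos, by simpa using hr⟩,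
    ?_, r / (2 * ‖ξ₀‖), by positivity, ?_, ?_⟩
  · have : {ξ : E d | ∃ t : ℝ, 0 < t ∧ t • ξ ∈ Metric.ball ξ₀ r} =
        ⋃ t : {t : ℝ // 0 < t}, (fun ξ : E d => t.1 • ξ) ⁻¹' Metric.ball ξ₀ r := by
      ext ξ; simp
    rw [this]
    exact isOpen_iUnion fun t => Metric.isOpen_ball.preimage (continuous_const_smul t.1)
  · rintro ⟨t, -, ht⟩
    rw [smul_zero, Metric.mem_ball, dist_eq_norm, zero_sub, norm_neg] at ht
    linarith
  · rintro t ht ξ ⟨s, hs, h⟩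
    refine ⟨s / t, by positivity, ?_⟩
    rwa [smul_smul, div_mul_cancel₀ _ ht.ne']
  · rintro ξ ⟨t, ht, h⟩
    rw [Metric.mem_ball, dist_eq_norm] at h
    have := hmem t⁻¹ (by positivity) (t • ξ) (by linarith)
    rwa [smul_smul, inv_mul_cancel₀ ht.ne', one_smul] at this
  · rw [div_le_one (by positivity)]; linarith
  · rintro ξ ⟨t, ht, h⟩ η hη
    rw [Metric.mem_ball, dist_eq_norm] at h
    have hn : ‖t • ξ‖ ≤ 2 * ‖ξ₀‖ := by
      have := norm_sub_norm_le (t • ξ) ξ₀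
      linarith
    have hη' : ‖t • η‖ < r := by
      rw [norm_smul, Real.norm_of_nonneg ht.le] at hn ⊢
      calc t * ‖η‖ < t * (r / (2 * ‖ξ₀‖) * ‖ξ‖) := by gcongr
        _ = r / (2 * ‖ξ₀‖) * (t * ‖ξ‖) := by ring
        _ ≤ r / (2 * ‖ξ₀‖) * (2 * ‖ξ₀‖) := by gcongr
        _ = r := by field_simp
    have := hmem t⁻¹ (by positivity) (t • (ξ - η)) (by
      rw [smul_sub, sub_right_comm]
      have := norm_sub_le (t • ξ - ξ₀) (t • η)
      linarith)
    rwa [smul_smul, inv_mul_cancel₀ ht.ne', one_smul] at this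

/-- Although G is known to be in B only on Γ, sums of its translates can be controlled on the
smaller cone Γ₁. If |κ| < ε|ξ|, then ξ − κ lies in Γ and the term is a translate of b; otherwise the
coefficient decays in |ξ| as well and outweighs the polynomial growth of G. -/
theorem IsInvariantBFSpace.exists_of_le_lattice (hB : IsInvariantBFSpace v ι) {Γ₁ Γ : Set (E d)}
    (hΓ₁ : IsOpenCone Γ₁) (hΓ : ConeInside Γ₁ Γ) {δ : ℝ} (hδ : 0 < δ) {G : E d → ℂ} {N : ℕ} {C : ℝ}
    (hGC : ∀ ξ, ‖G ξ‖ ≤ C * (1 + ‖ξ‖) ^ N) {b : B} (hb : ι b =ᵐ[volume] Γ.indicator G) :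
    ∃ M₀ : ℕ, ∀ M ≥ M₀, ∀ (H : E d → ℂ) (c : ℝ), AEStronglyMeasurable H volume →
      (∀ ξ ∈ Γ₁, ‖H ξ‖ₑ ≤ ∑' k : Fin d → ℤ,
        ENNReal.ofReal (c * dec M (latt δ k : E d)) * ‖G (ξ - latt δ k)‖ₑ) →
      ∃ h : B, ι h =ᵐ[volume] Γ₁.indicator H := by
  obtain ⟨ε, hε, hε1, hcone⟩ := hΓ
  obtain ⟨Nv, Cv, hCv, hNv⟩ := hB.weight.polyModerate.exists_le_pow
  obtain ⟨C', hC'⟩ := hB.translation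
  obtain ⟨MB, hMB⟩ := hB.exists_dec
  obtain ⟨r, hr⟩ := hMB MB le_rfl
  -- For far terms, MB + N gives an element of B and cancels (1 + |ξ|)^N, while d + 1 + N sums over
  -- κ and cancels (1 + |κ|)^N. For near terms, Nv pays for the norms of the translations.
  refine ⟨MB + N + (d + 1 + N) + Nv, fun M hM H c hH hle => ?_⟩
  choose g hg hgC using fun k : Fin d → ℤ => hC' (latt δ k) b
  have hC0 : 0 ≤ C := by simpa using (norm_nonneg _).trans (hGC 0)
  let bk : (Fin d → ℤ) → B := fun k => ((|c| * dec M (latt δ k : E d) : ℝ) : ℂ) • g k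
  have hdd := summable_dec_latt (d := d) hδ (Nat.lt_succ_self d)
  have hsum : Summable fun k => ‖bk k‖ := by
    refine Summable.of_nonneg_of_le (fun _ => norm_nonneg _) (fun k => ?_)
      (hdd.mul_left (|c| * |C'| * Cv * ‖b‖))
    have h1 : 0 < v (latt δ k) := hB.weight.polyModerate.pos _
    simp only [bk]
    rw [norm_smul, Complex.norm_real, Real.norm_of_nonneg
      (mul_nonneg (by positivity) (dec_nonneg _ _))]
    calc |c| * dec M (latt δ k : E d) * ‖g k‖
        ≤ |c| * dec (d + 1 + Nv) (latt δ k : E d) * (|C'| * (Cv * (1 + ‖(latt δ k : E d)‖) ^ Nv) * ‖b‖) := by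
          refine mul_le_mul ?_ ((hgC k).trans ?_) (norm_nonneg _) (mul_nonneg (by positivity) (dec_nonneg _ _))
          · exact mul_le_mul_of_nonneg_left (dec_anti (by omega) _) (by positivity)
          · refine mul_le_mul_of_nonneg_right ?_ (norm_nonneg _)
            exact mul_le_mul (le_abs_self _) (hNv _) h1.le (abs_nonneg _)
      _ = |c| * |C'| * Cv * ‖b‖ * (dec (d + 1 + Nv) (latt δ k : E d) * (1 + ‖(latt δ k : E d)‖) ^ Nv) := by
          ring
      _ = _ := by rw [dec_add_mul_pow]
  obtain ⟨S, hS⟩ := hB.exists_enorm_tsum bk hsum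
  let A : ℝ := |c| * C * (2 * ε⁻¹) ^ (MB + N) * ∑' k : Fin d → ℤ, dec (d + 1) (latt δ k : E d)
  have hA0 : 0 ≤ ∑' k : Fin d → ℤ, dec (d + 1) (latt δ k : E d) := tsum_nonneg fun k => dec_nonneg _ _
  refine hB.exists_of_norm_le_add S ((A : ℂ) • r) (hH.indicator hΓ₁.isOpen.measurableSet) ?_
  have htr : ∀ k, ∀ᵐ x, ι b (x - latt δ k) = Γ.indicator G (x - latt δ k) := fun k =>
    (measurePreserving_sub_right volume (latt δ k)).quasiMeasurePreserving.ae hb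
  filter_upwards [hS, hr, ae_all_iff.2 hg, ae_all_iff.2 htr, AEEqFun.coeFn_smul (A : ℂ) (ι r),
    ae_all_iff.2 fun k => AEEqFun.coeFn_smul ((|c| * dec M (latt δ k : E d) : ℝ) : ℂ) (ι (g k))]
    with ξ h1 h2 h3 h4 h5 h6
  by_cases hξ : ξ ∈ Γ₁
  swap
  · simp [Set.indicator_of_notMem hξ]
  rw [Set.indicator_of_mem hξ, ← h1.1, map_smul, h5, Pi.smul_apply, h2]
  have hr2 : ‖(A : ℂ) • ((dec MB ξ : ℝ) : ℂ)‖ₑ = ∑' k : Fin d → ℤ,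
      ENNReal.ofReal (|c| * C * (2 * ε⁻¹) ^ (MB + N) * dec MB ξ * dec (d + 1) (latt δ k : E d)) := by
    rw [← ENNReal.ofReal_tsum_of_nonneg, tsum_mul_left, ← ofReal_norm, norm_smul, Complex.norm_real,
      Complex.norm_real, Real.norm_of_nonneg (dec_nonneg _ _), Real.norm_of_nonneg]
    · congr 1; simp only [A]; ring
    · positivity
    · intro k
      have := dec_nonneg MB ξ
      have := dec_nonneg (d + 1) (latt δ k : E d)
      positivity
    · exact hdd.mul_left _
  rw [hr2, ← ENNReal.tsum_add]
  refine (hle ξ hξ).trans (ENNReal.tsum_le_tsum fun k => ?_)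
  have hcc : c * dec M (latt δ k : E d) ≤ |c| * dec M (latt δ k : E d) :=
    mul_le_mul_of_nonneg_right (le_abs_self c) (dec_nonneg _ _)
  -- Near terms go into the sum S of translates of b, far terms into the multiple A of the decaying
  -- element r.
  by_cases hk : ‖(latt δ k : E d)‖ < ε * ‖ξ‖
  · refine le_add_right ?_
    simp only [bk, map_smul, h6, Pi.smul_apply, h3, h4]
    rw [Set.indicator_of_mem (hcone ξ hξ _ hk), enorm_smul,
      ← ofReal_norm ((|c| * dec M (latt δ k : E d) : ℝ) : ℂ), Complex.norm_real,
      Real.norm_of_nonneg (mul_nonneg (abs_nonneg _) (dec_nonneg _ _))]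
    gcongr
  · refine le_add_left ?_
    rw [← ofReal_norm, ← ENNReal.ofReal_mul' (norm_nonneg _)]
    refine ENNReal.ofReal_le_ofReal ?_
    rw [not_lt] at hk
    set κ : E d := latt δ k
    have hξκ : 1 + ‖ξ‖ ≤ 2 * ε⁻¹ * (1 + ‖κ‖) := by
      have h1 : ‖ξ‖ ≤ ε⁻¹ * ‖κ‖ := by
        rw [le_inv_mul_iff₀ hε]; exact hk
      have h2 : 1 ≤ ε⁻¹ := (one_le_inv₀ hε).2 hε1
      have : 0 ≤ ‖κ‖ := norm_nonneg _
      nlinarith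
    have hd1 : dec (MB + N) κ ≤ (2 * ε⁻¹) ^ (MB + N) * dec (MB + N) ξ := by
      unfold dec
      rw [← div_eq_mul_inv, le_div_iff₀ (by positivity), inv_mul_le_iff₀ (by positivity), ← mul_pow,
        mul_comm]
      gcongr
    calc c * dec M κ * ‖G (ξ - κ)‖
        ≤ |c| * dec (MB + N + (d + 1 + N)) κ * (C * ((1 + ‖ξ‖) ^ N * (1 + ‖κ‖) ^ N)) := by
          refine mul_le_mul (hcc.trans ?_) ((hGC _).trans ?_) (norm_nonneg _)
            (mul_nonneg (abs_nonneg _) (dec_nonneg _ _))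
          · exact mul_le_mul_of_nonneg_left (dec_anti (by omega) _) (abs_nonneg _)
          · exact mul_le_mul_of_nonneg_left (one_add_norm_sub_pow_le _ _ _) hC0
      _ = |c| * C * (dec (MB + N) κ * (dec (d + 1 + N) κ * (1 + ‖κ‖) ^ N) * (1 + ‖ξ‖) ^ N) := by
          rw [dec_add (MB + N)]; ring
      _ = |c| * C * (dec (MB + N) κ * dec (d + 1) κ * (1 + ‖ξ‖) ^ N) := by rw [dec_add_mul_pow]
      _ ≤ |c| * C * (((2 * ε⁻¹) ^ (MB + N) * dec (MB + N) ξ) * dec (d + 1) κ * (1 + ‖ξ‖) ^ N) := by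
          have := dec_nonneg (d + 1) κ
          gcongr
      _ = |c| * C * (2 * ε⁻¹) ^ (MB + N) * (dec (MB + N) ξ * (1 + ‖ξ‖) ^ N) * dec (d + 1) κ := by ring
      _ = _ := by rw [dec_add_mul_pow]

end BFSpace

end FourierBF

end

noncomputable section

namespace FourierBF

open scoped ContDiff FourierTransform

/-! ### The Fourier transform on `𝒮` -/

section Fourier

variable {d : ℕ}

/-- The character `e^{i⟨x, ξ⟩}`. -/
def chr (x ξ : E d) : ℂ := Complex.exp (Complex.I * ((inner ℝ x ξ : ℝ) : ℂ))

theorem norm_chr (x ξ : E d) : ‖chr x ξ‖ = 1 := by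
  rw [chr, mul_comm, Complex.norm_exp_ofReal_mul_I]

theorem chr_comm (x ξ : E d) : chr x ξ = chr ξ x := by rw [chr, chr, real_inner_comm]

theorem chr_add (x ξ η : E d) : chr x (ξ + η) = chr x ξ * chr x η := by
  rw [chr, chr, chr, inner_add_right, ← Complex.exp_add]; push_cast; ring_nf

theorem chr_add_left (x y ξ : E d) : chr (x + y) ξ = chr x ξ * chr y ξ := by
  rw [chr_comm, chr_add, chr_comm ξ x, chr_comm ξ y]

theorem chr_zero (x : E d) : chr x 0 = 1 := by simp [chr]

theorem chr_neg_right (x ξ : E d) : chr x (-ξ) = Complex.exp (-Complex.I * ((inner ℝ x ξ : ℝ) : ℂ)) := by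
  rw [chr, inner_neg_right]; push_cast; ring_nf

theorem chr_neg_left (x ξ : E d) : chr (-x) ξ = chr x (-ξ) := by
  simp [chr]

theorem continuous_chr : Continuous fun p : E d × E d => chr p.1 p.2 := by
  unfold chr; fun_prop

@[fun_prop]
theorem Continuous.chr {X : Type*} [TopologicalSpace X] {f g : X → E d} (hf : Continuous f)
    (hg : Continuous g) : Continuous fun x => chr (f x) (g x) :=
  continuous_chr.comp (hf.prodMk hg)

@[fun_prop]
theorem contDiff_chr {X : Type*} [NormedAddCommGroup X] [NormedSpace ℝ X] {f g : X → E d}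
    (hf : ContDiff ℝ ∞ f) (hg : ContDiff ℝ ∞ g) : ContDiff ℝ ∞ fun x => chr (f x) (g x) := by
  unfold FourierBF.chr
  exact Complex.contDiff_exp.comp (contDiff_const.mul
    (Complex.ofRealCLM.contDiff.comp (hf.inner ℝ hg)))

/-- Multiplication of the argument by a nonzero number. -/
def scaleEquiv (c : ℝ) (hc : c ≠ 0) : E d ≃L[ℝ] E d :=
  ContinuousLinearEquiv.smulLeft (Units.mk0 c hc)

theorem scaleEquiv_apply (c : ℝ) (hc : c ≠ 0) (x : E d) : scaleEquiv c hc x = c • x := rfl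

theorem two_pi_inv_ne_zero : (2 * Real.pi)⁻¹ ≠ 0 := inv_ne_zero Real.two_pi_pos.ne'

/-- The Fourier transform `φ ↦ ∫ φ(x) e^{-i⟨x, ξ⟩} dx`. -/
def FS : 𝓢(E d, ℂ) →L[ℂ] 𝓢(E d, ℂ) :=
  (SchwartzMap.compCLMOfContinuousLinearEquiv ℂ (scaleEquiv _ two_pi_inv_ne_zero)).comp
    (SchwartzMap.fourierTransformCLM ℂ)

theorem FS_apply (φ : 𝓢(E d, ℂ)) (ξ : E d) : FS φ ξ = ∫ x, φ x * chr x (-ξ) := by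
  simp only [FS, ContinuousLinearMap.comp_apply, SchwartzMap.compCLMOfContinuousLinearEquiv_apply,
    Function.comp_apply, scaleEquiv_apply, SchwartzMap.fourierTransformCLM_apply,
    SchwartzMap.fourier_coe]
  rw [Real.fourier_eq']
  refine integral_congr_ae (ae_of_all _ fun x => ?_)
  simp only [chr, inner_neg_right, inner_smul_right, smul_eq_mul]
  rw [mul_comm]
  congr 2
  push_cast
  field_simp

theorem schwartz_mul_integrable (φ : 𝓢(E d, ℂ)) {g : E d → ℂ} (hg : Continuous g) {C : ℝ}
    (hC : ∀ x, ‖g x‖ ≤ C) : Integrable fun x => φ x * g x :=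
  (φ.integrable (μ := volume)).mul_bdd (c := C) hg.aestronglyMeasurable (ae_of_all _ hC)

theorem integrable_schwartz_mul_chr (φ : 𝓢(E d, ℂ)) (ξ : E d) :
    Integrable fun x => φ x * chr x ξ :=
  schwartz_mul_integrable φ (by fun_prop) (fun x => (norm_chr x ξ).le)

/-- Fourier inversion. -/
theorem integral_FS_mul_chr (φ : 𝓢(E d, ℂ)) (x : E d) :
    ∫ ξ, FS φ ξ * chr x ξ = (((2 * Real.pi) ^ d : ℝ) : ℂ) * φ x := by
  have h : 𝓕⁻ (𝓕 φ) = φ := FourierTransform.fourierInv_fourier_eq φ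
  have h1 := congrArg (fun ψ : 𝓢(E d, ℂ) => ψ x) h
  simp only [SchwartzMap.fourierInv_coe, Real.fourierInv_eq'] at h1
  rw [← h1]
  have h2 := Measure.integral_comp_inv_smul (volume : Measure (E d))
    (fun ξ => Complex.exp ((2 * Real.pi * inner ℝ ξ x : ℝ) * Complex.I) • (𝓕 φ) ξ) (2 * Real.pi)
  rw [finrank_euclideanSpace_fin, abs_of_nonneg (by positivity), Complex.real_smul] at h2
  rw [← h2]
  refine integral_congr_ae (ae_of_all _ fun ξ => ?_)
  simp only [FS, ContinuousLinearMap.comp_apply, SchwartzMap.compCLMOfContinuousLinearEquiv_apply,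
    Function.comp_apply, scaleEquiv_apply, SchwartzMap.fourierTransformCLM_apply, chr, smul_eq_mul,
    inner_smul_left]
  rw [mul_comm]
  congr 2
  rw [real_inner_comm]
  push_cast
  simp
  field_simp

/-- The Fourier transform can be moved from one factor to the other. -/
theorem integral_FS_mul (φ ψ : 𝓢(E d, ℂ)) : ∫ ξ, FS φ ξ * ψ ξ = ∫ x, φ x * FS ψ x := by
  simp_rw [FS_apply, ← integral_mul_const, ← integral_const_mul]
  rw [integral_integral_swap]
  · refine integral_congr_ae (ae_of_all _ fun x => integral_congr_ae (ae_of_all _ fun ξ => ?_))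
    simp only [chr, inner_neg_right, real_inner_comm]; ring
  · have h := (φ.integrable (μ := volume)).mul_prod (ψ.integrable (μ := volume))
    have h' := h.swap.mul_bdd (c := 1) (g := fun p : E d × E d => chr p.2 (-p.1))
      (by fun_prop) (ae_of_all _ fun p => (norm_chr _ _).le)
    refine h'.congr (ae_of_all _ fun p => ?_)
    simp only [Function.uncurry, Function.comp_apply, Prod.fst_swap, Prod.snd_swap]
    ring

theorem exists_norm_le_dec (φ : 𝓢(E d, ℂ)) (M : ℕ) : ∃ C : ℝ, 0 ≤ C ∧ ∀ x, ‖φ x‖ ≤ C * dec M x := by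
  have h := fun x => SchwartzMap.one_add_le_sup_seminorm_apply (𝕜 := ℂ) (m := (M, 0)) (k := M) (n := 0)
    le_rfl le_rfl φ x
  simp only [norm_iteratedFDeriv_zero] at h
  refine ⟨2 ^ M * ((Finset.Iic (M, 0)).sup fun m => SchwartzMap.seminorm ℂ m.1 m.2) φ,
    (by positivity : (0 : ℝ) ≤ (1 + ‖(0 : E d)‖) ^ M * ‖φ 0‖).trans (h 0), fun x => ?_⟩
  rw [dec, ← div_eq_mul_inv, le_div_iff₀ (by positivity), mul_comm]
  exact h x

/-! ### Fourier series of functions with compact support -/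

/-- u is supported in a ball of radius r and is repeated with period 4r in each coordinate. The room
between r and 2r makes the periodic function continuous, and its Fourier coefficients are samples of
the Fourier transform of u on the dual lattice (π/2r)ℤᵈ. -/
theorem hasSum_fourierSeries {u : E d → ℂ} (hu : Continuous u) {r : ℝ} (hr : 0 < r)
    (hur : ∀ x, r ≤ ‖x‖ → u x = 0)
    (hs : Summable fun k : Fin d → ℤ => ∫ x, u x * chr x (-latt (Real.pi / (2 * r)) k)) {x : E d}
    (hx : ‖x‖ < 2 * r) :
    HasSum (fun k : Fin d → ℤ => (((4 * r) ^ d : ℝ) : ℂ)⁻¹ *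
      (∫ y, u y * chr y (-latt (Real.pi / (2 * r)) k)) * chr x (latt (Real.pi / (2 * r)) k)) (u x) := by
  have hcoord : ∀ (x : E d) i, |x i| ≤ ‖x‖ := fun x i => by
    simpa using PiLp.norm_apply_le x i
  let rep : UnitAddCircle → ℝ := fun t => (AddCircle.equivIoc 1 (-(1 / 2)) t : ℝ)
  have hrep : ∀ t : UnitAddCircle, (rep t : UnitAddCircle) = t ∧ |rep t| = ‖t‖ := by
    intro t
    have h1 : (rep t : UnitAddCircle) = t := (AddCircle.equivIoc 1 (-(1 / 2) : ℝ)).symm_apply_apply t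
    refine ⟨h1, ?_⟩
    conv_rhs => rw [← h1]
    refine (AddCircle.norm_coe_eq_abs_iff (p := (1 : ℝ)) one_ne_zero |>.2 ?_).symm
    have := (AddCircle.equivIoc 1 (-(1 / 2) : ℝ) t).2
    rw [abs_le, abs_one]
    exact ⟨by linarith [this.1], by linarith [this.2]⟩
  have hrepcoe : ∀ y : ℝ, y ∈ Ioc (-(1 / 2) : ℝ) (-(1 / 2) + 1) → rep (y : UnitAddCircle) = y := by
    intro y hy
    have := (AddCircle.equivIoc 1 (-(1 / 2) : ℝ)).apply_symm_apply ⟨y, hy⟩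
    exact congrArg Subtype.val this
  let up : (Fin d → ℝ) → E d := fun y => WithLp.toLp 2 fun i => 4 * r * y i
  let F : UnitAddTorus (Fin d) → ℂ := fun t => u (up fun i => rep (t i))
  have hF : Continuous F := by
    rw [continuous_iff_continuousAt]
    intro t
    -- The representative jumps only at 1/2. If some coordinate exceeds 1/4 in norm, the point lies
    -- outside the ball of radius r and u vanishes nearby; otherwise all coordinates stay away from
    -- the jump.
    by_cases ht : ∃ i, 1 / 4 < ‖t i‖
    · obtain ⟨i, hi⟩ := ht
      have hop : IsOpen {s : UnitAddTorus (Fin d) | 1 / 4 < ‖s i‖} :=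
        isOpen_lt continuous_const (continuous_norm.comp (continuous_apply i))
      have : F =ᶠ[nhds t] fun _ => 0 := by
        filter_upwards [hop.mem_nhds hi] with s hs
        refine hur _ (le_trans ?_ (hcoord _ i))
        simp only [up, abs_mul, (hrep _).2]
        rw [abs_of_pos (by positivity : (0 : ℝ) < 4), abs_of_pos hr]
        have : 1 / 4 < ‖s i‖ := hs
        nlinarith
      exact continuousAt_const.congr this.symm
    · push Not at ht
      refine hu.continuousAt.comp ?_
      have : ∀ i, ContinuousAt (fun s : UnitAddTorus (Fin d) => rep (s i)) t := by
        intro i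
        have h1 : t i ≠ ((-(1 / 2) : ℝ) : UnitAddCircle) := by
          intro h
          have h2 := ht i
          rw [h, (AddCircle.norm_coe_eq_abs_iff (p := (1 : ℝ)) one_ne_zero).2 (by norm_num)] at h2
          norm_num at h2
        exact continuousAt_subtype_val.comp (ContinuousAt.comp
          (f := fun s : UnitAddTorus (Fin d) => s i) (AddCircle.continuousAt_equivIoc 1 _ h1)
          (continuous_apply i).continuousAt)
      refine (PiLp.continuous_toLp 2 _).continuousAt.comp ?_
      exact continuousAt_pi.2 fun i => continuousAt_const.mul (this i)
  have hmF : ∀ (k : Fin d → ℤ) (y : Fin d → ℝ),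
      UnitAddTorus.mFourier k (fun i => (y i : UnitAddCircle)) =
        chr (up y) (latt (Real.pi / (2 * r)) k) := by
    intro k y
    simp only [UnitAddTorus.mFourier, ContinuousMap.coe_mk, fourier_coe_apply, chr,
      ← Complex.exp_sum]
    congr 1
    rw [PiLp.inner_apply, Complex.ofReal_sum, Finset.mul_sum]
    refine Finset.sum_congr rfl fun i _ => ?_
    have hr' : (r : ℂ) ≠ 0 := by exact_mod_cast hr.ne'
    simp [up, latt]
    field_simp
    ring
  have hcoef : ∀ k, UnitAddTorus.mFourierCoeff F k =
      (((4 * r) ^ d : ℝ) : ℂ)⁻¹ * ∫ y, u y * chr y (-latt (Real.pi / (2 * r)) k) := by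
    intro k
    rw [UnitAddTorus.mFourierCoeff_eq_integral F k fun _ => -(1 / 2)]
    have hlneg : (latt (Real.pi / (2 * r)) (-k) : E d) = -latt (Real.pi / (2 * r)) k := by
      ext i; simp [latt]
    let g : E d → ℂ := fun y => u y * chr y (-latt (Real.pi / (2 * r)) k)
    have h1 : ∫ y in {y : Fin d → ℝ | ∀ i, y i ∈ Ioc (-(1 / 2) : ℝ) (-(1 / 2) + 1)},
        UnitAddTorus.mFourier (-k) (fun i => (y i : UnitAddCircle)) • F (fun i => y i) =
        ∫ y : Fin d → ℝ, g (up y) := by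
      rw [← integral_indicator (by
        rw [show {y : Fin d → ℝ | ∀ i, y i ∈ Ioc (-(1 / 2) : ℝ) (-(1 / 2) + 1)} =
          Set.univ.pi fun _ => Ioc (-(1 / 2) : ℝ) (-(1 / 2) + 1) by ext; simp]
        exact MeasurableSet.univ_pi fun _ => measurableSet_Ioc)]
      refine integral_congr_ae (ae_of_all _ fun y => ?_)
      by_cases hy : ∀ i, y i ∈ Ioc (-(1 / 2) : ℝ) (-(1 / 2) + 1)
      · simp only
        rw [Set.indicator_of_mem (by exact hy), hmF, hlneg]
        simp only [F, g, smul_eq_mul]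
        rw [mul_comm]
        congr 3
        simp only [hrepcoe _ (hy _)]
      · simp only
        rw [Set.indicator_of_notMem (by exact hy)]
        push Not at hy
        obtain ⟨i, hi⟩ := hy
        have : u (up y) = 0 := by
          refine hur _ (le_trans ?_ (hcoord _ i))
          simp only [up, abs_mul]
          rw [abs_of_pos (by positivity : (0 : ℝ) < 4), abs_of_pos hr]
          have : 1 / 2 ≤ |y i| := by
            by_contra h
            rw [not_le, abs_lt] at h
            exact hi ⟨by linarith [h.1], by linarith [h.2]⟩
          nlinarith
        simp only [g, this, zero_mul]
    rw [h1]
    have h2 : ∫ y : Fin d → ℝ, g (up y) = ∫ y : E d, g ((4 * r) • y) := by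
      rw [← (EuclideanSpace.volume_preserving_symm_measurableEquiv_toLp (Fin d)).integral_comp'
        (fun y : Fin d → ℝ => g (up y))]
      refine integral_congr_ae (ae_of_all _ fun y => ?_)
      simp only
      congr 1
    rw [h2, Measure.integral_comp_smul, finrank_euclideanSpace_fin, abs_of_nonneg (by positivity),
      Complex.real_smul, Complex.ofReal_inv]
  let Fc : C(UnitAddTorus (Fin d), ℂ) := ⟨F, hF⟩
  have hsum : Summable (UnitAddTorus.mFourierCoeff Fc) := by
    have : UnitAddTorus.mFourierCoeff Fc = fun k => (((4 * r) ^ d : ℝ) : ℂ)⁻¹ *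
        ∫ y, u y * chr y (-latt (Real.pi / (2 * r)) k) := funext hcoef
    rw [this]
    exact hs.mul_left _
  let y : Fin d → ℝ := fun i => x i / (4 * r)
  have hyx : up y = x := by
    ext i
    simp only [up, y]
    field_simp
  have hy : ∀ i, y i ∈ Ioc (-(1 / 2) : ℝ) (-(1 / 2) + 1) := by
    intro i
    have h1 : |y i| < 1 / 2 := by
      simp only [y, abs_div]
      rw [abs_of_pos (by positivity : 0 < 4 * r), div_lt_iff₀ (by positivity)]
      linarith [hcoord x i]
    rw [abs_lt] at h1
    exact ⟨h1.1, by linarith⟩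
  have key := UnitAddTorus.hasSum_mFourier_series_apply_of_summable hsum
    (fun i => (y i : UnitAddCircle))
  have hFx : Fc (fun i => (y i : UnitAddCircle)) = u x := by
    simp only [Fc, ContinuousMap.coe_mk, F]
    rw [← hyx]
    congr 2
    funext i
    exact hrepcoe _ (hy i)
  rw [hFx] at key
  refine key.congr_fun fun k => ?_
  rw [hmF, hyx, smul_eq_mul]
  congr 1
  exact (hcoef k).symm

end Fourier

end FourierBF

end

noncomputable section

namespace FourierBF

open scoped ContDiff FourierTransform

/-! ### Families of functions with bounded derivatives -/

section Families

variable {P : Type*} [NormedAddCommGroup P] [NormedSpace ℝ P] {Idx : Type} [Fintype Idx]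
  (κ : Coordinates Idx P) {T : Type*}

/-- All derivatives of the family `b` are bounded by `W`, up to powers of `g`. -/
structure DerivBound (g : P → ℝ) (W : T → P → ℝ) (b : T → P → ℂ) : Prop where
  smooth : ∀ t, ContDiff ℝ ∞ (b t)
  bound : ∀ l : List Idx, ∃ (K : ℕ) (C : ℝ), 0 ≤ C ∧ ∀ t p,
    ‖dirDs (l.map κ.vec) (b t) p‖ ≤ C * g p ^ K * W t p

variable {κ} {g : P → ℝ} {W W' : T → P → ℝ} {b c : T → P → ℂ}

theorem DerivBound.dirD (h : DerivBound κ g W b) (i : Idx) :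
    DerivBound κ g W (fun t => dirD (κ.vec i) (b t)) :=
  ⟨fun t => contDiff_dirD (h.smooth t) _, fun l => h.bound (i :: l)⟩

theorem DerivBound.norm_le (h : DerivBound κ g W b) : ∃ (K : ℕ) (C : ℝ), 0 ≤ C ∧ ∀ t p,
    ‖b t p‖ ≤ C * g p ^ K * W t p := h.bound []

theorem DerivBound.mono (h : DerivBound κ g W b) {C : ℝ} (hC : 0 ≤ C) (hg : ∀ p, 1 ≤ g p)
    (hW : ∀ t p, W t p ≤ C * W' t p) : DerivBound κ g W' b := by
  refine ⟨h.smooth, fun l => ?_⟩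
  obtain ⟨K, C', hC', hb⟩ := h.bound l
  refine ⟨K, C' * C, by positivity, fun t p => (hb t p).trans ?_⟩
  have := hg p
  calc C' * g p ^ K * W t p ≤ C' * g p ^ K * (C * W' t p) := by gcongr; exact hW t p
    _ = _ := by ring

theorem DerivBound.add (h : DerivBound κ g W b) (h' : DerivBound κ g W c) (hg : ∀ p, 1 ≤ g p)
    (hW : ∀ t p, 0 ≤ W t p) : DerivBound κ g W (fun t p => b t p + c t p) := by
  refine ⟨fun t => (h.smooth t).add (h'.smooth t), fun l => ?_⟩
  obtain ⟨K, C, hC, hb⟩ := h.bound l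
  obtain ⟨K', C', hC', hb'⟩ := h'.bound l
  refine ⟨K + K', C + C', by positivity, fun t p => ?_⟩
  rw [dirDs_add (h.smooth t) (h'.smooth t)]
  have hg1 := hg p
  have hW1 := hW t p
  calc _ ≤ _ := norm_add_le _ _
    _ ≤ C * g p ^ K * W t p + C' * g p ^ K' * W t p := add_le_add (hb t p) (hb' t p)
    _ ≤ C * g p ^ (K + K') * W t p + C' * g p ^ (K + K') * W t p := by
        gcongr <;> first | exact hg1 | omega
    _ = _ := by ring

theorem DerivBound.mul (h : DerivBound κ g W b) (h' : DerivBound κ g W' c) (hg : ∀ p, 1 ≤ g p)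
    (hW : ∀ t p, 0 ≤ W t p) (hW' : ∀ t p, 0 ≤ W' t p) :
    DerivBound κ g (fun t p => W t p * W' t p) (fun t p => b t p * c t p) := by
  refine ⟨fun t => (h.smooth t).mul (h'.smooth t), fun l => ?_⟩
  induction l generalizing b c with
  | nil =>
    obtain ⟨K, C, hC, hb⟩ := h.norm_le
    obtain ⟨K', C', hC', hb'⟩ := h'.norm_le
    refine ⟨K + K', C * C', by positivity, fun t p => ?_⟩
    have hg1 := hg p
    simp only [List.map_nil, dirDs, norm_mul]
    calc _ ≤ (C * g p ^ K * W t p) * (C' * g p ^ K' * W' t p) :=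
          mul_le_mul (hb t p) (hb' t p) (norm_nonneg _) (mul_nonneg (by positivity) (hW t p))
      _ = _ := by ring
  | cons i l ih =>
    obtain ⟨K, C, hC, hb⟩ := ih (h.dirD i) h'
    obtain ⟨K', C', hC', hb'⟩ := ih h (h'.dirD i)
    refine ⟨K + K', C + C', by positivity, fun t p => ?_⟩
    have hg1 := hg p
    have hW1 : 0 ≤ W t p * W' t p := mul_nonneg (hW t p) (hW' t p)
    simp only [List.map_cons, dirDs]
    rw [dirD_mul (differentiable_of_contDiff (h.smooth t)) (differentiable_of_contDiff (h'.smooth t)),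
      dirDs_add ((contDiff_dirD (h.smooth t) _).mul (h'.smooth t))
        ((h.smooth t).mul (contDiff_dirD (h'.smooth t) _))]
    calc _ ≤ _ := norm_add_le _ _
      _ ≤ C * g p ^ K * (W t p * W' t p) + C' * g p ^ K' * (W t p * W' t p) :=
          add_le_add (hb t p) (hb' t p)
      _ ≤ C * g p ^ (K + K') * (W t p * W' t p) + C' * g p ^ (K + K') * (W t p * W' t p) := by
          gcongr <;> first | exact hg1 | omega
      _ = _ := by ring

theorem dirD_const (v : P) (z : ℂ) : FourierBF.dirD v (fun _ : P => z) = fun _ => 0 := by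
  funext p; simp [FourierBF.dirD]

theorem DerivBound.const (z : ℂ) : DerivBound κ g (fun (_ : T) _ => 1) (fun _ _ => z) := by
  refine ⟨fun _ => contDiff_const, fun l => ?_⟩
  suffices h : ∃ C : ℝ, 0 ≤ C ∧ ∀ p, ‖dirDs (l.map κ.vec) (fun _ => z) p‖ ≤ C by
    obtain ⟨C, hC, h⟩ := h
    exact ⟨0, C, hC, fun t p => by simpa using h p⟩
  induction l generalizing z with
  | nil => exact ⟨‖z‖, norm_nonneg z, fun _ => le_rfl⟩
  | cons i l ih =>
    simp only [List.map_cons, dirDs, dirD_const]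
    exact ih 0

theorem DerivBound.linear (L : P →L[ℝ] ℂ) (hg : ∀ p, 1 ≤ g p) {C : ℝ} (hL : ∀ p, ‖L p‖ ≤ C * g p) :
    DerivBound κ g (fun (_ : T) _ => 1) (fun _ p => L p) := by
  refine ⟨fun _ => L.contDiff, fun l => ?_⟩
  cases l with
  | nil =>
    refine ⟨1, |C|, abs_nonneg _, fun t p => ?_⟩
    have := hg p
    simp only [List.map_nil, dirDs, pow_one, mul_one]
    exact (hL p).trans (by gcongr; exact le_abs_self _)
  | cons i l =>
    have : FourierBF.dirD (κ.vec i) (fun p => L p) = fun _ => L (κ.vec i) := by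
      funext p; simp [FourierBF.dirD]
    simp only [List.map_cons, dirDs, this]
    exact (DerivBound.const (κ := κ) (g := g) (T := T) (L (κ.vec i))).bound l

/-- Differentiation under the integral sign in which only the coordinate derivatives have to be
dominated, since they control the full derivative. -/
theorem hasFDerivAt_integral_of_dirD_le {α : Type*} [MeasurableSpace α] {μ : Measure α}
    {B : α → P → ℂ} {p₀ : P} (hB : ∀ s, Differentiable ℝ (B s))
    (hm : ∀ p, AEStronglyMeasurable (fun s => B s p) μ)
    (hm' : ∀ i p, AEStronglyMeasurable (fun s => FourierBF.dirD (κ.vec i) (B s) p) μ)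
    (hint : Integrable (fun s => B s p₀) μ) {G : α → ℝ} (hG : Integrable G μ)
    (hle : ∀ i, ∀ s, ∀ p ∈ Metric.ball p₀ 1, ‖FourierBF.dirD (κ.vec i) (B s) p‖ ≤ G s) :
    DifferentiableAt ℝ (fun p => ∫ s, B s p ∂μ) p₀ ∧
      ∀ i, FourierBF.dirD (κ.vec i) (fun p => ∫ s, B s p ∂μ) p₀ =
        ∫ s, FourierBF.dirD (κ.vec i) (B s) p₀ ∂μ := by
  have hbd : ∀ s, ∀ p ∈ Metric.ball p₀ 1, ‖fderiv ℝ (B s) p‖ ≤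
      (∑ i, ‖ContinuousLinearMap.smulRightL ℝ P ℂ (κ.coord i)‖) * G s := by
    intro s p hp
    rw [fderiv_eq_sum_dirD κ, Finset.sum_mul]
    refine (norm_sum_le _ _).trans (Finset.sum_le_sum fun i _ => ?_)
    exact (ContinuousLinearMap.le_opNorm (ContinuousLinearMap.smulRightL ℝ P ℂ (κ.coord i)) _).trans
      (mul_le_mul_of_nonneg_left (hle i s p hp) (norm_nonneg _))
  have hmeas : AEStronglyMeasurable (fun s => fderiv ℝ (B s) p₀) μ := by
    have : (fun s => fderiv ℝ (B s) p₀) = fun s => ∑ i,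
        ContinuousLinearMap.smulRightL ℝ P ℂ (κ.coord i) (FourierBF.dirD (κ.vec i) (B s) p₀) :=
      funext fun s => fderiv_eq_sum_dirD κ _ _
    rw [this]
    refine Finset.aestronglyMeasurable_fun_sum _ fun i _ => ?_
    exact (ContinuousLinearMap.continuous _).comp_aestronglyMeasurable (hm' i p₀)
  have key := hasFDerivAt_integral_of_dominated_of_fderiv_le (𝕜 := ℝ) (μ := μ)
    (F := fun p s => B s p) (F' := fun p s => fderiv ℝ (B s) p) (x₀ := p₀)
    (Metric.ball_mem_nhds p₀ one_pos) (Filter.Eventually.of_forall hm) hint hmeas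
    (ae_of_all _ hbd) (hG.const_mul _) (ae_of_all _ fun s p _ => (hB s p).hasFDerivAt)
  refine ⟨key.differentiableAt, fun i => ?_⟩
  rw [FourierBF.dirD, key.fderiv]
  have hi : Integrable (fun s => fderiv ℝ (B s) p₀) μ :=
    (hG.const_mul _).mono' hmeas (ae_of_all _ fun s => hbd s p₀ (Metric.mem_ball_self one_pos))
  exact (ContinuousLinearMap.integral_comp_comm
    (ContinuousLinearMap.apply ℝ ℂ (κ.vec i)) hi).symm

end Families

/-! ### Oscillatory integrals -/

section Oscillatory

variable {d : ℕ}

theorem one_le_one_add_norm_fst (p : E d × E d) : 1 ≤ 1 + ‖p.1‖ := one_le_one_add_norm _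

/-- The derivatives of the family `b` of functions on `ℝᵈ` are bounded by powers of `1 + ‖x‖`,
times `W t`. -/
abbrev FamBound {T : Type*} (W : T → ℝ) (b : T → E d → ℂ) : Prop :=
  DerivBound (stdCoord d) (fun x => 1 + ‖x‖) (fun t _ => W t) b

/-- The derivatives of `b` at `(x, η)` are bounded by powers of `1 + ‖x‖`, times `W η`. -/
abbrev AmpBound (W : E d → ℝ) (b : E d × E d → ℂ) : Prop :=
  DerivBound (prodCoord d) (fun p => 1 + ‖p.1‖) (fun (_ : Unit) p => W p.2) (fun _ => b)

theorem integrable_pow_mul_schwartz (θ : 𝓢(E d, ℂ)) (K : ℕ) :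
    Integrable fun x => (1 + ‖x‖) ^ K * ‖θ x‖ := by
  obtain ⟨C, hC, h⟩ := exists_norm_le_dec θ (d + 1 + K)
  refine ((integrable_dec (d := d) (Nat.lt_succ_self d)).const_mul C).mono'
    (Continuous.aestronglyMeasurable (by fun_prop)) (ae_of_all _ fun x => ?_)
  rw [Real.norm_of_nonneg (by positivity)]
  calc (1 + ‖x‖) ^ K * ‖θ x‖ ≤ (1 + ‖x‖) ^ K * (C * dec (d + 1 + K) x) := by gcongr; exact h x
    _ = C * (dec (d + 1 + K) x * (1 + ‖x‖) ^ K) := by ring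
    _ = _ := by rw [dec_add_mul_pow]

theorem exists_seminorm_integral_pow_mul_le (K : ℕ) :
    ∃ q : Seminorm ℂ 𝓢(E d, ℂ), Continuous q ∧
      ∀ θ : 𝓢(E d, ℂ), ∫ x, (1 + ‖x‖) ^ K * ‖θ x‖ ≤ q θ := by
  let I : ℝ := ∫ x : E d, dec (d + 1) x
  have hI : 0 ≤ I := integral_nonneg fun x => dec_nonneg _ _
  let c : NNReal := ⟨I * 2 ^ (d + 1 + K), by positivity⟩
  let q₀ : Seminorm ℂ 𝓢(E d, ℂ) := (Finset.Iic (d + 1 + K, 0)).sup fun m => SchwartzMap.seminorm ℂ m.1 m.2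
  have hq₀ : Continuous q₀ := by
    have h := (schwartz_withSeminorms ℂ (E d) ℂ).finset_sups
    exact h.continuous_seminorm (Finset.Iic (d + 1 + K, 0))
  refine ⟨c • q₀, hq₀.const_smul c, fun θ => ?_⟩
  have h : ∀ x, (1 + ‖x‖) ^ K * ‖θ x‖ ≤ dec (d + 1) x * (2 ^ (d + 1 + K) * q₀ θ) := by
    intro x
    have h1 := SchwartzMap.one_add_le_sup_seminorm_apply (𝕜 := ℂ) (m := (d + 1 + K, 0))
      (k := d + 1 + K) (n := 0) le_rfl le_rfl θ x
    rw [norm_iteratedFDeriv_zero] at h1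
    calc (1 + ‖x‖) ^ K * ‖θ x‖
        = dec (d + 1) x * ((1 + ‖x‖) ^ (d + 1 + K) * ‖θ x‖) := by
          rw [pow_add]
          have := pow_mul_dec (d + 1) x
          linear_combination (-(1 + ‖x‖) ^ K * ‖θ x‖) * this
      _ ≤ _ := mul_le_mul_of_nonneg_left h1 (dec_nonneg _ _)
  calc ∫ x, (1 + ‖x‖) ^ K * ‖θ x‖ ≤ ∫ x : E d, dec (d + 1) x * (2 ^ (d + 1 + K) * q₀ θ) :=
        integral_mono (integrable_pow_mul_schwartz θ K)
          ((integrable_dec (Nat.lt_succ_self d)).mul_const _) h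
    _ = I * 2 ^ (d + 1 + K) * q₀ θ := by rw [integral_mul_const]; ring
    _ = _ := rfl

theorem integrable_schwartz_mul_of_growth (θ : 𝓢(E d, ℂ)) {g : E d → ℂ} (hg : Continuous g) {C : ℝ}
    {K : ℕ} (h : ∀ x, ‖g x‖ ≤ C * (1 + ‖x‖) ^ K) : Integrable fun x => θ x * g x := by
  refine ((integrable_pow_mul_schwartz θ K).const_mul C).mono'
    (by fun_prop) (ae_of_all _ fun x => ?_)
  rw [norm_mul]
  calc ‖θ x‖ * ‖g x‖ ≤ ‖θ x‖ * (C * (1 + ‖x‖) ^ K) := by gcongr; exact h x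
    _ = _ := by ring

/-- The derivative along a unit vector on `𝒮`. -/
def sD (i : Fin d) : 𝓢(E d, ℂ) →L[ℂ] 𝓢(E d, ℂ) :=
  LineDeriv.lineDerivOpCLM ℂ 𝓢(E d, ℂ) (unitVec i)

theorem sD_apply (i : Fin d) (θ : 𝓢(E d, ℂ)) (x : E d) : sD i θ x = dirD (unitVec i) θ x :=
  SchwartzMap.lineDerivOp_apply_eq_fderiv _ _ _

theorem dirD_chr (x : E d) (ξ v : E d) :
    dirD v (fun y => chr y ξ) x = Complex.I * ((inner ℝ v ξ : ℝ) : ℂ) * chr x ξ := by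
  have h1 : HasFDerivAt (fun y : E d => ((inner ℝ y ξ : ℝ) : ℂ))
      (Complex.ofRealCLM.comp (innerSL ℝ ξ)) x := by
    have : (fun y : E d => ((inner ℝ y ξ : ℝ) : ℂ)) = Complex.ofRealCLM.comp (innerSL ℝ ξ) := by
      funext y; simp [real_inner_comm]
    rw [this]
    exact ContinuousLinearMap.hasFDerivAt _
  have h2 := (h1.const_mul Complex.I).cexp
  rw [dirD]
  unfold chr
  rw [h2.fderiv]
  simp [real_inner_comm]
  ring

theorem integral_mul_chr_ibp {g : E d → ℂ} (hg : Differentiable ℝ g) (hi : Integrable g) (j : Fin d)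
    (hi' : Integrable (dirD (unitVec j) g)) (ζ : E d) :
    Complex.I * ((ζ j : ℝ) : ℂ) * ∫ x, g x * chr x ζ = -∫ x, dirD (unitVec j) g x * chr x ζ := by
  have hb : ∀ {h : E d → ℂ}, Integrable h → Integrable fun x => h x * chr x ζ := fun hh =>
    hh.mul_bdd (c := 1) (by fun_prop) (ae_of_all _ fun x => (norm_chr x ζ).le)
  have hd : ∀ x, fderiv ℝ (fun y => chr y ζ) x (unitVec j) = Complex.I * ((ζ j : ℝ) : ℂ) * chr x ζ := by
    intro x
    have := dirD_chr x ζ (unitVec j)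
    rw [dirD] at this
    rw [this]
    simp [unitVec, EuclideanSpace.inner_single_left]
  have h := integral_mul_fderiv_eq_neg_fderiv_mul_of_integrable (μ := (volume : Measure (E d)))
    (f := g) (g := fun x => chr x ζ) (v := unitVec j) (hb hi') (by
      simp_rw [hd]
      have := (hb hi).const_mul (Complex.I * ((ζ j : ℝ) : ℂ))
      refine this.congr (ae_of_all _ fun x => ?_)
      simp only; ring) (hb hi) (fun x _ => hg x)
      (fun x _ => (differentiable_of_contDiff (contDiff_chr contDiff_id contDiff_const)) x)
  simp_rw [hd] at h
  rw [← integral_const_mul, show (∫ x, dirD (unitVec j) g x * chr x ζ) =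
    ∫ x, (fderiv ℝ g x) (unitVec j) * chr x ζ from rfl, ← h]
  refine integral_congr_ae (ae_of_all _ fun x => ?_)
  simp only; ring

/-- Each factor ζ_j is traded for a derivative in x, falling either on the Schwartz factor or on b,
and both results are of the same type. Uniformity in the parameter t matters because later
amplitudes depend on the frequencies. -/
theorem exists_seminorm_oscillatory {T : Type*} {W : T → ℝ} (hW : ∀ t, 0 ≤ W t) (L : ℕ)
    {b : T → E d → ℂ} (hb : FamBound W b) :
    ∃ q : Seminorm ℂ 𝓢(E d, ℂ), Continuous q ∧ ∀ (θ : 𝓢(E d, ℂ)) (t : T) (ζ : E d),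
      (1 + ‖ζ‖) ^ L * ‖∫ x, θ x * b t x * chr x ζ‖ ≤ W t * q θ := by
  induction L generalizing b with
  | zero =>
    obtain ⟨K, C, hC, h⟩ := hb.norm_le
    obtain ⟨q, hq, hq'⟩ := exists_seminorm_integral_pow_mul_le (d := d) K
    let c : NNReal := ⟨C, hC⟩
    refine ⟨c • q, hq.const_smul c, fun θ t ζ => ?_⟩
    rw [pow_zero, one_mul]
    calc ‖∫ x, θ x * b t x * chr x ζ‖ ≤ ∫ x, (C * W t) * ((1 + ‖x‖) ^ K * ‖θ x‖) := by
          refine norm_integral_le_of_norm_le ((integrable_pow_mul_schwartz θ K).const_mul _)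
            (ae_of_all _ fun x => ?_)
          rw [norm_mul, norm_mul, norm_chr, mul_one]
          calc ‖θ x‖ * ‖b t x‖ ≤ ‖θ x‖ * (C * (1 + ‖x‖) ^ K * W t) := by gcongr; exact h t x
            _ = _ := by ring
      _ = (C * W t) * ∫ x, (1 + ‖x‖) ^ K * ‖θ x‖ := integral_const_mul _ _
      _ ≤ (C * W t) * q θ := mul_le_mul_of_nonneg_left (hq' θ) (mul_nonneg hC (hW t))
      _ = W t * (C * q θ) := by ring
      _ = _ := rfl
  | succ L ih =>
    obtain ⟨q₀, hq₀, h₀⟩ := ih hb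
    choose q₁ hq₁ h₁ using fun j : Fin d => ih (hb.dirD j)
    let q : Seminorm ℂ 𝓢(E d, ℂ) := q₀ + ∑ j : Fin d, (q₁ j + q₀.comp (sD j).toLinearMap)
    have hqe : ∀ θ, q θ = q₀ θ + ∑ j : Fin d, (q₁ j θ + q₀ (sD j θ)) := by
      intro θ
      have : ∀ s : Finset (Fin d), (∑ j ∈ s, (q₁ j + q₀.comp (sD j).toLinearMap)) θ =
          ∑ j ∈ s, (q₁ j θ + q₀ (sD j θ)) := by
        intro s
        induction s using Finset.cons_induction with
        | empty => simp
        | cons j s hj ih2 => rw [Finset.sum_cons, Finset.sum_cons, add_apply, ih2]; rfl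
      simp only [q, add_apply, this]
    have hqc : Continuous q := by
      have : (q : 𝓢(E d, ℂ) → ℝ) = fun θ => q₀ θ + ∑ j : Fin d, (q₁ j θ + q₀ (sD j θ)) := funext hqe
      rw [this]
      exact hq₀.add (continuous_finsetSum _ fun j _ =>
        (hq₁ j).add (hq₀.comp (sD j).continuous))
    refine ⟨q, hqc, fun θ t ζ => ?_⟩
    set I := ∫ x, θ x * b t x * chr x ζ
    have hint : ∀ {b' : T → E d → ℂ}, FamBound W b' → ∀ θ' : 𝓢(E d, ℂ),
        Integrable fun x => θ' x * b' t x := by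
      intro b' hb' θ'
      obtain ⟨K, C, hC, h⟩ := hb'.norm_le
      refine integrable_schwartz_mul_of_growth θ' (hb'.smooth t).continuous (C := C * W t) (K := K)
        fun x => (h t x).trans (le_of_eq ?_)
      ring
    have hj : ∀ j, |ζ j| * ‖I‖ ≤ ‖∫ x, θ x * dirD (unitVec j) (b t) x * chr x ζ‖ +
        ‖∫ x, sD j θ x * b t x * chr x ζ‖ := by
      intro j
      have hdd : dirD (unitVec j) (fun x => θ x * b t x) =
          fun x => sD j θ x * b t x + θ x * dirD (unitVec j) (b t) x := by
        rw [dirD_mul θ.differentiable (differentiable_of_contDiff (hb.smooth t))]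
        funext x; rw [sD_apply]
      have hi1 : Integrable fun x => sD j θ x * b t x := hint hb _
      have hi2 : Integrable fun x => θ x * dirD (unitVec j) (b t) x := hint (hb.dirD j) _
      have hib : ∀ {h : E d → ℂ}, Integrable h → Integrable fun x => h x * chr x ζ := fun hh =>
        hh.mul_bdd (c := 1) (by fun_prop) (ae_of_all _ fun x => (norm_chr x ζ).le)
      have key := integral_mul_chr_ibp (g := fun x => θ x * b t x)
        (θ.differentiable.mul (differentiable_of_contDiff (hb.smooth t))) (hint hb θ) j
        (by rw [hdd]; exact hi1.add hi2) ζ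
      rw [hdd] at key
      have h1 : |ζ j| * ‖I‖ = ‖Complex.I * ((ζ j : ℝ) : ℂ) * I‖ := by simp
      rw [h1, key, norm_neg, add_comm]
      simp_rw [add_mul]
      rw [integral_add (hib hi1) (hib hi2)]
      exact norm_add_le _ _
    have hn : (1 + ‖ζ‖) ≤ 1 + ∑ j, |ζ j| := by linarith [norm_le_sum_abs ζ]
    rw [hqe, mul_add]
    calc (1 + ‖ζ‖) ^ (L + 1) * ‖I‖ ≤ (1 + ‖ζ‖) ^ L * ((1 + ∑ j, |ζ j|) * ‖I‖) := by
          rw [pow_succ, mul_assoc]; gcongr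
      _ = (1 + ‖ζ‖) ^ L * ‖I‖ + ∑ j, (1 + ‖ζ‖) ^ L * (|ζ j| * ‖I‖) := by
          rw [add_mul, mul_add, one_mul, Finset.sum_mul, Finset.mul_sum]
      _ ≤ W t * q₀ θ + ∑ j, W t * (q₁ j θ + q₀ (sD j θ)) := by
          refine add_le_add (h₀ θ t ζ) (Finset.sum_le_sum fun j _ => ?_)
          calc (1 + ‖ζ‖) ^ L * (|ζ j| * ‖I‖) ≤ (1 + ‖ζ‖) ^ L *
                (‖∫ x, θ x * dirD (unitVec j) (b t) x * chr x ζ‖ +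
                  ‖∫ x, sD j θ x * b t x * chr x ζ‖) := by gcongr; exact hj j
            _ ≤ W t * q₁ j θ + W t * q₀ (sD j θ) := by
                rw [mul_add]
                exact add_le_add (h₁ j θ t ζ) (h₀ (sD j θ) t ζ)
            _ = _ := by ring
      _ = _ := by rw [Finset.mul_sum]

end Oscillatory

end FourierBF

end

noncomputable section

namespace FourierBF

open scoped ContDiff FourierTransform

/-! ### Oscillatory integrals depending on a frequency, and symbol estimates. -/

section OscOp

variable {d : ℕ}

theorem dirDs_slice {b : E d × E d → ℂ} (hb : ContDiff ℝ ∞ b) (η : E d) (l : List (E d)) (x : E d) :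
    dirDs l (fun x => b (x, η)) x = dirDs (l.map fun v => (v, 0)) b (x, η) := by
  induction l generalizing b with
  | nil => rfl
  | cons v l ih =>
    simp only [List.map_cons, dirDs]
    rw [← ih (contDiff_dirD hb _)]
    congr 1
    funext y
    have h1 : HasFDerivAt (fun x : E d => (x, η)) (ContinuousLinearMap.inl ℝ (E d) (E d)) y :=
      hasFDerivAt_prodMk_left y η
    have h2 := ((differentiable_of_contDiff hb) (y, η)).hasFDerivAt.comp y h1
    have h3 := h2.fderiv
    simp only [Function.comp_def] at h3
    simp only [dirD]
    rw [h3]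
    simp

theorem AmpBound.slice {W : E d → ℝ} {b : E d × E d → ℂ} (h : AmpBound W b) :
    FamBound W (fun η x => b (x, η)) := by
  refine ⟨fun η => (h.smooth ()).comp (contDiff_id.prodMk contDiff_const), fun l => ?_⟩
  obtain ⟨K, C, hC, hb⟩ := h.bound (l.map Sum.inl)
  refine ⟨K, C, hC, fun η x => ?_⟩
  rw [dirDs_slice (h.smooth ()), List.map_map]
  have := hb () (x, η)
  rwa [List.map_map] at this

theorem dirD_comp_affine_right {b : E d × E d → ℂ} (hb : ContDiff ℝ ∞ b) (x η v : E d) :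
    dirD v (fun η => b (x, η)) η = dirD (0, v) b (x, η) := by
  have h1 : HasFDerivAt (fun η : E d => (x, η)) (ContinuousLinearMap.inr ℝ (E d) (E d)) η :=
    hasFDerivAt_prodMk_right x η
  have h2 := ((differentiable_of_contDiff hb) (x, η)).hasFDerivAt.comp η h1
  have h3 := h2.fderiv
  simp only [Function.comp_def] at h3
  simp only [dirD]
  rw [h3]
  simp

/-- The oscillatory integral `∫ θ(x) b(x, η) e^{i⟨x, η - ξ⟩} dx`. -/
def oscInt (b : E d × E d → ℂ) (θ : 𝓢(E d, ℂ)) (ξ η : E d) : ℂ :=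
  ∫ x, θ x * b (x, η) * chr x (η - ξ)

/-- The amplitude of the derivative of an oscillatory integral. -/
def ampD (j : Fin d) (b : E d × E d → ℂ) (p : E d × E d) : ℂ :=
  dirD (0, unitVec j) b p + Complex.I * ((p.1 j : ℝ) : ℂ) * b p

variable {W : E d → ℝ} {b : E d × E d → ℂ}

theorem AmpBound.ampD (h : AmpBound W b) (hW : ∀ η, 0 ≤ W η) (j : Fin d) :
    AmpBound W (ampD j b) := by
  have h1 : AmpBound W (dirD (0, unitVec j) b) := h.dirD (Sum.inr j)
  let L : E d × E d →L[ℝ] ℂ := Complex.I •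
    (Complex.ofRealCLM.comp ((EuclideanSpace.proj j).comp (ContinuousLinearMap.fst ℝ (E d) (E d))))
  have h2 := DerivBound.linear (κ := prodCoord d) (T := Unit) (g := fun p => 1 + ‖p.1‖) L
    one_le_one_add_norm_fst (C := 1) (fun p => by
      have : ‖L p‖ = |p.1 j| := by simp [L]
      rw [this, one_mul]
      have := PiLp.norm_apply_le p.1 j
      rw [Real.norm_eq_abs] at this
      linarith)
  have h3 := h2.mul h one_le_one_add_norm_fst (fun _ _ => zero_le_one) (fun _ p => hW _)
  simp only [one_mul] at h3
  exact h1.add h3 one_le_one_add_norm_fst (fun _ p => hW _)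

theorem AmpBound.integrable (h : AmpBound W b) (θ : 𝓢(E d, ℂ)) (η : E d) :
    Integrable fun x => θ x * b (x, η) := by
  obtain ⟨K, C, hC, h1⟩ := h.norm_le
  refine integrable_schwartz_mul_of_growth θ (g := fun x => b (x, η))
    ((h.smooth ()).continuous.comp (by fun_prop)) (C := C * W η) (K := K)
    fun x => (h1 () (x, η)).trans (le_of_eq ?_)
  simp only; ring

theorem integrable_mul_chr {f : E d → ℂ} (hf : Integrable f) (ζ : E d) :
    Integrable fun x => f x * chr x ζ :=
  hf.mul_bdd (c := 1) (by fun_prop) (ae_of_all _ fun x => (norm_chr x ζ).le)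

/-- A frequency derivative hits b or produces a factor i x_j from the exponential. Amplitude bounds
allow powers of 1 + |x|, so both contributions form an amplitude with the same W. -/
theorem oscInt_deriv (h : AmpBound W b) (hW : ∀ η, 0 ≤ W η) (hWc : Continuous W) (θ : 𝓢(E d, ℂ))
    (ξ : E d) : Differentiable ℝ (oscInt b θ ξ) ∧
      ∀ j, dirD (unitVec j) (oscInt b θ ξ) = oscInt (ampD j b) θ ξ := by
  let F : E d → E d → ℂ := fun x η => θ x * b (x, η) * chr x (η - ξ)
  have hbs : ∀ x, ContDiff ℝ ∞ fun η => b (x, η) := fun x =>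
    (h.smooth ()).comp (contDiff_const.prodMk contDiff_id)
  have hsm : ∀ x, ContDiff ℝ ∞ (F x) := fun x =>
    (contDiff_const.mul (hbs x)).mul
      (contDiff_chr contDiff_const (contDiff_id.sub contDiff_const))
  have hdir : ∀ (i : Fin d) x η, dirD (unitVec i) (F x) η = θ x * ampD i b (x, η) * chr x (η - ξ) := by
    intro i x η
    have e1 : F x = fun η => θ x * b (x, η) * chr x (η - ξ) := rfl
    have e2 : dirD (unitVec i) (fun η => chr x (η - ξ)) η =
        Complex.I * ((x i : ℝ) : ℂ) * chr x (η - ξ) := by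
      have : (fun η => chr x (η - ξ)) = fun η => chr η x * chr x (-ξ) := by
        funext η; rw [sub_eq_add_neg, chr_add, chr_comm x η]
      rw [this, dirD_mul (b := fun η => chr η x) (c := fun _ => chr x (-ξ))
        (differentiable_of_contDiff (contDiff_chr contDiff_id contDiff_const))
        (differentiable_const _)]
      simp only [dirD_chr, dirD_const]
      rw [sub_eq_add_neg, chr_add, chr_comm η x]
      simp [unitVec, EuclideanSpace.inner_single_left]
      ring
    rw [e1, dirD_mul (b := fun η => θ x * b (x, η)) (c := fun η => chr x (η - ξ))
      (differentiable_of_contDiff (contDiff_const.mul (hbs x)))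
      (differentiable_of_contDiff (contDiff_chr contDiff_const (contDiff_id.sub contDiff_const))),
      dirD_mul (b := fun _ => θ x) (c := fun η => b (x, η)) (differentiable_const _)
        (differentiable_of_contDiff (hbs x)), dirD_const]
    simp only [e2, dirD_comp_affine_right (h.smooth ()), ampD]
    ring
  have hcont : Continuous b := (h.smooth ()).continuous
  have key : ∀ η₀, DifferentiableAt ℝ (fun η => ∫ x, F x η) η₀ ∧ ∀ i : Fin d,
      dirD (unitVec i) (fun η => ∫ x, F x η) η₀ = ∫ x, dirD (unitVec i) (F x) η₀ := by
    intro η₀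
    obtain ⟨M, hM⟩ := (isCompact_closedBall η₀ 1).exists_bound_of_continuousOn hWc.continuousOn
    choose K C hC hb using fun i : Fin d => (h.ampD hW i).norm_le
    let G : E d → ℝ := fun x => ∑ i, C i * M * ((1 + ‖x‖) ^ (K i) * ‖θ x‖)
    have hG : Integrable G := integrable_finsetSum _ fun i _ =>
      (integrable_pow_mul_schwartz θ (K i)).const_mul _
    have hM0 : 0 ≤ M := (norm_nonneg _).trans (hM η₀ (Metric.mem_closedBall_self zero_le_one))
    refine hasFDerivAt_integral_of_dirD_le (κ := stdCoord d) (B := F) (p₀ := η₀) (μ := volume)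
      (fun x => differentiable_of_contDiff (hsm x)) (fun η => ?_) (fun i η => ?_) ?_ hG ?_
    · exact Continuous.aestronglyMeasurable (by fun_prop)
    · have : (fun s => dirD ((stdCoord d).vec i) (F s) η) =
          fun x => θ x * ampD i b (x, η) * chr x (η - ξ) := funext fun x => hdir i x η
      rw [this]
      have := ((h.ampD hW i).smooth ()).continuous
      exact Continuous.aestronglyMeasurable (by fun_prop)
    · exact integrable_mul_chr (h.integrable θ η₀) _
    · intro i x η hη
      have e : dirD ((stdCoord d).vec i) (F x) η = _ := hdir i x η
      rw [e, norm_mul, norm_mul, norm_chr, mul_one]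
      have h1 := hM η (Metric.ball_subset_closedBall hη)
      rw [Real.norm_of_nonneg (hW η)] at h1
      refine le_trans ?_ (Finset.single_le_sum
        (f := fun i : Fin d => C i * M * ((1 + ‖x‖) ^ (K i) * ‖θ x‖))
        (fun i _ => by have := hC i; positivity) (Finset.mem_univ i))
      have := hC i
      calc ‖θ x‖ * ‖ampD i b (x, η)‖ ≤ ‖θ x‖ * (C i * (1 + ‖x‖) ^ (K i) * M) := by
            gcongr
            refine (hb i () (x, η)).trans ?_
            simp only
            gcongr
        _ = _ := by ring
  refine ⟨fun η => (key η).1, fun j => funext fun η => ?_⟩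
  refine ((key η).2 j).trans ?_
  exact integral_congr_ae (ae_of_all _ fun x => hdir j x η)

theorem contDiff_oscInt (h : AmpBound W b) (hW : ∀ η, 0 ≤ W η) (hWc : Continuous W) (θ : 𝓢(E d, ℂ))
    (ξ : E d) : ContDiff ℝ ∞ (oscInt b θ ξ) := by
  refine contDiff_of_dirD_mem (stdCoord d)
    {f | ∃ c, AmpBound W c ∧ f = oscInt c θ ξ} ?_ ?_ ⟨b, h, rfl⟩
  · rintro _ ⟨c, hc, rfl⟩
    exact (oscInt_deriv hc hW hWc θ ξ).1
  · rintro _ ⟨c, hc, rfl⟩ i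
    exact ⟨ampD i c, hc.ampD hW i, (oscInt_deriv hc hW hWc θ ξ).2 i⟩

theorem exists_seminorm_oscInt (h : AmpBound W b) (hW : ∀ η, 0 ≤ W η) (hWc : Continuous W) (L n : ℕ) :
    ∃ q : Seminorm ℂ 𝓢(E d, ℂ), Continuous q ∧ ∀ (θ : 𝓢(E d, ℂ)) (ξ η : E d),
      (1 + ‖η - ξ‖) ^ L * ‖iteratedFDeriv ℝ n (oscInt b θ ξ) η‖ ≤ W η * q θ := by
  obtain ⟨Cn, hCn, hCn'⟩ := norm_iteratedFDeriv_le_of_dirDs (stdCoord d) n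
  have hl : ∀ (m : ℕ) (c : E d × E d → ℂ), AmpBound W c →
      ∃ q : Seminorm ℂ 𝓢(E d, ℂ), Continuous q ∧ ∀ l : List (Fin d), l.length = m →
        ∀ (θ : 𝓢(E d, ℂ)) (ξ η : E d),
        (1 + ‖η - ξ‖) ^ L * ‖dirDs (l.map unitVec) (oscInt c θ ξ) η‖ ≤ W η * q θ := by
    intro m
    induction m with
    | zero =>
      intro c hc
      obtain ⟨q, hq, hq'⟩ := exists_seminorm_oscillatory hW L hc.slice
      refine ⟨q, hq, fun l hl θ ξ η => ?_⟩
      rw [List.length_eq_zero_iff] at hl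
      subst hl
      exact hq' θ η (η - ξ)
    | succ m ih =>
      intro c hc
      choose q hq hq' using fun i => ih (ampD i c) (hc.ampD hW i)
      have hqe : ∀ (s : Finset (Fin d)) θ, (∑ i ∈ s, q i) θ = ∑ i ∈ s, q i θ := by
        intro s θ
        induction s using Finset.cons_induction with
        | empty => simp
        | cons j s hj ih2 => rw [Finset.sum_cons, Finset.sum_cons, add_apply, ih2]
      refine ⟨∑ i, q i, ?_, ?_⟩
      · have : ((∑ i, q i : Seminorm ℂ 𝓢(E d, ℂ)) : 𝓢(E d, ℂ) → ℝ) = fun θ => ∑ i, q i θ :=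
          funext (hqe _)
        rw [this]
        exact continuous_finsetSum _ fun i _ => hq i
      · intro l hl θ ξ η
        match l, hl with
        | i :: l, hl =>
          simp only [List.map_cons, dirDs]
          rw [(oscInt_deriv hc hW hWc θ ξ).2 i]
          refine (hq' i l (by simpa using hl) θ ξ η).trans ?_
          rw [hqe]
          exact mul_le_mul_of_nonneg_left
            (Finset.single_le_sum (f := fun i => q i θ) (fun i _ => apply_nonneg _ _)
              (Finset.mem_univ i)) (hW η)
  obtain ⟨q, hq, hq'⟩ := hl n b h
  let c : NNReal := ⟨Cn, hCn⟩
  refine ⟨c • q, hq.const_smul c, fun θ ξ η => ?_⟩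
  have h1 := hCn' (oscInt b θ ξ) (contDiff_oscInt h hW hWc θ ξ) η
    (dec L (η - ξ) * (W η * q θ)) (fun l hl => by
      rw [dec, ← div_eq_inv_mul, le_div_iff₀ (by positivity), mul_comm]
      exact hq' l hl θ ξ η)
  calc (1 + ‖η - ξ‖) ^ L * ‖iteratedFDeriv ℝ n (oscInt b θ ξ) η‖
      ≤ (1 + ‖η - ξ‖) ^ L * (Cn * (dec L (η - ξ) * (W η * q θ))) := by gcongr
    _ = ((1 + ‖η - ξ‖) ^ L * dec L (η - ξ)) * (W η * (Cn * q θ)) := by ring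
    _ = W η * (Cn * q θ) := by rw [pow_mul_dec, one_mul]
    _ = _ := rfl

theorem exists_sup_seminorm_le {q : Seminorm ℂ 𝓢(E d, ℂ)} (hq : Continuous q) :
    ∃ (s : Finset (ℕ × ℕ)) (C : ℝ), 0 ≤ C ∧ ∀ θ, q θ ≤ C * s.sup (schwartzSeminormFamily ℂ (E d) ℂ) θ := by
  obtain ⟨s, C, -, h⟩ := Seminorm.bound_of_continuous (schwartz_withSeminorms ℂ (E d) ℂ) q hq
  exact ⟨s, C, C.2, fun θ => h θ⟩

theorem continuous_one_add_norm_pow (N : ℕ) : Continuous fun η : E d => (1 + ‖η‖) ^ N := by fun_prop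

/-- The operator `θ ↦ ∫ θ(x) b(x, ·) e^{i⟨x, ·⟩} dx` on `𝒮`. -/
theorem exists_oscCLM {N : ℕ} (h : AmpBound (fun η => (1 + ‖η‖) ^ N) b) :
    ∃ A : 𝓢(E d, ℂ) →L[ℂ] 𝓢(E d, ℂ), ∀ θ η, A θ η = oscInt b θ 0 η := by
  have hW : ∀ η : E d, 0 ≤ (1 + ‖η‖) ^ N := fun η => by positivity
  refine ⟨SchwartzMap.mkCLM (𝕜 := ℂ) (𝕜' := ℂ) (σ := RingHom.id ℂ) (fun θ => oscInt b θ 0)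
    (fun θ θ' η => ?_) (fun c θ η => ?_)
    (fun θ => contDiff_oscInt h hW (continuous_one_add_norm_pow N) θ 0) ?_, fun θ η => rfl⟩
  · simp only [oscInt]
    rw [← integral_add (integrable_mul_chr (h.integrable θ η) _)
      (integrable_mul_chr (h.integrable θ' η) _)]
    refine integral_congr_ae (ae_of_all _ fun x => ?_)
    simp only [add_apply]; ring
  · simp only [oscInt, RingHom.id_apply, smul_eq_mul]
    rw [← integral_const_mul]
    refine integral_congr_ae (ae_of_all _ fun x => ?_)
    simp only [smul_apply, smul_eq_mul]; ring
  · rintro ⟨k, n⟩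
    -- N orders of decay cancel the growth of the amplitude; the remaining k supply the weight in
    -- the Schwartz seminorm.
    obtain ⟨q, hq, hq'⟩ := exists_seminorm_oscInt h hW (continuous_one_add_norm_pow N) (N + k) n
    obtain ⟨s, C, hC, hs⟩ := exists_sup_seminorm_le hq
    refine ⟨s, C, hC, fun θ η => ?_⟩
    refine le_trans ?_ (hs θ)
    have h1 := hq' θ 0 η
    rw [sub_zero, pow_add, mul_assoc, mul_le_mul_iff_of_pos_left (by positivity)] at h1
    refine le_trans ?_ h1
    gcongr
    linarith

/-! ### Symbols -/

/-- The derivatives of `b` are bounded by `W η`, with a gain of `(1 + ‖η‖) ^ ρ` for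
each `η`-derivative. -/
structure SymBound (ρ : ℝ) (W : E d → ℝ) (b : E d × E d → ℂ) : Prop where
  smooth : ContDiff ℝ ∞ b
  bound : ∀ l l' : List (Fin d), ∃ (K : ℕ) (C : ℝ), 0 ≤ C ∧ ∀ x η,
    ‖dirDs (l.map (fun i => (unitVec i, 0)) ++ l'.map (fun i => (0, unitVec i))) b (x, η)‖ ≤
      C * (1 + ‖x‖) ^ K * (W η * (1 + ‖η‖) ^ (-ρ * l'.length))

variable {ρ : ℝ}

theorem SymBound.dirD_left (h : SymBound ρ W b) (i : Fin d) :
    SymBound ρ W (dirD (unitVec i, 0) b) :=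
  ⟨contDiff_dirD h.smooth _, fun l l' => h.bound (i :: l) l'⟩

theorem SymBound.dirD_right (h : SymBound ρ W b) (i : Fin d) :
    SymBound ρ (fun η => W η * (1 + ‖η‖) ^ (-ρ)) (dirD (0, unitVec i) b) := by
  refine ⟨contDiff_dirD h.smooth _, fun l l' => ?_⟩
  obtain ⟨K, C, hC, hb⟩ := h.bound l (i :: l')
  refine ⟨K, C, hC, fun x η => ?_⟩
  have hp : (((0, unitVec i) : E d × E d) :: (l.map (fun i => ((unitVec i, 0) : E d × E d)) ++
      l'.map (fun i => (0, unitVec i)))).Perm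
      (l.map (fun i => (unitVec i, 0)) ++ (i :: l').map (fun i => (0, unitVec i))) :=
    List.perm_middle.symm
  have e : dirDs (l.map (fun i => ((unitVec i, 0) : E d × E d)) ++ l'.map (fun i => (0, unitVec i)))
      (dirD (0, unitVec i) b) = _ := dirDs_perm hp h.smooth
  rw [e]
  refine (hb x η).trans (le_of_eq ?_)
  rw [mul_assoc (W η), ← Real.rpow_add (by positivity)]
  congr 3
  push_cast [List.length_cons]
  ring

theorem SymBound.norm_le (h : SymBound ρ W b) : ∃ (K : ℕ) (C : ℝ), 0 ≤ C ∧ ∀ x η,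
    ‖b (x, η)‖ ≤ C * (1 + ‖x‖) ^ K * W η := by
  simpa [dirDs] using h.bound [] []

theorem list_sum_perm {α β : Type*} (l : List (α ⊕ β)) :
    ∃ (l₁ : List α) (l₂ : List β), l.Perm (l₁.map Sum.inl ++ l₂.map Sum.inr) := by
  induction l with
  | nil => exact ⟨[], [], by simp⟩
  | cons a l ih =>
    obtain ⟨l₁, l₂, h⟩ := ih
    rcases a with a | a
    · exact ⟨a :: l₁, l₂, h.cons _⟩
    · exact ⟨l₁, a :: l₂, (h.cons _).trans List.perm_middle.symm⟩

theorem prodCoord_map_append (l l' : List (Fin d)) :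
    (l.map Sum.inl ++ l'.map Sum.inr).map (prodCoord d).vec =
      l.map (fun i => (unitVec i, 0)) ++ l'.map (fun i => (0, unitVec i)) := by
  rw [List.map_append, List.map_map, List.map_map]; rfl

theorem SymBound.ampBound (h : SymBound ρ W b) (hρ : 0 ≤ ρ) (hW : ∀ η, 0 ≤ W η) :
    AmpBound W b := by
  refine ⟨fun _ => h.smooth, fun l => ?_⟩
  obtain ⟨l₁, l₂, hp⟩ := list_sum_perm l
  obtain ⟨K, C, hC, hb⟩ := h.bound l₁ l₂
  refine ⟨K, C, hC, fun _ p => ?_⟩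
  rw [dirDs_perm (hp.map _) h.smooth, prodCoord_map_append]
  refine (hb p.1 p.2).trans ?_
  have h1 : (1 + ‖p.2‖) ^ (-ρ * l₂.length) ≤ 1 :=
    Real.rpow_le_one_of_one_le_of_nonpos (one_le_one_add_norm _) (by
      have := mul_nonneg hρ (Nat.cast_nonneg (α := ℝ) l₂.length); linarith)
  have := hW p.2
  gcongr
  exact mul_le_of_le_one_right this h1

theorem SymBound.mono {W' : E d → ℝ} (h : SymBound ρ W b) {C : ℝ} (hC : 0 ≤ C)
    (hW : ∀ η, W η ≤ C * W' η) : SymBound ρ W' b := by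
  refine ⟨h.smooth, fun l l' => ?_⟩
  obtain ⟨K, C', hC', hb⟩ := h.bound l l'
  refine ⟨K, C' * C, by positivity, fun x η => (hb x η).trans ?_⟩
  calc C' * (1 + ‖x‖) ^ K * (W η * (1 + ‖η‖) ^ (-ρ * l'.length))
      ≤ C' * (1 + ‖x‖) ^ K * (C * W' η * (1 + ‖η‖) ^ (-ρ * l'.length)) := by gcongr; exact hW η
    _ = _ := by ring

theorem dirDs_swap (l : List (E d × E d)) (hb : ContDiff ℝ ∞ b) (p : E d × E d) :
    dirDs l (fun p => b p.swap) p = dirDs (l.map Prod.swap) b p.swap := by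
  induction l generalizing b with
  | nil => rfl
  | cons v l ih =>
    simp only [List.map_cons, dirDs]
    rw [← ih (contDiff_dirD hb _)]
    congr 1
    funext q
    let S : E d × E d →L[ℝ] E d × E d :=
      (ContinuousLinearMap.snd ℝ _ _).prod (ContinuousLinearMap.fst ℝ _ _)
    have h3 := (((differentiable_of_contDiff hb) q.swap).hasFDerivAt.comp q S.hasFDerivAt).fderiv
    simp only [Function.comp_def] at h3
    simp only [dirD]
    exact congrArg (fun M : E d × E d →L[ℝ] ℂ => M v) h3

/-- For a symbol whose derivatives are bounded by `(1 + ‖x‖) ^ N (1 + ‖η‖) ^ N`, the roles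
of the variables may be exchanged. -/
theorem ampBound_swap {N : ℕ} (hb : ContDiff ℝ ∞ b)
    (h : ∀ l : List (Fin d ⊕ Fin d), ∃ C : ℝ, 0 ≤ C ∧ ∀ x η,
      ‖dirDs (l.map (prodCoord d).vec) b (x, η)‖ ≤ C * (1 + ‖x‖) ^ N * (1 + ‖η‖) ^ N) :
    AmpBound (fun x => (1 + ‖x‖) ^ N) (fun p => b p.swap) := by
  refine ⟨fun _ => hb.comp (contDiff_snd.prodMk contDiff_fst), fun l => ?_⟩
  obtain ⟨C, hC, h⟩ := h (l.map Sum.swap)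
  refine ⟨N, C, hC, fun _ p => ?_⟩
  have := h p.2 p.1
  rw [dirDs_swap _ hb, List.map_map]
  rw [List.map_map] at this
  have e : Prod.swap ∘ (prodCoord d).vec = (prodCoord d).vec ∘ Sum.swap := by
    funext i; rcases i with i | i <;> rfl
  rw [e]
  refine this.trans (le_of_eq ?_)
  ring

theorem bracket_rpow_le {s : ℝ} (hs : 0 ≤ s) : ∃ C : ℝ, 0 < C ∧ ∀ ξ : E d,
    bracket ξ ^ (-s) ≤ C * (1 + ‖ξ‖) ^ (-s) := by
  refine ⟨2 ^ s, by positivity, fun ξ => ?_⟩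
  have hb : 0 < bracket ξ := Real.sqrt_pos.2 (by positivity)
  have h1 : 1 + ‖ξ‖ ≤ 2 * bracket ξ := by
    have h2 : 1 ≤ bracket ξ := by
      unfold bracket; rw [Real.one_le_sqrt]; nlinarith [norm_nonneg ξ]
    have h3 : ‖ξ‖ ≤ bracket ξ := Real.le_sqrt_of_sq_le (by linarith)
    linarith
  rw [Real.rpow_neg hb.le, Real.rpow_neg (by positivity), ← div_eq_mul_inv,
    le_div_iff₀ (by positivity), inv_mul_le_iff₀ (by positivity), ← Real.mul_rpow (by positivity)
      (by norm_num)]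
  exact Real.rpow_le_rpow (by positivity) (by linarith) hs

theorem IsSymbol.dirDs_le {w₀ : E d × E d → ℝ} (hw : ∀ p, 0 < w₀ p) (hρ : 0 ≤ ρ)
    {a : E d × E d → ℂ} (ha : IsSymbol ρ 0 w₀ a) (l l' : List (Fin d)) :
    ∃ C : ℝ, 0 ≤ C ∧ ∀ x η,
      ‖dirDs (l.map (fun i => (unitVec i, 0)) ++ l'.map (fun i => (0, unitVec i))) a (x, η)‖ ≤
        C * w₀ (x, η) * (1 + ‖η‖) ^ (-ρ * l'.length) := by
  obtain ⟨C, hC⟩ := ha.bound l.length l'.length l.get l'.get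
  obtain ⟨C', hC', hb⟩ := bracket_rpow_le (d := d) (s := ρ * l'.length) (by positivity)
  refine ⟨|C| * C', by positivity, fun x η => ?_⟩
  have h1 := hC x η
  unfold mixedPartial at h1
  rw [iteratedFDeriv_apply_eq_dirDs ha.smooth, List.ofFn_fin_append] at h1
  have e : ∀ (l : List (Fin d)) (f : Fin d → E d × E d), List.ofFn (fun k => f (l.get k)) = l.map f := by
    intro l f
    conv_rhs => rw [← List.ofFn_get l, List.map_ofFn]
    rfl
  rw [e l (fun i => (EuclideanSpace.single i 1, 0)), e l' (fun i => (0, EuclideanSpace.single i 1))] at h1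
  refine h1.trans ?_
  have hbr : (0 : ℝ) ≤ bracket η ^ (-ρ * l'.length + 0 * l.length) :=
    Real.rpow_nonneg (Real.sqrt_nonneg _) _
  have hw' := (hw (x, η)).le
  calc C * w₀ (x, η) * bracket η ^ (-ρ * l'.length + 0 * l.length)
      ≤ |C| * w₀ (x, η) * bracket η ^ (-ρ * l'.length + 0 * l.length) := by
        gcongr; exact le_abs_self C
    _ ≤ |C| * w₀ (x, η) * (C' * (1 + ‖η‖) ^ (-ρ * l'.length)) := by
        have h2 := hb η
        rw [zero_mul, add_zero, neg_mul]
        gcongr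
    _ = _ := by ring

/-- Moderateness of w₀ bounds w₀(x, η) by w₀(z, η) times a power of 1 + |x|, which is admissible in
`SymBound`. From here on the weight depends on the frequency alone. -/
theorem IsSymbol.symBound {w₀ : E d × E d → ℝ} (hw : IsPolyModerate w₀) (hρ : 0 ≤ ρ)
    {a : E d × E d → ℂ} (ha : IsSymbol ρ 0 w₀ a) (z : E d) : SymBound ρ (fun η => w₀ (z, η)) a := by
  obtain ⟨N, C, hC, hN⟩ := hw.slice_le
  refine ⟨ha.smooth, fun l l' => ?_⟩
  obtain ⟨C', hC', h⟩ := ha.dirDs_le hw.pos hρ l l'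
  refine ⟨N, C' * C * (1 + ‖z‖) ^ N, by positivity, fun x η => (h x η).trans ?_⟩
  have h1 := hw.pos (z, η)
  calc C' * w₀ (x, η) * (1 + ‖η‖) ^ (-ρ * l'.length)
      ≤ C' * (C * w₀ (z, η) * ((1 + ‖x‖) ^ N * (1 + ‖z‖) ^ N)) * (1 + ‖η‖) ^ (-ρ * l'.length) := by
        gcongr
        refine (hN x z η).trans ?_
        gcongr
        exact one_add_norm_sub_pow_le _ _ _
    _ = _ := by ring

theorem IsSymbol.dirDs_le_pow {w₀ : E d × E d → ℝ} (hw : IsPolyModerate w₀) (hρ : 0 ≤ ρ)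
    {a : E d × E d → ℂ} (ha : IsSymbol ρ 0 w₀ a) : ∃ N : ℕ, ∀ l : List (Fin d ⊕ Fin d), ∃ C : ℝ, 0 ≤ C ∧
      ∀ x η, ‖dirDs (l.map (prodCoord d).vec) a (x, η)‖ ≤ C * (1 + ‖x‖) ^ N * (1 + ‖η‖) ^ N := by
  obtain ⟨N, C, hC, hN⟩ := hw.exists_le_pow
  refine ⟨N, fun l => ?_⟩
  obtain ⟨l₁, l₂, hp⟩ := list_sum_perm l
  obtain ⟨C', hC', h⟩ := ha.dirDs_le hw.pos hρ l₁ l₂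
  refine ⟨C' * C, by positivity, fun x η => ?_⟩
  rw [dirDs_perm (hp.map _) ha.smooth, prodCoord_map_append]
  refine (h x η).trans ?_
  have h1 : (1 + ‖η‖) ^ (-ρ * l₂.length) ≤ 1 :=
    Real.rpow_le_one_of_one_le_of_nonpos (one_le_one_add_norm _) (by
      have := mul_nonneg hρ (Nat.cast_nonneg (α := ℝ) l₂.length); linarith)
  have h2 := hw.pos (x, η)
  have h3 : 1 + ‖((x, η) : E d × E d)‖ ≤ (1 + ‖x‖) * (1 + ‖η‖) := by
    rw [Prod.norm_def]
    rcases max_cases ‖x‖ ‖η‖ with h | h <;> simp only [h.1] <;>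
      nlinarith [norm_nonneg x, norm_nonneg η, mul_nonneg (norm_nonneg x) (norm_nonneg η)]
  calc C' * w₀ (x, η) * (1 + ‖η‖) ^ (-ρ * l₂.length) ≤ C' * w₀ (x, η) * 1 := by gcongr
    _ ≤ C' * (C * ((1 + ‖x‖) * (1 + ‖η‖)) ^ N) * 1 := by
        gcongr
        refine (hN _).trans ?_
        gcongr
    _ = _ := by rw [mul_pow]; ring

end OscOp

end FourierBF

end

noncomputable section

namespace FourierBF

open scoped ContDiff FourierTransform

/-! ### The operator and its transpose -/

section Operator

variable {d : ℕ}

/-- 𝓢' carries the topology of pointwise convergence on 𝓢, whose continuous functionals are the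
evaluations. Hence a continuous operator on 𝓢' automatically has a transpose acting on 𝓢. -/
theorem exists_eval_of_clm (A : 𝓢'(E d, ℂ) →L[ℂ] 𝓢'(E d, ℂ)) (φ : 𝓢(E d, ℂ)) :
    ∃ Φ : 𝓢(E d, ℂ), ∀ f : 𝓢'(E d, ℂ), A f φ = f Φ := by
  let e := PointwiseConvergenceCLM.equivWeakDual (𝕜 := ℂ) (E := 𝓢(E d, ℂ))
  let u : 𝓢'(E d, ℂ) →L[ℂ] ℂ := (PointwiseConvergenceCLM.evalCLM (RingHom.id ℂ) ℂ φ).comp A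
  let w : WeakDual ℂ 𝓢(E d, ℂ) →L[ℂ] ℂ := u.comp (e.symm : WeakDual ℂ 𝓢(E d, ℂ) →L[ℂ] 𝓢'(E d, ℂ))
  obtain ⟨Φ, hΦ⟩ := LinearMap.dualEmbedding_surjective (topDualPairing ℂ 𝓢(E d, ℂ)) w
  refine ⟨Φ, fun f => ?_⟩
  have h := congrArg (fun W => W (e f)) hΦ
  have h2 : w (e f) = A f φ := by
    simp only [w, ContinuousLinearMap.comp_apply, ContinuousLinearEquiv.coe_coe,
      ContinuousLinearEquiv.symm_apply_apply]
    rfl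
  exact h2.symm.trans h.symm

theorem schwartz_eq_of_integral_mul {Φ Ψ : 𝓢(E d, ℂ)}
    (h : ∀ θ : 𝓢(E d, ℂ), ∫ x, θ x * Φ x = ∫ x, θ x * Ψ x) : Φ = Ψ := by
  have hi : ∀ θ Φ : 𝓢(E d, ℂ), Integrable fun x => θ x * Φ x := fun θ Φ => by
    obtain ⟨C, hC, hb⟩ := exists_norm_le_dec Φ 0
    exact schwartz_mul_integrable θ Φ.continuous (C := C) fun x =>
      (hb x).trans (mul_le_of_le_one_right hC (dec_le_one _ _))
  have hl : LocallyIntegrable (fun x => Φ x - Ψ x) := (Φ.integrable.sub Ψ.integrable).locallyIntegrable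
  have h0 : ∀ᵐ x, Φ x - Ψ x = 0 := by
    refine ae_eq_zero_of_integral_contDiff_smul_eq_zero hl fun g hg hgs => ?_
    have hgc : HasCompactSupport fun x => (g x : ℂ) := hgs.comp_left (g := fun t : ℝ => (t : ℂ)) rfl
    let θ : 𝓢(E d, ℂ) := hgc.toSchwartzMap (Complex.ofRealCLM.contDiff.comp hg)
    have hθ : ∀ x, θ x = g x := fun x => rfl
    have h1 := h θ
    rw [← sub_eq_zero, ← integral_sub (hi _ _) (hi _ _)] at h1
    rw [← h1]
    refine integral_congr_ae (ae_of_all _ fun x => ?_)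
    simp only [hθ, Complex.real_smul]; ring
  have h1 : (fun x => Φ x) = fun x => Ψ x :=
    Continuous.ae_eq_iff_eq (volume : Measure (E d)) Φ.continuous Ψ.continuous |>.1
      (h0.mono fun x hx => sub_eq_zero.1 hx)
  exact DFunLike.coe_injective h1

/-- The normalization `(2π)^{-d}`. -/
def cFS (d : ℕ) : ℂ := (((2 * Real.pi) ^ (-(d : ℝ)) : ℝ) : ℂ)

theorem cFS_mul (d : ℕ) : cFS d * (((2 * Real.pi) ^ d : ℝ) : ℂ) = 1 := by
  rw [cFS, ← Complex.ofReal_mul, Real.rpow_neg Real.two_pi_pos.le, Real.rpow_natCast,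
    inv_mul_cancel₀ (by positivity), Complex.ofReal_one]

theorem opSchwartz_eq_oscInt (a : E d × E d → ℂ) (φ : 𝓢(E d, ℂ)) (x : E d) :
    opSchwartz a φ x = cFS d * oscInt (fun p => a p.swap) (FS φ) 0 x := by
  rw [opSchwartz, cFS, oscInt]
  congr 1
  refine integral_congr_ae (ae_of_all _ fun ξ => ?_)
  simp only [sub_zero, Prod.swap_prod_mk]
  rw [FS_apply, ← integral_mul_const, ← integral_mul_const]
  refine integral_congr_ae (ae_of_all _ fun y => ?_)
  have : Complex.exp (Complex.I * ((inner ℝ (x - y) ξ : ℝ) : ℂ)) = chr x ξ * chr y (-ξ) := by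
    rw [← chr_neg_left, ← chr_add_left, ← sub_eq_add_neg]; rfl
  simp only [this, chr_comm ξ x]
  ring

/-- The operator `Op(a)` on `𝒮`, the operator `θ ↦ ∫ θ(x) a(x, ·) e^{i⟨x, ·⟩} dx` and
the transpose of `Op(a)`. -/
theorem exists_transpose {w₀ : E d × E d → ℝ} (hw : IsPolyModerate w₀) {ρ : ℝ} (hρ : 0 ≤ ρ)
    {a : E d × E d → ℂ} (ha : IsSymbol ρ 0 w₀ a) :
    ∃ S T : 𝓢(E d, ℂ) →L[ℂ] 𝓢(E d, ℂ), (∀ φ x, S φ x = opSchwartz a φ x) ∧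
      (∀ θ η, T θ η = oscInt a θ 0 η) ∧
      ∀ θ φ, ∫ x, φ x * S θ x = ∫ x, θ x * (cFS d • FS (T φ)) x := by
  obtain ⟨N, hN⟩ := ha.dirDs_le_pow hw hρ
  have hamp : AmpBound (fun η => (1 + ‖η‖) ^ N) a := by
    refine ⟨fun _ => ha.smooth, fun l => ?_⟩
    obtain ⟨C, hC, h⟩ := hN l
    exact ⟨N, C, hC, fun _ p => h p.1 p.2⟩
  obtain ⟨T, hT⟩ := exists_oscCLM hamp
  obtain ⟨S₀, hS₀⟩ := exists_oscCLM (ampBound_swap ha.smooth hN)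
  refine ⟨cFS d • S₀.comp FS, T, fun φ x => ?_, hT, fun θ φ => ?_⟩
  · rw [opSchwartz_eq_oscInt, ← hS₀]; rfl
  · obtain ⟨C, hC, hb⟩ := hN []
    have hL : ∀ x, φ x * (cFS d • S₀.comp FS) θ x =
        cFS d * ∫ ξ, φ x * (FS θ ξ * a (x, ξ) * chr x ξ) := by
      intro x
      change φ x * (cFS d * S₀ (FS θ) x) = _
      rw [hS₀, oscInt, integral_const_mul]
      simp only [sub_zero, Prod.swap_prod_mk, chr_comm x]
      ring
    have hR : ∫ x, θ x * (cFS d • FS (T φ)) x = cFS d * ∫ ξ, ∫ x, φ x * (FS θ ξ * a (x, ξ) * chr x ξ) := by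
      have e1 : ∀ x, θ x * (cFS d • FS (T φ)) x = cFS d * (θ x * FS (T φ) x) := fun x => by
        rw [smul_apply, smul_eq_mul]; ring
      simp_rw [e1]
      rw [integral_const_mul, ← integral_FS_mul]
      congr 1
      refine integral_congr_ae (ae_of_all _ fun ξ => ?_)
      simp only [hT, oscInt, sub_zero]
      rw [← integral_const_mul]
      refine integral_congr_ae (ae_of_all _ fun x => ?_)
      simp only; ring
    simp_rw [hL]
    rw [integral_const_mul, hR, integral_integral_swap]
    have h1 := ((integrable_pow_mul_schwartz φ N).mul_prod (integrable_pow_mul_schwartz (FS θ) N)).const_mul C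
    have hac : Continuous a := ha.smooth.continuous
    refine h1.mono' (Continuous.aestronglyMeasurable (by
      simp only [Function.uncurry_def]; fun_prop)) (ae_of_all _ fun p => ?_)
    simp only [Function.uncurry_def, norm_mul, norm_chr, mul_one]
    have := hb p.1 p.2
    simp only [List.map_nil, dirDs] at this
    calc ‖φ p.1‖ * (‖FS θ p.2‖ * ‖a (p.1, p.2)‖) ≤
        ‖φ p.1‖ * (‖FS θ p.2‖ * (C * (1 + ‖p.1‖) ^ N * (1 + ‖p.2‖) ^ N)) := by gcongr
      _ = _ := by ring

/-- The transpose of any extension is determined by the action on Schwartz functions, through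
pairings with all of them. This gives uniqueness together with an explicit formula; existence is
composition with that transpose. -/
theorem existsUnique_isOpExtension {w₀ : E d × E d → ℝ} (hw : IsPolyModerate w₀) {ρ : ℝ} (hρ : 0 ≤ ρ)
    {a : E d × E d → ℂ} (ha : IsSymbol ρ 0 w₀ a) :
    (∃! A : 𝓢'(E d, ℂ) →L[ℂ] 𝓢'(E d, ℂ), IsOpExtension a A) ∧
    ∃ T : 𝓢(E d, ℂ) →L[ℂ] 𝓢(E d, ℂ), (∀ θ η, T θ η = oscInt a θ 0 η) ∧
      ∀ A : 𝓢'(E d, ℂ) →L[ℂ] 𝓢'(E d, ℂ), IsOpExtension a A →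
        ∀ f φ, A f φ = cFS d * f (FS (T φ)) := by
  obtain ⟨S, T, hS, hT, hST⟩ := exists_transpose hw hρ ha
  have key : ∀ A : 𝓢'(E d, ℂ) →L[ℂ] 𝓢'(E d, ℂ), IsOpExtension a A →
        ∀ f φ, A f φ = cFS d * f (FS (T φ)) := by
    intro A hA f φ
    obtain ⟨Φ, hΦ⟩ := exists_eval_of_clm A φ
    have e : Φ = cFS d • FS (T φ) := by
      refine schwartz_eq_of_integral_mul fun θ => ?_
      obtain ⟨ψ, hψ, hAψ⟩ := hA θ
      have h1 := hΦ (SchwartzMap.toTemperedDistributionCLM (E d) ℂ volume θ)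
      rw [hAψ, SchwartzMap.coe_apply, SchwartzMap.coe_apply] at h1
      have h2 : ∫ x, θ x * Φ x = ∫ x, Φ x • θ x :=
        integral_congr_ae (ae_of_all _ fun x => mul_comm _ _)
      rw [h2, ← h1, ← hST]
      refine integral_congr_ae (ae_of_all _ fun x => ?_)
      simp only [smul_eq_mul, hψ, hS]
    rw [hΦ, e, map_smul, smul_eq_mul]
  refine ⟨⟨PointwiseConvergenceCLM.precomp ℂ (cFS d • FS.comp T), fun φ => ⟨S φ, hS φ, ?_⟩,
    fun A hA => ?_⟩, T, hT, key⟩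
  · ext ψ
    change SchwartzMap.toTemperedDistributionCLM (E d) ℂ volume φ (cFS d • FS (T ψ)) = _
    rw [SchwartzMap.coe_apply, SchwartzMap.coe_apply]
    have := hST φ ψ
    simp only [smul_eq_mul]
    rw [this]
    exact integral_congr_ae (ae_of_all _ fun x => mul_comm _ _)
  · ext f φ
    rw [key A hA]
    change _ = f (cFS d • FS (T φ))
    rw [map_smul, smul_eq_mul]

end Operator

end FourierBF

end

noncomputable section

namespace FourierBF

open scoped ContDiff FourierTransform

/-! ### The Fourier transform of a localized distribution -/

section LocalizedFourier

variable {d : ℕ}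

theorem hasSum_of_forall_eq {ι : Type*} {f g : ι → ℂ} {a : ℂ} (h : HasSum f a)
    (e : ∀ i, g i = f i) : HasSum g a := (funext e : g = f) ▸ h

/-- Summable seminorms allow termwise differentiation, so each seminorm of the remainder is at most
a tail of a convergent series. This is what lets a distribution be applied term by term to a Fourier
series. -/
theorem hasSum_schwartz {ι : Type*} {t : ι → 𝓢(E d, ℂ)} {φ : 𝓢(E d, ℂ)}
    (hφ : ∀ x, HasSum (fun i => t i x) (φ x))
    (ht : ∀ k n, Summable fun i => SchwartzMap.seminorm ℂ k n (t i)) : HasSum t φ := by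
  have hle : ∀ n i x, ‖iteratedFDeriv ℝ n (t i) x‖ ≤ SchwartzMap.seminorm ℂ 0 n (t i) := by
    intro n i x
    simpa using SchwartzMap.le_seminorm ℂ 0 n (t i) x
  have hD : ∀ n x, HasSum (fun i => iteratedFDeriv ℝ n (t i) x) (iteratedFDeriv ℝ n φ x) := by
    intro n x
    have h1 : (φ : E d → ℂ) = fun x => ∑' i, t i x := funext fun x => (hφ x).tsum_eq.symm
    rw [h1, iteratedFDeriv_tsum_apply (𝕜 := ℝ) (N := ⊤) (v := fun n i => SchwartzMap.seminorm ℂ 0 n (t i))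
      (fun i => (t i).smooth ⊤) (fun n _ => ht 0 n) (fun n i x _ => hle n i x) le_top]
    exact (Summable.of_norm_bounded (ht 0 n) fun i => hle n i x).hasSum
  refine ((schwartz_withSeminorms ℂ (E d) ℂ).tendsto_nhds _ _).2 ?_
  rintro ⟨k, n⟩ ε hε
  have hs := ht k n
  have h0 := tendsto_tsum_compl_atTop_zero fun i => SchwartzMap.seminorm ℂ k n (t i)
  filter_upwards [h0.eventually_lt_const hε] with S hS
  refine lt_of_le_of_lt ?_ hS
  change SchwartzMap.seminorm ℂ k n (∑ i ∈ S, t i - φ) ≤ _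
  rw [map_sub_rev]
  refine SchwartzMap.seminorm_le_bound ℂ k n _ (tsum_nonneg fun i => apply_nonneg _ _) fun x => ?_
  have hsum : iteratedFDeriv ℝ n (⇑(φ - ∑ i ∈ S, t i)) x =
      ∑' i : { i // i ∉ S }, iteratedFDeriv ℝ n (t i) x := by
    have e : (⇑(φ - ∑ i ∈ S, t i) : E d → ℂ) = ⇑φ - fun x => ∑ i ∈ S, t i x := by
      funext x
      have : ∀ S : Finset ι, (∑ i ∈ S, t i) x = ∑ i ∈ S, t i x := by
        intro S
        induction S using Finset.cons_induction with
        | empty => simp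
        | cons j s hj ih2 => rw [Finset.sum_cons, Finset.sum_cons, add_apply, ih2]
      rw [Pi.sub_apply, ← this]; rfl
    have hc : ∀ i, ContDiff ℝ n (t i) := fun i => ((t i).smooth ⊤).of_le (by exact_mod_cast le_top)
    rw [e, iteratedFDeriv_sub_apply ((φ.smooth ⊤).of_le (by exact_mod_cast le_top)).contDiffAt
      (ContDiff.sum fun i _ => hc i).contDiffAt,
      iteratedFDeriv_fun_sum_apply (fun i _ => (hc i).contDiffAt), ← (hD n x).tsum_eq,
      ← (hD n x).summable.sum_add_tsum_subtype_compl S, add_sub_cancel_left]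
  rw [hsum]
  refine (mul_le_mul_of_nonneg_left (norm_tsum_le_tsum_norm ?_) (by positivity)).trans ?_
  · exact (Summable.of_nonneg_of_le (fun _ => norm_nonneg _) (fun i => hle n i x) (ht 0 n)).subtype _
  · rw [← tsum_mul_left]
    refine Summable.tsum_le_tsum (fun i => ?_) ?_ (hs.subtype _)
    · exact SchwartzMap.le_seminorm ℂ k n (t i) x
    · exact (Summable.of_nonneg_of_le (fun _ => by positivity)
        (fun i => SchwartzMap.le_seminorm ℂ k n (t i) x) hs).subtype _

theorem modulate_apply (ψ : 𝓢(E d, ℂ)) (hψ : HasCompactSupport ψ) (ξ y : E d) :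
    modulate ψ hψ ξ y = ψ y * chr y (-ξ) := by
  rw [chr_neg_right]; rfl

theorem norm_iteratedFDeriv_chr_le (n : ℕ) : ∃ C : ℝ, 0 ≤ C ∧ ∀ ξ x : E d,
    ‖iteratedFDeriv ℝ n (fun y => chr y ξ) x‖ ≤ C * (1 + ‖ξ‖) ^ n := by
  obtain ⟨C, hC, h⟩ := norm_iteratedFDeriv_le_of_dirDs (stdCoord d) n
  refine ⟨C, hC, fun ξ x => h _ (contDiff_chr contDiff_id contDiff_const) x _ fun l hl => ?_⟩
  have key : ∀ (l : List (Fin d)) (c : ℂ),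
      ‖dirDs (l.map (stdCoord d).vec) (fun y => c * chr y ξ) x‖ ≤ ‖c‖ * (1 + ‖ξ‖) ^ l.length := by
    intro l
    induction l with
    | nil => intro c; simp [dirDs, norm_chr]
    | cons i l ih =>
      intro c
      have e : dirD ((stdCoord d).vec i) (fun y => c * chr y ξ) =
          fun y => c * (Complex.I * ((ξ i : ℝ) : ℂ)) * chr y ξ := by
        rw [dirD_mul (b := fun _ => c) (c := fun y => chr y ξ) (differentiable_const _)
          (differentiable_of_contDiff (contDiff_chr contDiff_id contDiff_const))]
        funext y
        have := dirD_chr y ξ ((stdCoord d).vec i)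
        simp only [dirD_const]
        rw [this]
        simp [stdCoord, unitVec, EuclideanSpace.inner_single_left]
        ring
      simp only [List.map_cons, dirDs, e, List.length_cons]
      refine (ih _).trans ?_
      have h1 : ‖(ξ i : ℝ)‖ ≤ ‖ξ‖ := PiLp.norm_apply_le ξ i
      have h2 : ‖c * (Complex.I * ((ξ i : ℝ) : ℂ))‖ ≤ ‖c‖ * (1 + ‖ξ‖) := by
        rw [norm_mul, norm_mul, Complex.norm_I, one_mul, Complex.norm_real]
        gcongr
        linarith
      calc _ ≤ ‖c‖ * (1 + ‖ξ‖) * (1 + ‖ξ‖) ^ l.length := by gcongr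
        _ = _ := by ring
  have := key l 1
  simpa [hl] using this

theorem exists_seminorm_modulate_le (ψ : 𝓢(E d, ℂ)) (hψ : HasCompactSupport ψ) (k n : ℕ) :
    ∃ C : ℝ, 0 ≤ C ∧ ∀ ξ, SchwartzMap.seminorm ℂ k n (modulate ψ hψ ξ) ≤ C * (1 + ‖ξ‖) ^ n := by
  choose C hC h using fun j => norm_iteratedFDeriv_chr_le (d := d) j
  refine ⟨∑ i ∈ Finset.range (n + 1), n.choose i * SchwartzMap.seminorm ℂ k i ψ * C (n - i),
    Finset.sum_nonneg fun i _ => mul_nonneg (mul_nonneg (by positivity) (apply_nonneg _ _)) (hC _),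
    fun ξ => ?_⟩
  refine SchwartzMap.seminorm_le_bound ℂ k n _ (mul_nonneg (Finset.sum_nonneg fun i _ =>
    mul_nonneg (mul_nonneg (by positivity) (apply_nonneg _ _)) (hC _)) (by positivity)) fun x => ?_
  have e : (⇑(modulate ψ hψ ξ) : E d → ℂ) = fun y => ψ y * chr y (-ξ) :=
    funext fun y => modulate_apply ψ hψ ξ y
  rw [e]
  refine (mul_le_mul_of_nonneg_left (norm_iteratedFDeriv_mul_le (N := ∞) (ψ.smooth ⊤)
    (contDiff_chr contDiff_id contDiff_const) x (by exact_mod_cast le_top)) (by positivity)).trans ?_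
  rw [Finset.mul_sum, Finset.sum_mul]
  refine Finset.sum_le_sum fun i _ => ?_
  have h1 := SchwartzMap.le_seminorm ℂ k i ψ x
  have h2 := h (n - i) (-ξ) x
  rw [norm_neg] at h2
  have h3 : (1 + ‖ξ‖) ^ (n - i) ≤ (1 + ‖ξ‖) ^ n :=
    pow_le_pow_right₀ (one_le_one_add_norm ξ) (Nat.sub_le _ _)
  have := hC (n - i)
  calc ‖x‖ ^ k * (n.choose i * ‖iteratedFDeriv ℝ i ψ x‖ * ‖iteratedFDeriv ℝ (n - i) (fun y => chr y (-ξ)) x‖)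
      = n.choose i * (‖x‖ ^ k * ‖iteratedFDeriv ℝ i ψ x‖) *
        ‖iteratedFDeriv ℝ (n - i) (fun y => chr y (-ξ)) x‖ := by ring
    _ ≤ n.choose i * SchwartzMap.seminorm ℂ k i ψ * (C (n - i) * (1 + ‖ξ‖) ^ n) := by
        gcongr
        exact h2.trans (by gcongr)
    _ = _ := by ring

/-- The unnormalized Fourier transform of `ψ f`. -/
def locF (f : 𝓢'(E d, ℂ)) (ψ : 𝓢(E d, ℂ)) (hψ : HasCompactSupport ψ) (ξ : E d) : ℂ :=
  f (modulate ψ hψ ξ)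

theorem exists_seminorm_functional (u : 𝓢(E d, ℂ) →L[ℂ] ℂ) : ∃ (s : Finset (ℕ × ℕ)) (C : ℝ), 0 ≤ C ∧
    ∀ φ, ‖u φ‖ ≤ C * ∑ i ∈ s, SchwartzMap.seminorm ℂ i.1 i.2 φ := by
  let q : Seminorm ℂ 𝓢(E d, ℂ) := (normSeminorm ℂ ℂ).comp u.toLinearMap
  have hq : Continuous q := continuous_norm.comp u.continuous
  obtain ⟨s, C, hC, h⟩ := exists_sup_seminorm_le hq
  refine ⟨s, C, hC, fun φ => (h φ).trans (mul_le_mul_of_nonneg_left ?_ hC)⟩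
  refine Seminorm.finset_sup_apply_le (Finset.sum_nonneg fun i _ => apply_nonneg _ _) fun i hi => ?_
  exact Finset.single_le_sum (f := fun i : ℕ × ℕ => SchwartzMap.seminorm ℂ i.1 i.2 φ)
    (fun i _ => apply_nonneg _ _) hi

variable (f : 𝓢'(E d, ℂ)) (ψ : 𝓢(E d, ℂ)) (hψ : HasCompactSupport ψ)

theorem exists_norm_locF_le : ∃ (N : ℕ) (C : ℝ), 0 ≤ C ∧ ∀ ξ, ‖locF f ψ hψ ξ‖ ≤ C * (1 + ‖ξ‖) ^ N := by
  obtain ⟨s, C, hC, h⟩ := exists_seminorm_functional (f : 𝓢(E d, ℂ) →L[ℂ] ℂ)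
  choose D hD hDle using fun i : ℕ × ℕ => exists_seminorm_modulate_le ψ hψ i.1 i.2
  refine ⟨s.sup Prod.snd, C * ∑ i ∈ s, D i,
    mul_nonneg hC (Finset.sum_nonneg fun i _ => hD i), fun ξ => (h _).trans ?_⟩
  rw [mul_assoc, Finset.sum_mul]
  refine mul_le_mul_of_nonneg_left (Finset.sum_le_sum fun i hi => (hDle i ξ).trans ?_) hC
  exact mul_le_mul_of_nonneg_left (pow_le_pow_right₀ (one_le_one_add_norm ξ)
    (Finset.le_sup (f := Prod.snd) hi)) (hD i)

/-- Expanding u in a Fourier series on a ball containing supp ψ writes φ as a sum of characters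
times ψ. The coefficients decay rapidly, so the series converges in 𝓢 and f passes through it. -/
theorem hasSum_locF {R : ℝ} (hR : 0 < R) (hψR : ∀ x, R ≤ ‖x‖ → ψ x = 0) {u φ : 𝓢(E d, ℂ)} {ξ : E d}
    (hu : ∀ x, R ≤ ‖x‖ → u x = 0) (hφ : ∀ x, φ x = ψ x * u x * chr x (-ξ)) :
    HasSum (fun k => (((4 * R) ^ d : ℝ) : ℂ)⁻¹ * FS u (latt (Real.pi / (2 * R)) k) *
      locF f ψ hψ (ξ - latt (Real.pi / (2 * R)) k)) (f φ) := by
  set δ := Real.pi / (2 * R)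
  have hδ : 0 < δ := by positivity
  let c : (Fin d → ℤ) → ℂ := fun k => (((4 * R) ^ d : ℝ) : ℂ)⁻¹ * FS u (latt δ k)
  have hdecay : ∀ M : ℕ, ∃ C : ℝ, 0 ≤ C ∧ ∀ k, ‖c k‖ ≤ C * dec M (latt δ k) := by
    intro M
    obtain ⟨C, hC, h⟩ := exists_norm_le_dec (FS u) M
    refine ⟨‖(((4 * R) ^ d : ℝ) : ℂ)⁻¹‖ * C, by positivity, fun k => ?_⟩
    rw [norm_mul, mul_assoc]
    gcongr
    exact h _
  have hsum : HasSum (fun k => c k • modulate ψ hψ (ξ - latt δ k)) φ := by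
    refine hasSum_schwartz (fun x => ?_) fun k n => ?_
    · simp only [smul_apply, smul_eq_mul, modulate_apply]
      by_cases hx : R ≤ ‖x‖
      · simp only [hφ, hψR x hx, zero_mul, mul_zero]
        exact hasSum_zero
      have h1 := hasSum_fourierSeries u.continuous hR hu (x := x) ?_ (by linarith [not_le.1 hx])
      · have h2 := h1.mul_left (ψ x * chr x (-ξ))
        rw [show φ x = ψ x * chr x (-ξ) * u x by rw [hφ]; ring]
        refine hasSum_of_forall_eq h2 fun k => ?_
        simp only [c, FS_apply]
        rw [show -(ξ - latt δ k) = -ξ + latt δ k by abel, chr_add]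
        ring
      · obtain ⟨C, hC, h⟩ := exists_norm_le_dec (FS u) (d + 1)
        refine Summable.of_norm_bounded ((summable_dec_latt hδ (Nat.lt_succ_self d)).mul_left C) fun k => ?_
        rw [← FS_apply]; exact h _
    · obtain ⟨C, hC, h⟩ := exists_seminorm_modulate_le ψ hψ k n
      obtain ⟨C', hC', h'⟩ := hdecay (d + 1 + n)
      refine Summable.of_nonneg_of_le (fun _ => apply_nonneg _ _) (fun j => ?_)
        ((summable_dec_latt hδ (Nat.lt_succ_self d)).mul_left (C' * (C * (1 + ‖ξ‖) ^ n)))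
      rw [map_smul_eq_mul]
      calc ‖c j‖ * SchwartzMap.seminorm ℂ k n (modulate ψ hψ (ξ - latt δ j))
          ≤ (C' * dec (d + 1 + n) (latt δ j)) * (C * ((1 + ‖ξ‖) ^ n * (1 + ‖latt δ j‖) ^ n)) := by
            refine mul_le_mul (h' j) ((h _).trans ?_) (apply_nonneg _ _)
              (mul_nonneg hC' (dec_nonneg _ _))
            gcongr
            exact one_add_norm_sub_pow_le _ _ _
        _ = C' * (C * (1 + ‖ξ‖) ^ n) * (dec (d + 1 + n) (latt δ j) * (1 + ‖latt δ j‖) ^ n) := by ring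
        _ = _ := by rw [dec_add_mul_pow]
  have h1 := (f : 𝓢(E d, ℂ) →L[ℂ] ℂ).hasSum hsum
  refine hasSum_of_forall_eq h1 fun k => ?_
  change _ = f (c k • _)
  rw [map_smul, smul_eq_mul]
  rfl

theorem exists_pos_eq_zero {ψ : 𝓢(E d, ℂ)} (hψ : HasCompactSupport ψ) :
    ∃ R : ℝ, 0 < R ∧ ∀ x, R ≤ ‖x‖ → ψ x = 0 := by
  obtain ⟨R, hR⟩ := hψ.isCompact.isBounded.subset_closedBall (0 : E d)
  refine ⟨|R| + 1, by positivity, fun x hx => ?_⟩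
  by_contra h
  have := hR (subset_tsupport _ (Function.mem_support.2 h))
  rw [mem_closedBall_zero_iff] at this
  linarith [le_abs_self R]

/-- The values of `locF f ψ` are given by sampling on a lattice, and `locF f ψ` represents
the Fourier transform of `ψ f`. -/
theorem exists_sampling : ∃ (δ : ℝ) (m : E d → ℂ), 0 < δ ∧ Continuous m ∧
    (∀ M : ℕ, ∃ C : ℝ, 0 ≤ C ∧ ∀ τ, ‖m τ‖ ≤ C * dec M τ) ∧
    (∀ ξ η, HasSum (fun k => m (η - latt δ k) * locF f ψ hψ (ξ - latt δ k)) (locF f ψ hψ (ξ - η))) ∧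
    ∀ g φ : 𝓢(E d, ℂ), (∀ x, φ x = ψ x * FS g x) →
      HasSum (fun k => ∫ η, g η * (m (-η - latt δ k) * locF f ψ hψ (-latt δ k))) (f φ) := by
  obtain ⟨r, hr, hψr⟩ := exists_pos_eq_zero hψ
  -- ψ lives in radius r, while the auxiliary cut-off χ equals 1 there and lives in radius 2r; the
  -- radius 2r serves both.
  have hR : 0 < 2 * r := by positivity
  have hψR : ∀ x, 2 * r ≤ ‖x‖ → ψ x = 0 := fun x hx => hψr x (by linarith)
  let χ := sbump (0 : E d) r hr
  have hχR : ∀ x, 2 * r ≤ ‖x‖ → χ x = 0 := fun x hx => sbump_eq_zero _ _ hr (by simpa using hx)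
  have hχψ : ∀ x, ψ x * χ x = ψ x := by
    intro x
    by_cases hx : r ≤ ‖x‖
    · rw [hψr x hx, zero_mul]
    · rw [sbump_eq_one _ _ hr (by simpa using (not_le.1 hx).le), mul_one]
  have hχc : HasCompactSupport χ := hasCompactSupport_sbump _ _ hr
  let c : ℂ := (((4 * (2 * r)) ^ d : ℝ) : ℂ)⁻¹
  refine ⟨Real.pi / (2 * (2 * r)), fun τ => c * FS χ (-τ), by positivity, by fun_prop, fun M => ?_,
    fun ξ η => ?_, fun g φ hφ => ?_⟩
  · obtain ⟨C, hC, h⟩ := exists_norm_le_dec (FS χ) M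
    refine ⟨‖c‖ * C, by positivity, fun τ => ?_⟩
    rw [norm_mul, mul_assoc, ← dec_neg]
    gcongr
    exact h _
  -- Taking u = χ e^{i⟨·,η⟩} and ψχ = ψ, the coefficients become the Fourier transform of χ at κ −
  -- η, which is the kernel m up to the normalizing constant.
  · refine hasSum_of_forall_eq (hasSum_locF f ψ hψ hR hψR (u := modulate χ hχc (-η))
      (φ := modulate ψ hψ (ξ - η)) (ξ := ξ) (fun x hx => by simp [modulate_apply, hχR x hx])
      fun x => ?_) fun k => ?_
    · rw [modulate_apply, modulate_apply, neg_neg, show -(ξ - η) = η + -ξ by abel, chr_add]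
      linear_combination (-(chr x η * chr x (-ξ))) * hχψ x
    · have e : ∀ y, FS (modulate χ hχc (-η)) y = FS χ (-(η - y)) := by
        intro y
        rw [FS_apply, FS_apply]
        refine integral_congr_ae (ae_of_all _ fun x => ?_)
        simp only [modulate_apply]
        rw [neg_neg, neg_neg, mul_assoc, ← chr_add, sub_eq_add_neg]
      rw [e]
  -- For the second formula u = χ · FS g; moving the Fourier transform onto the modulated χ turns
  -- the coefficient into an integral of g against m.
  · let u : 𝓢(E d, ℂ) := hχc.mul_right (f' := FS g) |>.toSchwartzMap
      ((χ.smooth ⊤).mul ((FS g).smooth ⊤))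
    have hu : ∀ x, u x = χ x * FS g x := fun x => rfl
    refine hasSum_of_forall_eq (hasSum_locF f ψ hψ hR hψR (u := u) (φ := φ) (ξ := 0)
      (fun x hx => by rw [hu, hχR x hx, zero_mul]) fun x => ?_) fun k => ?_
    · rw [neg_zero, chr_zero, mul_one, hu, ← mul_assoc, hχψ, hφ]
    · set y := latt (Real.pi / (2 * (2 * r))) k
      rw [zero_sub]
      have e : FS u y = ∫ η, g η * FS χ (-(-η - y)) := by
        have h1 : FS u y = ∫ x, modulate χ hχc y x * FS g x := by
          rw [FS_apply]
          refine integral_congr_ae (ae_of_all _ fun x => ?_)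
          simp only [modulate_apply, hu]; ring
        rw [h1, ← integral_FS_mul]
        refine integral_congr_ae (ae_of_all _ fun η => ?_)
        simp only
        rw [mul_comm, FS_apply, FS_apply]
        congr 1
        refine integral_congr_ae (ae_of_all _ fun x => ?_)
        simp only [modulate_apply]
        rw [mul_assoc, ← chr_add]
        congr 2
        abel
      rw [e, ← integral_const_mul, ← integral_mul_const]
      refine integral_congr_ae (ae_of_all _ fun η => ?_)
      simp only [c]; ring

/-- The sampling formula based at 0 exhibits it as a pointwise limit of finite sums of continuous
functions. -/
theorem measurable_locF : Measurable (locF f ψ hψ) := by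
  obtain ⟨δ, m, hδ, hm, -, h, -⟩ := exists_sampling f ψ hψ
  refine measurable_of_tendsto_metrizable' (Filter.atTop : Filter (Finset (Fin d → ℤ)))
    (f := fun S ξ => ∑ k ∈ S, m (-ξ - latt δ k) * locF f ψ hψ (0 - latt δ k)) (fun S => ?_) ?_
  · exact Continuous.measurable (by fun_prop)
  · refine tendsto_pi_nhds.2 fun ξ => ?_
    have := h 0 (-ξ)
    rw [sub_neg_eq_add, zero_add] at this
    exact this

theorem integrable_locF_mul (g : 𝓢(E d, ℂ)) : Integrable fun η => locF f ψ hψ η * g η := by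
  obtain ⟨N, C, hC, h⟩ := exists_norm_locF_le f ψ hψ
  refine ((integrable_pow_mul_schwartz g N).const_mul C).mono'
    ((measurable_locF f ψ hψ).aestronglyMeasurable.mul g.continuous.aestronglyMeasurable)
    (ae_of_all _ fun x => ?_)
  rw [norm_mul, ← mul_assoc]
  gcongr
  exact h x

/-- This is Fourier duality for the compactly supported distribution ψ f. Both sides have the same
lattice expansion: one from applying f to the series, the other from integrating the sampling
formula against g. -/
theorem apply_eq_integral_locF {g φ : 𝓢(E d, ℂ)} (hφ : ∀ x, φ x = ψ x * FS g x) :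
    f φ = ∫ η, locF f ψ hψ η * g η := by
  obtain ⟨δ, m, hδ, hm, hdec, h, hint⟩ := exists_sampling f ψ hψ
  obtain ⟨N, C, hC, hN⟩ := exists_norm_locF_le f ψ hψ
  obtain ⟨C', hC', hm'⟩ := hdec (d + 1 + N)
  have hpt : ∀ k η, ‖g η * (m (-η - latt δ k) * locF f ψ hψ (-latt δ k))‖ ≤
      (C' * C * dec (d + 1) (latt δ k)) * ((1 + ‖η‖) ^ (d + 1 + N) * ‖g η‖) := by
    intro k η
    rw [norm_mul, norm_mul]
    have h1 : ‖m (-η - latt δ k)‖ ≤ C' * (dec (d + 1 + N) (latt δ k) * (1 + ‖η‖) ^ (d + 1 + N)) := by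
      refine (hm' _).trans ?_
      gcongr
      have := dec_le_of_sub (d + 1 + N) (-latt δ k) η
      rwa [dec_neg, show -latt δ k - η = -η - latt δ k by abel] at this
    have h2 : ‖locF f ψ hψ (-latt δ k)‖ ≤ C * (1 + ‖latt δ k‖) ^ N := by simpa using hN (-latt δ k)
    have h0 := dec_nonneg (d + 1 + N) (latt δ k)
    calc ‖g η‖ * (‖m (-η - latt δ k)‖ * ‖locF f ψ hψ (-latt δ k)‖)
        ≤ ‖g η‖ * (C' * (dec (d + 1 + N) (latt δ k) * (1 + ‖η‖) ^ (d + 1 + N)) *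
          (C * (1 + ‖latt δ k‖) ^ N)) := by gcongr
      _ = C' * C * (dec (d + 1 + N) (latt δ k) * (1 + ‖latt δ k‖) ^ N) *
          ((1 + ‖η‖) ^ (d + 1 + N) * ‖g η‖) := by ring
      _ = _ := by rw [dec_add_mul_pow]
  have hI := integrable_pow_mul_schwartz g (d + 1 + N)
  have hi : ∀ k, Integrable fun η => g η * (m (-η - latt δ k) * locF f ψ hψ (-latt δ k)) := fun k =>
    (hI.const_mul _).mono' (Continuous.aestronglyMeasurable (by fun_prop)) (ae_of_all _ (hpt k))
  have key := hasSum_integral_of_summable_integral_norm hi (by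
    refine Summable.of_nonneg_of_le (fun k => integral_nonneg fun _ => norm_nonneg _) (fun k => ?_)
      ((summable_dec_latt hδ (Nat.lt_succ_self d)).mul_left
        (C' * C * ∫ η, (1 + ‖η‖) ^ (d + 1 + N) * ‖g η‖))
    refine (integral_mono (hi k).norm (hI.const_mul _) (hpt k)).trans (le_of_eq ?_)
    rw [integral_const_mul]; ring)
  rw [(hint g φ hφ).unique key]
  refine integral_congr_ae (ae_of_all _ fun η => ?_)
  simp only
  have h1 := h 0 (-η)
  simp only [zero_sub, neg_neg] at h1
  rw [tsum_mul_left, h1.tsum_eq, mul_comm]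

end LocalizedFourier

end FourierBF

end

noncomputable section

namespace FourierBF

open scoped ContDiff FourierTransform

/-! ### Convolutions in BF-spaces -/

section ConvolutionBF

variable {d : ℕ} {B : Type*} [NormedAddCommGroup B] [NormedSpace ℂ B]
  {v : E d → ℝ} {ι : B →ₗ[ℂ] (E d →ₘ[volume] ℂ)}

/-- The function `F` restricted to `Γ` belongs to `B`. -/
def InBF (ι : B →ₗ[ℂ] (E d →ₘ[volume] ℂ)) (Γ : Set (E d)) (F : E d → ℂ) : Prop :=
  ∃ b : B, ι b =ᵐ[volume] Γ.indicator F

/-- The convolution of `dec M` and `g`. -/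
def decConv (M : ℕ) (g : E d → ℝ) (ξ : E d) : ℝ := ∫ η, dec M (ξ - η) * g η

theorem measurable_dec_sub (M : ℕ) : Measurable fun p : E d × E d => dec M (p.1 - p.2) :=
  ((continuous_dec M).comp (by fun_prop)).measurable

theorem measurable_decConv (M : ℕ) {g : E d → ℝ} (hg : Measurable g) :
    Measurable (decConv M g) := by
  have h : StronglyMeasurable (Function.uncurry fun ξ η : E d => dec M (ξ - η) * g η) :=
    ((measurable_dec_sub M).mul (hg.comp measurable_snd)).stronglyMeasurable
  exact h.integral_prod_right.measurable

theorem enorm_sampling_le {f : 𝓢'(E d, ℂ)} {ψ : 𝓢(E d, ℂ)} {hψ : HasCompactSupport ψ} :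
    ∃ δ : ℝ, 0 < δ ∧ ∀ M : ℕ, ∃ C : ℝ, 0 ≤ C ∧ ∀ ξ η : E d, ‖locF f ψ hψ (ξ - η)‖ₑ ≤
      ∑' k, ENNReal.ofReal (C * dec M (η - latt δ k)) * ‖locF f ψ hψ (ξ - latt δ k)‖ₑ := by
  obtain ⟨δ, m, hδ, -, hm, h, -⟩ := exists_sampling f ψ hψ
  refine ⟨δ, hδ, fun M => ?_⟩
  obtain ⟨C, hC, hm⟩ := hm M
  refine ⟨C, hC, fun ξ η => ?_⟩
  rw [← (h ξ η).tsum_eq]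
  refine (enorm_tsum_le_tsum_enorm).trans (ENNReal.tsum_le_tsum fun k => ?_)
  rw [enorm_mul]
  gcongr
  rw [← ofReal_norm]
  exact ENNReal.ofReal_le_ofReal (hm _)

/-- No vector-valued integral in B is needed: the sampling formula bounds the value at ξ − η by
values at ξ − κ, and integrating out η leaves the rapidly decreasing lattice sum handled by
`exists_of_le_lattice`. -/
theorem IsInvariantBFSpace.exists_decConv_mem (hB : IsInvariantBFSpace v ι) {Γ₁ Γ : Set (E d)}
    (hΓ₁ : IsOpenCone Γ₁) (hΓ : ConeInside Γ₁ Γ) {f : 𝓢'(E d, ℂ)} {ψ : 𝓢(E d, ℂ)}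
    {hψ : HasCompactSupport ψ} {W : E d → ℝ} (hW : IsPolyModerate W)
    (hb : InBF ι Γ fun ξ => locF f ψ hψ ξ * (W ξ : ℂ)) :
    ∃ M₀ : ℕ, ∀ M ≥ M₀,
      InBF ι Γ₁ fun ξ => ((decConv M (fun η => ‖locF f ψ hψ η‖ * W η) ξ : ℝ) : ℂ) := by
  obtain ⟨b, hb⟩ := hb
  obtain ⟨δ, hδ, hsamp⟩ := enorm_sampling_le (f := f) (ψ := ψ) (hψ := hψ)
  obtain ⟨N, C, hC, hN⟩ := exists_norm_locF_le f ψ hψ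
  obtain ⟨N₁, C₁, hC₁, hN₁⟩ := hW.exists_le_pow
  obtain ⟨N₂, C₂, hC₂, hN₂⟩ := hW.exists_le
  obtain ⟨M₀, hM₀⟩ := hB.exists_of_le_lattice hΓ₁ hΓ hδ
    (G := fun ξ => locF f ψ hψ ξ * (W ξ : ℂ)) (N := N + N₁) (C := C * C₁) (fun ξ => by
      rw [norm_mul, Complex.norm_real, Real.norm_of_nonneg (hW.pos ξ).le]
      calc _ ≤ (C * (1 + ‖ξ‖) ^ N) * (C₁ * (1 + ‖ξ‖) ^ N₁) :=
            mul_le_mul (hN ξ) (hN₁ ξ) (hW.pos ξ).le (by positivity)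
        _ = _ := by ring) hb
  have hF := measurable_locF f ψ hψ
  refine ⟨M₀, fun M hM => ?_⟩
  -- M orders combine with `dec M η` to give decay in κ, d + 1 make the η-integral finite, and N₂
  -- move W from ξ − η to ξ − κ.
  obtain ⟨C', hC', hle⟩ := hsamp (M + (d + 1) + N₂)
  let I : ℝ := ∫ x : E d, dec (d + 1) x
  have hI : ∫⁻ x : E d, ENNReal.ofReal (dec (d + 1) x) = ENNReal.ofReal I :=
    (ofReal_integral_eq_lintegral_ofReal (integrable_dec (Nat.lt_succ_self d))
      (ae_of_all _ fun x => dec_nonneg _ _)).symm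
  refine hM₀ M hM _ (C' * C₂ * I) ?_ fun ξ _ => ?_
  · exact (Complex.measurable_ofReal.comp
      (measurable_decConv M (hF.norm.mul hW.measurable))).aestronglyMeasurable
  have hpt : ∀ η k, ENNReal.ofReal (dec M η) * (ENNReal.ofReal (C' * dec (M + (d + 1) + N₂) (η - latt δ k)) *
      ‖locF f ψ hψ (ξ - latt δ k)‖ₑ * ENNReal.ofReal (W (ξ - η))) ≤
      ENNReal.ofReal (C' * C₂ * dec M (latt δ k : E d)) * ENNReal.ofReal (dec (d + 1) (η - latt δ k)) *
        ‖locF f ψ hψ (ξ - latt δ k) * (W (ξ - latt δ k) : ℂ)‖ₑ := by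
    intro η k
    have h1 : W (ξ - η) ≤ C₂ * W (ξ - latt δ k) * (1 + ‖η - latt δ k‖) ^ N₂ := by
      have := hN₂ (ξ - latt δ k) (latt δ k - η)
      rwa [sub_add_sub_cancel, norm_sub_rev] at this
    have h2 : dec M η * dec M (η - latt δ k) ≤ dec M (latt δ k) := by
      have := dec_mul_dec_le_left M η (latt δ k - η)
      rwa [add_sub_cancel, dec_sub_comm] at this
    have hWp := hW.pos (ξ - latt δ k)
    rw [enorm_mul, ← ofReal_norm (W (ξ - latt δ k) : ℂ), Complex.norm_real,
      Real.norm_of_nonneg hWp.le]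
    calc _ = ENNReal.ofReal (dec M η) * ENNReal.ofReal (C' * dec (M + (d + 1) + N₂) (η - latt δ k)) *
          ENNReal.ofReal (W (ξ - η)) * ‖locF f ψ hψ (ξ - latt δ k)‖ₑ := by ring
      _ = ENNReal.ofReal (dec M η * (C' * dec (M + (d + 1) + N₂) (η - latt δ k)) * W (ξ - η)) *
          ‖locF f ψ hψ (ξ - latt δ k)‖ₑ := by
          have h3 := dec_nonneg M η
          have h4 := dec_nonneg (M + (d + 1) + N₂) (η - latt δ k)
          rw [← ENNReal.ofReal_mul h3, ← ENNReal.ofReal_mul (by positivity)]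
      _ ≤ ENNReal.ofReal (C' * C₂ * dec M (latt δ k : E d) * dec (d + 1) (η - latt δ k) *
            W (ξ - latt δ k)) * ‖locF f ψ hψ (ξ - latt δ k)‖ₑ := by
          refine mul_le_mul_left (ENNReal.ofReal_le_ofReal ?_) _
          have h3 := dec_nonneg M η
          have h4 := dec_nonneg (M + (d + 1) + N₂) (η - latt δ k)
          have h5 := dec_nonneg (d + 1) (η - latt δ k)
          calc dec M η * (C' * dec (M + (d + 1) + N₂) (η - latt δ k)) * W (ξ - η)
              ≤ dec M η * (C' * dec (M + (d + 1) + N₂) (η - latt δ k)) *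
                (C₂ * W (ξ - latt δ k) * (1 + ‖η - latt δ k‖) ^ N₂) := by gcongr
            _ = C' * C₂ * (dec M η * (dec (M + (d + 1) + N₂) (η - latt δ k) *
                (1 + ‖η - latt δ k‖) ^ N₂)) * W (ξ - latt δ k) := by ring
            _ = C' * C₂ * (dec M η * dec M (η - latt δ k)) * dec (d + 1) (η - latt δ k) *
                W (ξ - latt δ k) := by rw [dec_add_mul_pow, dec_add]; ring
            _ ≤ _ := by gcongr
      _ = _ := by
          have h3 := dec_nonneg M (latt δ k : E d)
          have h5 := dec_nonneg (d + 1) (η - latt δ k)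
          rw [ENNReal.ofReal_mul (by positivity), ENNReal.ofReal_mul (by positivity)]
          ring
  have hm1 : ∀ k : Fin d → ℤ, Measurable fun η : E d => ENNReal.ofReal (dec (d + 1) (η - latt δ k)) := fun k =>
    ENNReal.measurable_ofReal.comp ((continuous_dec _).comp (by fun_prop)).measurable
  calc ‖((decConv M (fun η => ‖locF f ψ hψ η‖ * W η) ξ : ℝ) : ℂ)‖ₑ
      = ‖∫ η, dec M (ξ - η) * (‖locF f ψ hψ η‖ * W η)‖ₑ := by
        rw [← ofReal_norm, Complex.norm_real, ofReal_norm]; rfl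
    _ ≤ ∫⁻ η, ‖dec M (ξ - η) * (‖locF f ψ hψ η‖ * W η)‖ₑ := enorm_integral_le_lintegral_enorm _
    _ = ∫⁻ η, ENNReal.ofReal (dec M η) * (‖locF f ψ hψ (ξ - η)‖ₑ * ENNReal.ofReal (W (ξ - η))) := by
        rw [← lintegral_sub_left_eq_self _ ξ]
        refine lintegral_congr fun η => ?_
        rw [enorm_mul, enorm_mul, sub_sub_cancel, Real.enorm_of_nonneg (dec_nonneg _ _),
          Real.enorm_of_nonneg (hW.pos _).le, enorm_norm]
    _ ≤ ∫⁻ η, ∑' k, ENNReal.ofReal (C' * C₂ * dec M (latt δ k : E d)) *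
        ENNReal.ofReal (dec (d + 1) (η - latt δ k)) *
        ‖locF f ψ hψ (ξ - latt δ k) * (W (ξ - latt δ k) : ℂ)‖ₑ := by
        refine lintegral_mono fun η => ?_
        refine le_trans ?_ (ENNReal.tsum_le_tsum (hpt η))
        rw [ENNReal.tsum_mul_left, ENNReal.tsum_mul_right]
        gcongr
        exact hle ξ η
    _ = ∑' k, ENNReal.ofReal (C' * C₂ * I * dec M (latt δ k : E d)) *
        ‖locF f ψ hψ (ξ - latt δ k) * (W (ξ - latt δ k) : ℂ)‖ₑ := by
        rw [lintegral_tsum fun k => (((hm1 k).const_mul _).mul_const _).aemeasurable]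
        refine tsum_congr fun k => ?_
        rw [lintegral_mul_const _ ((hm1 k).const_mul _), lintegral_const_mul _ (hm1 k),
          lintegral_sub_right_eq_self (fun η : E d => ENNReal.ofReal (dec (d + 1) η)), hI,
          ← ENNReal.ofReal_mul (by have := dec_nonneg M (latt δ k : E d); positivity)]
        congr 2
        ring

end ConvolutionBF

end FourierBF

end

noncomputable section

namespace FourierBF

open scoped ContDiff FourierTransform

/-! ### Smoothing symbols in the frequency variable -/

section Pseudolocal

variable {d : ℕ} {ρ : ℝ} {W : E d → ℝ} {b : E d × E d → ℂ}

theorem IsPolyModerate.mul_rpow (hW : IsPolyModerate W) (s : ℝ) :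
    IsPolyModerate fun η => W η * (1 + ‖η‖) ^ s := hW.mul (isPolyModerate_one_add_norm_rpow s)

/-- The mean value theorem on the segment from η to ζ: the derivative carries the gain of ρ, and
moderateness brings its weight back to η at the cost of N powers of 1 + |η − ζ|. One further power
is the length of the segment. -/
theorem SymBound.sub_le (h : SymBound ρ W b) (hW : ∀ η, 0 < W η) {N : ℕ} {C : ℝ} (hC : 0 < C)
    (hN : ∀ η ζ, W (η + ζ) * (1 + ‖η + ζ‖) ^ (-ρ) ≤
      C * (W η * (1 + ‖η‖) ^ (-ρ)) * (1 + ‖ζ‖) ^ N) :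
    ∃ (K : ℕ) (C : ℝ), 0 ≤ C ∧ ∀ x η ζ, ‖b (x, η) - b (x, ζ)‖ ≤
      C * (1 + ‖x‖) ^ K * (W η * (1 + ‖η‖) ^ (-ρ)) * (1 + ‖η - ζ‖) ^ (N + 1) := by
  choose K D hD hb using fun i => (h.dirD_right i).norm_le
  obtain ⟨C₁, hC₁, h₁⟩ := norm_iteratedFDeriv_le_of_dirDs (stdCoord d) 1
  let K₀ := ∑ i, K i
  let D₀ := ∑ i, D i
  have hD₀ : 0 ≤ D₀ := Finset.sum_nonneg fun i _ => hD i
  refine ⟨K₀, C₁ * D₀ * C, by positivity, fun x η ζ => ?_⟩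
  have hV : 0 ≤ W η * (1 + ‖η‖) ^ (-ρ) := mul_nonneg (hW η).le (by positivity)
  set A := C₁ * (D₀ * (1 + ‖x‖) ^ K₀ * (C * (W η * (1 + ‖η‖) ^ (-ρ)) * (1 + ‖η - ζ‖) ^ N))
  have hsm : ContDiff ℝ ∞ fun η => b (x, η) := h.smooth.comp (contDiff_const.prodMk contDiff_id)
  have hder : ∀ p ∈ segment ℝ η ζ, ‖fderiv ℝ (fun η => b (x, η)) p‖ ≤ A := by
    intro p hp
    rw [← norm_iteratedFDeriv_one]
    refine h₁ _ hsm p _ fun l hl => ?_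
    obtain ⟨i, rfl⟩ := List.length_eq_one_iff.1 hl
    have e : dirDs (List.map (stdCoord d).vec [i]) (fun η => b (x, η)) p =
        dirD (0, unitVec i) b (x, p) := dirD_comp_affine_right h.smooth x p _
    rw [e]
    have h2 := hN η (p - η)
    rw [add_sub_cancel] at h2
    have h3 : ‖p - η‖ ≤ ‖η - ζ‖ := by
      obtain ⟨s, t, hs, ht, hst, rfl⟩ := hp
      have : s • η + t • ζ - η = t • (ζ - η) := by
        rw [show s = 1 - t by linarith]; module
      rw [this, norm_smul, Real.norm_of_nonneg ht, norm_sub_rev η]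
      exact mul_le_of_le_one_left (norm_nonneg _) (by linarith)
    have hVp : 0 ≤ W p * (1 + ‖p‖) ^ (-ρ) := mul_nonneg (hW p).le (by positivity)
    have hDi : D i ≤ D₀ := Finset.single_le_sum (f := D) (fun i _ => hD i) (Finset.mem_univ i)
    have hKi : K i ≤ K₀ := Finset.single_le_sum (f := K) (fun i _ => Nat.zero_le _) (Finset.mem_univ i)
    have hDi0 := hD i
    calc ‖dirD (0, unitVec i) b (x, p)‖ ≤ D i * (1 + ‖x‖) ^ (K i) * (W p * (1 + ‖p‖) ^ (-ρ)) := hb i x p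
      _ ≤ D₀ * (1 + ‖x‖) ^ K₀ * (W p * (1 + ‖p‖) ^ (-ρ)) := by
          gcongr
          exact one_le_one_add_norm x
      _ ≤ D₀ * (1 + ‖x‖) ^ K₀ * (C * (W η * (1 + ‖η‖) ^ (-ρ)) * (1 + ‖η - ζ‖) ^ N) := by
          refine mul_le_mul_of_nonneg_left (h2.trans ?_) (by positivity)
          gcongr
  have key := (convex_segment η ζ).norm_image_sub_le_of_norm_fderiv_le (𝕜 := ℝ)
    (fun p _ => (differentiable_of_contDiff hsm) p) hder (right_mem_segment ℝ η ζ)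
    (left_mem_segment ℝ η ζ)
  refine key.trans ?_
  have hA : 0 ≤ A := by positivity
  calc A * ‖η - ζ‖ ≤ A * (1 + ‖η - ζ‖) := by gcongr; linarith
    _ = _ := by simp only [A]; ring

theorem SymBound.dirDs (h : SymBound ρ W b) (l l' : List (Fin d)) :
    SymBound ρ (fun η => W η * (1 + ‖η‖) ^ (-ρ * l'.length))
      (dirDs (l.map (fun i => (unitVec i, 0)) ++ l'.map (fun i => (0, unitVec i))) b) := by
  induction l generalizing b W with
  | nil =>
    induction l' generalizing b W with
    | nil => simpa [FourierBF.dirDs] using h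
    | cons i l' ih =>
      refine (ih (h.dirD_right i)).mono zero_le_one fun η => le_of_eq ?_
      simp only [one_mul]
      rw [mul_assoc, ← Real.rpow_add (by positivity)]
      congr 2
      push_cast [List.length_cons]
      ring
  | cons i l ih => exact ih (h.dirD_left i)

/-- The averaged difference `∫ (b(x, η) - b(x, η - ζ)) k(ζ) dζ`. -/
def smoothDiff (k : 𝓢(E d, ℂ)) (b : E d × E d → ℂ) (p : E d × E d) : ℂ :=
  ∫ ζ, (b p - b (p.1, p.2 - ζ)) * k ζ

variable (k : 𝓢(E d, ℂ))

theorem exists_norm_shift_le (h : AmpBound W b) (hW : IsPolyModerate W) (k : 𝓢(E d, ℂ)) :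
    ∃ (K : ℕ) (C : ℝ) (N : ℕ), 0 ≤ C ∧ ∀ (p : E d × E d) (ζ : E d), ‖b (p.1, p.2 - ζ) * k ζ‖ ≤
      C * (1 + ‖p.1‖) ^ K * W p.2 * ((1 + ‖ζ‖) ^ N * ‖k ζ‖) := by
  obtain ⟨K, C, hC, hb⟩ := h.norm_le
  obtain ⟨N, D, hD, hN⟩ := hW.exists_le
  refine ⟨K, C * D, N, by positivity, fun p ζ => ?_⟩
  have h1 := hN p.2 (-ζ)
  rw [norm_neg, ← sub_eq_add_neg] at h1
  have h2 := hW.pos p.2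
  rw [norm_mul]
  calc ‖b (p.1, p.2 - ζ)‖ * ‖k ζ‖ ≤ (C * (1 + ‖p.1‖) ^ K * W (p.2 - ζ)) * ‖k ζ‖ := by
        gcongr; exact hb () (p.1, p.2 - ζ)
    _ ≤ (C * (1 + ‖p.1‖) ^ K * (D * W p.2 * (1 + ‖ζ‖) ^ N)) * ‖k ζ‖ := by gcongr
    _ = _ := by ring

theorem integrable_shift (h : AmpBound W b) (hW : IsPolyModerate W) (p : E d × E d) :
    Integrable fun ζ => b (p.1, p.2 - ζ) * k ζ := by
  obtain ⟨K, C, N, hC, hb⟩ := exists_norm_shift_le h hW k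
  have hbc := (h.smooth ()).continuous
  exact ((integrable_pow_mul_schwartz k N).const_mul _).mono'
    (Continuous.aestronglyMeasurable (by fun_prop)) (ae_of_all _ (hb p))

theorem integrable_diff (h : AmpBound W b) (hW : IsPolyModerate W) (p : E d × E d) :
    Integrable fun ζ => (b p - b (p.1, p.2 - ζ)) * k ζ := by
  simp_rw [sub_mul]
  exact ((k.integrable).const_mul _).sub (integrable_shift k h hW p)

theorem smoothDiff_deriv (h : AmpBound W b) (hW : IsPolyModerate W) :
    Differentiable ℝ (smoothDiff k b) ∧ ∀ i, dirD ((prodCoord d).vec i) (smoothDiff k b) =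
      smoothDiff k (dirD ((prodCoord d).vec i) b) := by
  have hbc : ∀ {b : E d × E d → ℂ}, AmpBound W b → Continuous b := fun h => (h.smooth ()).continuous
  have hsh : ∀ ζ : E d, ContDiff ℝ ∞ fun p : E d × E d => b (p.1, p.2 - ζ) := fun ζ =>
    (h.smooth ()).comp (contDiff_fst.prodMk (contDiff_snd.sub contDiff_const))
  have hdsh : ∀ v (ζ : E d) p, dirD v (fun p : E d × E d => b (p.1, p.2 - ζ)) p =
      dirD v b (p.1, p.2 - ζ) := by
    intro v ζ p
    have e : (fun p : E d × E d => b (p.1, p.2 - ζ)) = fun p => b (p - (0, ζ)) := by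
      funext p; congr 1; simp [Prod.ext_iff]
    have e2 : (p.1, p.2 - ζ) = p - (0, ζ) := by simp [Prod.ext_iff]
    rw [e, e2, dirD, fderiv_comp_sub, dirD]
  have hdir : ∀ v ζ p, dirD v (fun p => (b p - b (p.1, p.2 - ζ)) * k ζ) p =
      (dirD v b p - dirD v b (p.1, p.2 - ζ)) * k ζ := by
    intro v ζ p
    rw [dirD_mul (b := fun p => b p - b (p.1, p.2 - ζ)) (c := fun _ => k ζ)
      (differentiable_of_contDiff ((h.smooth ()).sub (hsh ζ))) (differentiable_const _),
      dirD_sub (differentiable_of_contDiff (h.smooth ())) (differentiable_of_contDiff (hsh ζ))]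
    simp only [dirD_const, hdsh]
    ring
  have key : ∀ p₀, DifferentiableAt ℝ (smoothDiff k b) p₀ ∧ ∀ i,
      dirD ((prodCoord d).vec i) (smoothDiff k b) p₀ =
        ∫ ζ, dirD ((prodCoord d).vec i) (fun p => (b p - b (p.1, p.2 - ζ)) * k ζ) p₀ := by
    intro p₀
    choose K C N hC hb using fun i => exists_norm_shift_le (h.dirD i) hW k
    choose K' C' hC' hb' using fun i => (h.dirD i).norm_le
    obtain ⟨N₀, D, hD, hN₀⟩ := hW.exists_le
    have hW0 := hW.pos p₀.2
    let G : E d → ℝ := fun ζ => ∑ i, (C' i * (1 + ‖p₀.1‖ + 1) ^ K' i * (D * W p₀.2 * 2 ^ N₀) * ‖k ζ‖ +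
      C i * (1 + ‖p₀.1‖ + 1) ^ K i * (D * W p₀.2 * 2 ^ N₀) * ((1 + ‖ζ‖) ^ N i * ‖k ζ‖))
    have hG : Integrable G := integrable_finsetSum _ fun i _ =>
      (k.integrable.norm.const_mul _).add ((integrable_pow_mul_schwartz k (N i)).const_mul _)
    refine hasFDerivAt_integral_of_dirD_le (κ := prodCoord d)
      (B := fun ζ p => (b p - b (p.1, p.2 - ζ)) * k ζ) (μ := volume) (p₀ := p₀)
      (fun ζ => (differentiable_of_contDiff ((h.smooth ()).sub (hsh ζ))).mul_const _) (fun p => ?_)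
      (fun i p => ?_) (integrable_diff k h hW p₀) hG fun i ζ p hp => ?_
    · exact (integrable_diff k h hW p).aestronglyMeasurable
    · simp_rw [hdir]
      exact (integrable_diff k (h.dirD i) hW p).aestronglyMeasurable
    · rw [hdir, sub_mul]
      have hp1 : ‖p - p₀‖ < 1 := by simpa [dist_eq_norm] using hp
      have hx : ‖p.1‖ ≤ ‖p₀.1‖ + 1 := by
        have h1 := norm_fst_le (p - p₀)
        have h2 := norm_sub_norm_le p.1 p₀.1
        rw [Prod.fst_sub] at h1
        linarith
      have hη : W p.2 ≤ D * W p₀.2 * 2 ^ N₀ := by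
        have h1 := norm_snd_le (p - p₀)
        have h2 := hN₀ p₀.2 (p.2 - p₀.2)
        rw [add_sub_cancel] at h2
        rw [Prod.snd_sub] at h1
        refine h2.trans ?_
        gcongr
        linarith
      refine (norm_sub_le _ _).trans (le_trans ?_ (Finset.single_le_sum
        (f := fun i => C' i * (1 + ‖p₀.1‖ + 1) ^ K' i * (D * W p₀.2 * 2 ^ N₀) * ‖k ζ‖ +
          C i * (1 + ‖p₀.1‖ + 1) ^ K i * (D * W p₀.2 * 2 ^ N₀) * ((1 + ‖ζ‖) ^ N i * ‖k ζ‖))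
        (fun i _ => by have := hC i; have := hC' i; positivity) (Finset.mem_univ i)))
      have := hC i
      have := hC' i
      refine add_le_add ?_ ((hb i p ζ).trans ?_)
      · rw [norm_mul]
        gcongr
        refine (hb' i () p).trans ?_
        have hx' : 1 + ‖p.1‖ ≤ 1 + ‖p₀.1‖ + 1 := by linarith
        have hWp := (hW.pos p.2).le
        gcongr
      · have hx' : 1 + ‖p.1‖ ≤ 1 + ‖p₀.1‖ + 1 := by linarith
        have hWp := (hW.pos p.2).le
        gcongr
  refine ⟨fun p => (key p).1, fun i => funext fun p => ((key p).2 i).trans ?_⟩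
  exact integral_congr_ae (ae_of_all _ fun ζ => hdir _ ζ p)

theorem contDiff_smoothDiff (h : AmpBound W b) (hW : IsPolyModerate W) :
    ContDiff ℝ ∞ (smoothDiff k b) := by
  refine contDiff_of_dirD_mem (prodCoord d) {f | ∃ c, AmpBound W c ∧ f = smoothDiff k c} ?_ ?_
    ⟨b, h, rfl⟩
  · rintro _ ⟨c, hc, rfl⟩
    exact (smoothDiff_deriv k hc hW).1
  · rintro _ ⟨c, hc, rfl⟩ i
    exact ⟨_, hc.dirD i, (smoothDiff_deriv k hc hW).2 i⟩

theorem dirDs_smoothDiff (h : AmpBound W b) (hW : IsPolyModerate W) (l : List (Fin d ⊕ Fin d)) :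
    dirDs (l.map (prodCoord d).vec) (smoothDiff k b) =
      smoothDiff k (dirDs (l.map (prodCoord d).vec) b) := by
  induction l generalizing b with
  | nil => rfl
  | cons i l ih =>
    simp only [List.map_cons, FourierBF.dirDs]
    rw [(smoothDiff_deriv k h hW).2 i, ih (h.dirD i)]

/-- Averaging commutes with derivatives, so `sub_le` applies to each derivative of b, and k absorbs
the powers of the translation. The result is again a symbol, which permits iteration. -/
theorem SymBound.smoothDiff (h : SymBound ρ W b) (hρ : 0 ≤ ρ) (hW : IsPolyModerate W) :
    SymBound ρ (fun η => W η * (1 + ‖η‖) ^ (-ρ)) (smoothDiff k b) := by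
  have hamp := h.ampBound hρ fun η => (hW.pos η).le
  refine ⟨contDiff_smoothDiff k hamp hW, fun l l' => ?_⟩
  rw [← prodCoord_map_append, dirDs_smoothDiff k hamp hW, prodCoord_map_append]
  obtain ⟨N, C₀, hC₀, hN⟩ := ((hW.mul_rpow (-ρ * l'.length)).mul_rpow (-ρ)).exists_le
  obtain ⟨K, C, hC, hb⟩ := (h.dirDs l l').sub_le (hW.mul_rpow _).pos hC₀ hN
  have hI := integrable_pow_mul_schwartz k (N + 1)
  refine ⟨K, C * ∫ ζ, (1 + ‖ζ‖) ^ (N + 1) * ‖k ζ‖, mul_nonneg hC (integral_nonneg fun _ => by positivity),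
    fun x η => ?_⟩
  refine (norm_integral_le_of_norm_le (hI.const_mul (C * (1 + ‖x‖) ^ K *
    (W η * (1 + ‖η‖) ^ (-ρ * l'.length) * (1 + ‖η‖) ^ (-ρ)))) (ae_of_all _ fun ζ => ?_)).trans
    (le_of_eq ?_)
  · have := hb x η (η - ζ)
    rw [sub_sub_cancel] at this
    rw [norm_mul]
    calc _ ≤ C * (1 + ‖x‖) ^ K * (W η * (1 + ‖η‖) ^ (-ρ * l'.length) * (1 + ‖η‖) ^ (-ρ)) *
          (1 + ‖ζ‖) ^ (N + 1) * ‖k ζ‖ := by gcongr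
      _ = _ := by ring
  · rw [integral_const_mul]; ring

/-! ### Pseudolocality -/

theorem continuous_oscInt_pow {N : ℕ} (h : AmpBound (fun η => (1 + ‖η‖) ^ N) b) (θ : 𝓢(E d, ℂ))
    (ξ : E d) : Continuous (oscInt b θ ξ) :=
  (contDiff_oscInt h (fun η => by positivity) (continuous_one_add_norm_pow N) θ ξ).continuous

theorem exists_norm_oscInt_le (h : AmpBound W b) (hW : ∀ η, 0 ≤ W η) (L : ℕ) :
    ∃ q : Seminorm ℂ 𝓢(E d, ℂ), Continuous q ∧ ∀ (θ : 𝓢(E d, ℂ)) (ξ η : E d),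
      ‖oscInt b θ ξ η‖ ≤ dec L (η - ξ) * (W η * q θ) := by
  obtain ⟨q, hq, hq'⟩ := exists_seminorm_oscillatory hW L h.slice
  refine ⟨q, hq, fun θ ξ η => ?_⟩
  rw [dec, ← div_eq_inv_mul, le_div_iff₀ (by positivity), mul_comm]
  exact hq' θ η (η - ξ)

/-- Averaging the symbol over frequency against k multiplies its kernel at (x, y) by κ(x − y), and
the hypothesis says that this factor vanishes on the support of θ. -/
theorem integral_smooth_oscInt_eq_zero {N : ℕ} (h : AmpBound (fun η => (1 + ‖η‖) ^ N) b)
    {κ : E d → ℂ} (hκ : ∀ z, ∫ ζ, k ζ * chr z ζ = κ z) (θ : 𝓢(E d, ℂ)) (ξ y : E d)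
    (hy : ∀ x, θ x * κ (x - y) = 0) :
    ∫ η, (∫ x, θ x * (∫ ζ, b (x, η - ζ) * k ζ) * chr x (η - ξ)) * chr η (-y) = 0 := by
  have hbc := (h.smooth ()).continuous
  have hW0 : ∀ η : E d, 0 ≤ (1 + ‖η‖) ^ N := fun η => by positivity
  obtain ⟨K, C, hC, hb⟩ := h.norm_le
  obtain ⟨q, -, hq⟩ := exists_norm_oscInt_le h hW0 (d + 1 + N)
  have hinner : ∀ η, ∫ x, θ x * (∫ ζ, b (x, η - ζ) * k ζ) * chr x (η - ξ) =
      ∫ ζ, k ζ * oscInt b θ (ξ - ζ) (η - ζ) := by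
    intro η
    simp only [oscInt, ← integral_const_mul, ← integral_mul_const]
    rw [integral_integral_swap]
    · refine integral_congr_ae (ae_of_all _ fun ζ => integral_congr_ae (ae_of_all _ fun x => ?_))
      simp only [sub_sub_sub_cancel_right]; ring
    · have h1 := ((integrable_pow_mul_schwartz θ K).mul_prod (integrable_pow_mul_schwartz k N)).const_mul
        (C * (1 + ‖η‖) ^ N)
      refine h1.mono' (Continuous.aestronglyMeasurable (by
        simp only [Function.uncurry_def]; fun_prop)) (ae_of_all _ fun p => ?_)
      simp only [Function.uncurry_def, norm_mul, norm_chr, mul_one]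
      have h2 := hb () (p.1, η - p.2)
      have h3 := one_add_norm_sub_pow_le η p.2 N
      calc ‖θ p.1‖ * (‖b (p.1, η - p.2)‖ * ‖k p.2‖)
          ≤ ‖θ p.1‖ * ((C * (1 + ‖p.1‖) ^ K * ((1 + ‖η‖) ^ N * (1 + ‖p.2‖) ^ N)) * ‖k p.2‖) := by
            gcongr
            exact h2.trans (by gcongr)
        _ = _ := by ring
  have hjoint : StronglyMeasurable fun p : E d × E d => oscInt b θ (ξ - p.1) p.2 := by
    have : StronglyMeasurable (Function.uncurry fun (p : E d × E d) (x : E d) =>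
        θ x * b (x, p.2) * chr x (p.2 - (ξ - p.1))) :=
      Continuous.stronglyMeasurable (by simp only [Function.uncurry_def]; fun_prop)
    exact this.integral_prod_right
  have hbound : ∀ ζ η, ‖k ζ * oscInt b θ (ξ - ζ) η‖ ≤
      (q θ * (1 + ‖ξ‖) ^ (d + 1 + N)) * (((1 + ‖ζ‖) ^ (d + 1 + N) * ‖k ζ‖) * dec (d + 1) η) := by
    intro ζ η
    have h1 : dec (d + 1 + N) (η - (ξ - ζ)) ≤
        dec (d + 1 + N) η * ((1 + ‖ξ‖) ^ (d + 1 + N) * (1 + ‖ζ‖) ^ (d + 1 + N)) := by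
      refine (dec_le_of_sub _ _ _).trans ?_
      have := dec_nonneg (d + 1 + N) η
      gcongr
      exact one_add_norm_sub_pow_le _ _ _
    have h2 : 0 ≤ q θ := apply_nonneg q θ
    rw [norm_mul]
    calc ‖k ζ‖ * ‖oscInt b θ (ξ - ζ) η‖
        ≤ ‖k ζ‖ * (dec (d + 1 + N) η * ((1 + ‖ξ‖) ^ (d + 1 + N) * (1 + ‖ζ‖) ^ (d + 1 + N)) *
          ((1 + ‖η‖) ^ N * q θ)) := by
          gcongr
          exact (hq θ _ _).trans (by gcongr)
      _ = (q θ * (1 + ‖ξ‖) ^ (d + 1 + N)) * (((1 + ‖ζ‖) ^ (d + 1 + N) * ‖k ζ‖) *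
          (dec (d + 1 + N) η * (1 + ‖η‖) ^ N)) := by ring
      _ = _ := by rw [dec_add_mul_pow]
  have hprod : Integrable (fun p : E d × E d => k p.1 * oscInt b θ (ξ - p.1) p.2 * chr (p.2 + p.1) (-y))
      (volume.prod volume) := by
    refine ((((integrable_pow_mul_schwartz k (d + 1 + N)).mul_prod
      (integrable_dec (Nat.lt_succ_self d))).const_mul (q θ * (1 + ‖ξ‖) ^ (d + 1 + N)))).mono'
      (((Continuous.stronglyMeasurable (by fun_prop)).mul hjoint).mul
        (Continuous.stronglyMeasurable (by fun_prop))).aestronglyMeasurable (ae_of_all _ fun p => ?_)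
    rw [norm_mul, norm_chr, mul_one]
    exact hbound p.1 p.2
  -- The translation η ↦ η + ζ removes ζ from the symbol and leaves it only in exponentials, ready
  -- for the ζ-integration.
  have hswap1 : ∫ η, (∫ ζ, k ζ * oscInt b θ (ξ - ζ) (η - ζ)) * chr η (-y) =
      ∫ ζ, ∫ η, k ζ * oscInt b θ (ξ - ζ) η * chr (η + ζ) (-y) := by
    simp only [← integral_mul_const]
    rw [integral_integral_swap]
    · refine integral_congr_ae (ae_of_all _ fun ζ => ?_)
      simp only
      rw [← integral_add_right_eq_self _ ζ]
      simp only [add_sub_cancel_right]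
    · have hmp : MeasurePreserving (fun p : E d × E d => (p.2, p.1 - p.2))
          (volume.prod volume) (volume.prod volume) := measurePreserving_prod_sub_swap _ _
      have := hmp.integrable_comp_of_integrable hprod
      refine this.congr (ae_of_all _ fun p => ?_)
      simp [Function.uncurry_def]
  have hxζ : ∀ η, ∫ ζ, k ζ * oscInt b θ (ξ - ζ) η * chr (η + ζ) (-y) = 0 := by
    intro η
    have h1 : ∀ ζ, k ζ * oscInt b θ (ξ - ζ) η * chr (η + ζ) (-y) =
        ∫ x, (θ x * b (x, η) * chr x (η - ξ) * chr η (-y)) * (k ζ * chr (x - y) ζ) := by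
      intro ζ
      simp only [oscInt, ← integral_const_mul, ← integral_mul_const]
      refine integral_congr_ae (ae_of_all _ fun x => ?_)
      simp only
      rw [show η - (ξ - ζ) = (η - ξ) + ζ by abel, chr_add, chr_add_left, sub_eq_add_neg x y,
        chr_add_left, chr_neg_left, chr_comm ζ, ← chr_neg_left, ← chr_neg_left y ζ]
      ring
    simp_rw [h1]
    rw [integral_integral_swap]
    · simp_rw [integral_const_mul, hκ]
      refine integral_eq_zero_of_ae (ae_of_all _ fun x => ?_)
      simp only [Pi.zero_apply]
      linear_combination (b (x, η) * chr x (η - ξ) * chr η (-y)) * hy x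
    · have h2 := (k.integrable (μ := volume)).norm.mul_prod (h.integrable θ η).norm
      refine h2.mono' (Continuous.aestronglyMeasurable (by
        simp only [Function.uncurry_def]; fun_prop)) (ae_of_all _ fun p => le_of_eq ?_)
      simp only [Function.uncurry_def, norm_mul, norm_chr, mul_one]
      ring
  simp_rw [hinner]
  rw [hswap1, integral_integral_swap hprod]
  simp_rw [hxζ]
  exact integral_zero _ _

end Pseudolocal

end FourierBF

end

noncomputable section

namespace FourierBF

open scoped ContDiff FourierTransform

/-! ### Gain of decay off the diagonal and the pseudolocal estimate. -/

section PseudolocalEstimate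

variable {d : ℕ} {ρ : ℝ} {W : E d → ℝ} {b : E d × E d → ℂ}

theorem exists_seminorm_sum {ι : Type*} (s : Finset ι) (q : ι → Seminorm ℂ 𝓢(E d, ℂ))
    (hq : ∀ i, Continuous (q i)) {C : ℝ} (hC : 0 ≤ C) :
    ∃ p : Seminorm ℂ 𝓢(E d, ℂ), Continuous p ∧ ∀ θ, p θ = C * ∑ i ∈ s, q i θ := by
  have hsum : ∀ θ, (∑ i ∈ s, q i) θ = ∑ i ∈ s, q i θ := by
    intro θ
    induction s using Finset.cons_induction with
    | empty => simp
    | cons j s hj ih => rw [Finset.sum_cons, Finset.sum_cons, add_apply, ih]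
  let c : NNReal := ⟨C, hC⟩
  have he : ∀ θ, (c • ∑ i ∈ s, q i) θ = C * ∑ i ∈ s, q i θ := fun θ => by
    rw [← hsum]; rfl
  refine ⟨c • ∑ i ∈ s, q i, ?_, he⟩
  rw [funext he]
  exact continuous_const.mul (continuous_finsetSum _ fun i _ => hq i)

theorem integrable_oscInt {N : ℕ} (h : AmpBound (fun η => (1 + ‖η‖) ^ N) b) (θ : 𝓢(E d, ℂ))
    (ξ : E d) : Integrable (oscInt b θ ξ) := by
  obtain ⟨q, -, hq⟩ := exists_norm_oscInt_le h (fun η => by positivity) (d + 1 + N)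
  refine ((integrable_dec (Nat.lt_succ_self d)).const_mul ((1 + ‖ξ‖) ^ (d + 1 + N) * q θ)).mono'
    (continuous_oscInt_pow h θ ξ).aestronglyMeasurable (ae_of_all _ fun η => (hq θ ξ η).trans ?_)
  have h1 : 0 ≤ q θ := apply_nonneg q θ
  have h2 := dec_le_of_sub (d + 1 + N) η ξ
  calc dec (d + 1 + N) (η - ξ) * ((1 + ‖η‖) ^ N * q θ)
      ≤ (dec (d + 1 + N) η * (1 + ‖ξ‖) ^ (d + 1 + N)) * ((1 + ‖η‖) ^ N * q θ) := by gcongr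
    _ = ((1 + ‖ξ‖) ^ (d + 1 + N) * q θ) * (dec (d + 1 + N) η * (1 + ‖η‖) ^ N) := by ring
    _ = _ := by rw [dec_add_mul_pow]

theorem AmpBound.mono_pow (h : AmpBound W b) (hW : IsPolyModerate W) :
    ∃ N : ℕ, AmpBound (fun η => (1 + ‖η‖) ^ N) b := by
  obtain ⟨N, C, hC, hN⟩ := hW.exists_le_pow
  exact ⟨N, h.mono hC.le one_le_one_add_norm_fst fun _ p => hN p.2⟩

/-- A symbol may be modified without changing its operator off the `ε`-neighbourhood of
the support, with a gain of `(1 + ‖η‖) ^ ρ`. -/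
theorem SymBound.exists_gain (h : SymBound ρ W b) (hρ : 0 ≤ ρ) (hW : IsPolyModerate W) {ε : ℝ}
    (hε : 0 < ε) : ∃ b', SymBound ρ (fun η => W η * (1 + ‖η‖) ^ (-ρ)) b' ∧
      ∀ (θ : 𝓢(E d, ℂ)) (ξ y : E d), (∀ x, ‖x - y‖ < ε → θ x = 0) →
        ∫ η, oscInt b' θ ξ η * chr η (-y) = ∫ η, oscInt b θ ξ η * chr η (-y) := by
  have hε2 : 0 < ε / 2 := by positivity
  let κ := sbump (0 : E d) (ε / 2) hε2
  -- By Fourier inversion ∫ k(ζ) e^{i⟨z,ζ⟩} dζ = κ(z). Then κ(0) = 1 gives ∫ k = 1, and κ = 0 beyond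
  -- distance ε kills the averaged symbol there.
  let k : 𝓢(E d, ℂ) := cFS d • FS κ
  have hκ : ∀ z, ∫ ζ, k ζ * chr z ζ = κ z := by
    intro z
    have : ∀ ζ, k ζ * chr z ζ = cFS d * (FS κ ζ * chr z ζ) := fun ζ => by
      simp only [k, smul_apply, smul_eq_mul]; ring
    simp_rw [this]
    rw [integral_const_mul, integral_FS_mul_chr, ← mul_assoc, cFS_mul, one_mul]
  have hk : ∫ ζ, k ζ = 1 := by
    have := hκ 0
    rw [sbump_eq_one _ _ hε2 (Metric.mem_closedBall_self hε2.le)] at this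
    rw [← this]
    refine integral_congr_ae (ae_of_all _ fun ζ => ?_)
    simp only [chr_comm 0, chr_zero, mul_one]
  have hb' := h.smoothDiff k hρ hW
  have hamp := h.ampBound hρ fun η => (hW.pos η).le
  have hamp' := hb'.ampBound hρ fun η => ((hW.mul_rpow (-ρ)).pos η).le
  refine ⟨FourierBF.smoothDiff k b, hb', fun θ ξ y hy => ?_⟩
  obtain ⟨N, hN⟩ := hamp.mono_pow hW
  obtain ⟨N', hN'⟩ := hamp'.mono_pow (hW.mul_rpow (-ρ))
  have hdiff : ∀ p, ∫ ζ, b (p.1, p.2 - ζ) * k ζ = b p - FourierBF.smoothDiff k b p := by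
    intro p
    simp_rw [FourierBF.smoothDiff, sub_mul]
    rw [integral_sub ((k.integrable).const_mul _) (integrable_shift k hamp hW p),
      integral_const_mul, hk]
    ring
  have hzero := integral_smooth_oscInt_eq_zero k hN hκ θ ξ y (fun x => by
    by_cases hx : ‖x - y‖ < ε
    · rw [hy x hx, zero_mul]
    · rw [sbump_eq_zero _ _ hε2 (by rw [dist_zero_right]; linarith [not_lt.1 hx]), mul_zero])
  have e : ∀ η, ∫ x, θ x * (∫ ζ, b (x, η - ζ) * k ζ) * chr x (η - ξ) =
      oscInt b θ ξ η - oscInt (FourierBF.smoothDiff k b) θ ξ η := by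
    intro η
    rw [oscInt, oscInt, ← integral_sub (integrable_mul_chr (hamp.integrable θ η) _)
      (integrable_mul_chr (hamp'.integrable θ η) _)]
    refine integral_congr_ae (ae_of_all _ fun x => ?_)
    simp only
    rw [hdiff (x, η)]; ring
  simp_rw [e, sub_mul] at hzero
  rw [integral_sub (integrable_mul_chr (integrable_oscInt hN θ ξ) _)
    (integrable_mul_chr (integrable_oscInt hN' θ ξ) _), sub_eq_zero] at hzero
  exact hzero.symm

theorem SymBound.exists_gain_pow (h : SymBound ρ W b) (hρ : 0 ≤ ρ) (hW : IsPolyModerate W) {ε : ℝ}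
    (hε : 0 < ε) (M : ℕ) : ∃ b', SymBound ρ (fun η => W η * (1 + ‖η‖) ^ (-ρ * M)) b' ∧
      ∀ (θ : 𝓢(E d, ℂ)) (ξ y : E d), (∀ x, ‖x - y‖ < ε → θ x = 0) →
        ∫ η, oscInt b' θ ξ η * chr η (-y) = ∫ η, oscInt b θ ξ η * chr η (-y) := by
  induction M with
  | zero => exact ⟨b, by simpa using h, fun _ _ _ _ => rfl⟩
  | succ M ih =>
    obtain ⟨b', hb', he⟩ := ih
    obtain ⟨b'', hb'', he'⟩ := hb'.exists_gain hρ (hW.mul_rpow _) hε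
    refine ⟨b'', hb''.mono zero_le_one fun η => le_of_eq ?_, fun θ ξ y hy => ?_⟩
    · rw [one_mul, mul_assoc, ← Real.rpow_add (by positivity)]
      congr 2
      push_cast
      ring
    · rw [he' θ ξ y hy, he θ ξ y hy]

/-- A functional sees finitely many seminorms, so sufficient decay of the amplitude in η beats their
weights. The remaining L orders, together with the decay in η − ξ, give decay in ξ by Peetre's
inequality. -/
theorem exists_rapid (u : 𝓢(E d, ℂ) →L[ℂ] ℂ) (L : ℕ) : ∃ M : ℕ, ∀ b, AmpBound (dec M) b →
    ∃ q : Seminorm ℂ 𝓢(E d, ℂ), Continuous q ∧ ∀ (θ : 𝓢(E d, ℂ)) (ξ : E d) (g : 𝓢(E d, ℂ)),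
      (∀ η, g η = oscInt b θ ξ η) → ‖u g‖ ≤ dec L ξ * q θ := by
  obtain ⟨s, C, hC, hu⟩ := exists_seminorm_functional u
  refine ⟨L + s.sup Prod.fst, fun b hb => ?_⟩
  choose q hq hq' using fun i : ℕ × ℕ =>
    exists_seminorm_oscInt hb (fun η => dec_nonneg _ η) (continuous_dec _) L i.2
  obtain ⟨p, hp, hp'⟩ := exists_seminorm_sum s q hq hC
  refine ⟨p, hp, fun θ ξ g hg => (hu g).trans ?_⟩
  rw [hp', mul_left_comm, Finset.mul_sum (f := fun i => q i θ)]
  refine mul_le_mul_of_nonneg_left (Finset.sum_le_sum fun i hi => ?_) hC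
  have hqi : 0 ≤ q i θ := apply_nonneg _ _
  refine SchwartzMap.seminorm_le_bound ℂ _ _ _ (mul_nonneg (dec_nonneg _ _) hqi) fun η => ?_
  have hge : (g : E d → ℂ) = oscInt b θ ξ := funext hg
  have h1 := hq' i θ ξ η
  have h2 : ‖iteratedFDeriv ℝ i.2 (oscInt b θ ξ) η‖ ≤
      dec L (ξ - η) * (dec (L + s.sup Prod.fst) η * q i θ) := by
    rw [dec_sub_comm, dec, ← div_eq_inv_mul, le_div_iff₀ (by positivity), mul_comm]
    exact h1
  have hk : i.1 ≤ s.sup Prod.fst := Finset.le_sup (f := Prod.fst) hi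
  have h3 : ‖η‖ ^ i.1 ≤ (1 + ‖η‖) ^ (s.sup Prod.fst) :=
    (pow_le_pow_left₀ (norm_nonneg _) (by linarith) _).trans
      (pow_le_pow_right₀ (one_le_one_add_norm η) hk)
  have h4 := dec_mul_dec_le_left L (ξ - η) η
  rw [sub_add_cancel] at h4
  have h5 := dec_nonneg L (ξ - η)
  have h6 := dec_nonneg (L + s.sup Prod.fst) η
  rw [hge]
  calc ‖η‖ ^ i.1 * ‖iteratedFDeriv ℝ i.2 (oscInt b θ ξ) η‖
      ≤ (1 + ‖η‖) ^ (s.sup Prod.fst) * (dec L (ξ - η) * (dec (L + s.sup Prod.fst) η * q i θ)) := by gcongr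
    _ = dec L (ξ - η) * (dec (L + s.sup Prod.fst) η * (1 + ‖η‖) ^ (s.sup Prod.fst)) * q i θ := by ring
    _ = (dec L (ξ - η) * dec L η) * q i θ := by rw [dec_add_mul_pow]
    _ ≤ dec L ξ * q i θ := by gcongr

theorem oscInt_modulate (b : E d × E d → ℂ) (θ : 𝓢(E d, ℂ)) (hθ : HasCompactSupport θ) (ξ η : E d) :
    oscInt b (modulate θ hθ ξ) 0 η = oscInt b θ ξ η := by
  refine integral_congr_ae (ae_of_all _ fun x => ?_)
  simp only [modulate_apply]
  rw [sub_zero, sub_eq_add_neg, chr_add]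
  ring

/-- Where ψ ≠ 1 the point is at distance at least ε from the support of θ, so b may be replaced by a
symbol of very negative order without changing (1 − ψ) FS g. The bound depends on θ only through a
seminorm, so θ may later vary with ξ. -/
theorem SymBound.exists_pseudolocal (h : SymBound ρ W b) (hρ : 0 < ρ) (hW : IsPolyModerate W)
    (f : 𝓢'(E d, ℂ)) (ψ : 𝓢(E d, ℂ)) {ε : ℝ} (hε : 0 < ε) (L : ℕ) :
    ∃ q : Seminorm ℂ 𝓢(E d, ℂ), Continuous q ∧ ∀ (θ : 𝓢(E d, ℂ)) (_ : HasCompactSupport θ) (ξ : E d),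
      (∀ x y, θ x ≠ 0 → ‖x - y‖ < ε → ψ y = 1) → ∀ g Φ : 𝓢(E d, ℂ),
      (∀ η, g η = oscInt b θ ξ η) → (∀ y, Φ y = FS g y - ψ y * FS g y) → ‖f Φ‖ ≤ dec L ξ * q θ := by
  let m : 𝓢(E d, ℂ) →L[ℂ] 𝓢(E d, ℂ) :=
    ContinuousLinearMap.id ℂ _ - SchwartzMap.smulLeftCLM ℂ (ψ : E d → ℂ)
  have hm : ∀ g y, m g y = g y - ψ y * g y := by
    intro g y
    change g y - SchwartzMap.smulLeftCLM ℂ (ψ : E d → ℂ) g y = _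
    rw [SchwartzMap.smulLeftCLM_apply_apply ψ.hasTemperateGrowth, smul_eq_mul]
  let u : 𝓢(E d, ℂ) →L[ℂ] ℂ := (f : 𝓢(E d, ℂ) →L[ℂ] ℂ).comp (m.comp FS)
  obtain ⟨M, hM⟩ := exists_rapid u L
  obtain ⟨N, C, hC, hN⟩ := hW.exists_le_pow
  -- M' gains of ρ must cover the decay M required by u and the growth N of W.
  obtain ⟨M', hM'⟩ := exists_nat_ge (((M + N : ℕ) : ℝ) / ρ)
  obtain ⟨b', hb', he⟩ := h.exists_gain_pow hρ.le hW hε M'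
  have hle : ∀ η, W η * (1 + ‖η‖) ^ (-ρ * M') ≤ C * dec M η := by
    intro η
    have h1 : (1 + ‖η‖) ^ (-ρ * M') ≤ dec (M + N) η := by
      rw [dec, ← Real.rpow_natCast, ← Real.rpow_neg (by positivity)]
      refine Real.rpow_le_rpow_of_exponent_le (one_le_one_add_norm η) ?_
      rw [div_le_iff₀ hρ] at hM'
      linarith
    calc W η * (1 + ‖η‖) ^ (-ρ * M') ≤ (C * (1 + ‖η‖) ^ N) * dec (M + N) η :=
          mul_le_mul (hN η) h1 (by positivity) (by positivity)
      _ = C * (dec (M + N) η * (1 + ‖η‖) ^ N) := by ring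
      _ = _ := by rw [dec_add_mul_pow]
  have hamp' := (hb'.mono hC.le hle).ampBound hρ.le fun η => dec_nonneg _ _
  obtain ⟨q, hq, hq'⟩ := hM b' hamp'
  obtain ⟨N', hN'⟩ := (hb'.ampBound hρ.le fun η => ((hW.mul_rpow _).pos η).le).mono_pow (hW.mul_rpow _)
  obtain ⟨A, hA⟩ := exists_oscCLM hN'
  refine ⟨q, hq, fun θ hθ ξ hψ g Φ hg hΦ => ?_⟩
  let g' := A (modulate θ hθ ξ)
  have hg' : ∀ η, g' η = oscInt b' θ ξ η := fun η => by rw [hA, oscInt_modulate]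
  -- At each point either 1 − ψ vanishes or the two Fourier transforms agree.
  have e : Φ = m (FS g') := by
    ext y
    rw [hm, hΦ]
    by_cases hy : ψ y = 1
    · rw [hy]; ring
    · have hFS : FS g' y = FS g y := by
        rw [FS_apply, FS_apply]
        simp_rw [hg', hg]
        refine he θ ξ y fun x hx => ?_
        by_contra h0
        exact hy (hψ x y h0 hx)
      rw [hFS]
  rw [e]
  exact hq' θ ξ g' hg'

end PseudolocalEstimate

end FourierBF

end

noncomputable section

namespace FourierBF

open scoped ContDiff FourierTransform

/-! ### Quotients of families -/

section Quotients

variable {d : ℕ} {T : Type*}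

theorem hasDerivAt_of_dirD {b : E d → ℂ} {x : E d} (hb : DifferentiableAt ℝ b x) (v : E d) :
    HasDerivAt (fun t : ℝ => b (x + t • v)) (dirD v b x) 0 := by
  have h1 : HasDerivAt (fun t : ℝ => x + t • v) v 0 := by
    simpa using ((hasDerivAt_id (0 : ℝ)).smul_const v).const_add x
  have h2 : HasFDerivAt b (fderiv ℝ b x) (x + (0 : ℝ) • v) := by simpa using hb.hasFDerivAt
  exact h2.comp_hasDerivAt _ h1

theorem tsupport_dirD_subset (v : E d) (b : E d → ℂ) : tsupport (dirD v b) ⊆ tsupport b := by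
  refine closure_minimal (fun x hx => ?_) (isClosed_tsupport b)
  refine support_fderiv_subset ℝ (f := b) fun h => hx ?_
  rw [dirD, h]; rfl

theorem contDiff_div_pow {g A : E d → ℂ} (hg : ContDiff ℝ ∞ g) (hA : ContDiff ℝ ∞ A)
    (h : ∀ x ∈ tsupport g, A x ≠ 0) (m : ℕ) : ContDiff ℝ ∞ fun x => g x / A x ^ m := by
  refine contDiff_iff_contDiffAt.2 fun x => ?_
  by_cases hx : x ∈ tsupport g
  · simp only [div_eq_mul_inv]
    exact hg.contDiffAt.mul ((hA.contDiffAt.pow m).inv (pow_ne_zero _ (h x hx)))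
  · refine (contDiffAt_const (c := (0 : ℂ))).congr_of_eventuallyEq ?_
    filter_upwards [notMem_tsupport_iff_eventuallyEq.1 hx] with y hy
    rw [hy]; simp

theorem dirD_div_pow {g A : E d → ℂ} (hg : ContDiff ℝ ∞ g) (hA : ContDiff ℝ ∞ A)
    (h : ∀ x ∈ tsupport g, A x ≠ 0) (m : ℕ) (v : E d) :
    dirD v (fun x => g x / A x ^ m) = fun x =>
      dirD v g x / A x ^ m + (-(m : ℂ) * (g x * dirD v A x)) / A x ^ (m + 1) := by
  funext x
  by_cases hx : x ∈ tsupport g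
  · have hA0 := h x hx
    have h1 := hasDerivAt_of_dirD
      ((differentiable_of_contDiff (contDiff_div_pow hg hA h m)) x) v
    have h2 := hasDerivAt_of_dirD ((differentiable_of_contDiff hg) x) v
    have h3 := hasDerivAt_of_dirD ((differentiable_of_contDiff hA) x) v
    have h4 := h2.fun_div (h3.fun_pow m) (by simpa using pow_ne_zero m hA0)
    rw [h1.unique h4]
    simp only [zero_smul, add_zero]
    rcases m with _ | m
    · simp
    · rw [Nat.add_sub_cancel]
      field_simp
      ring
  · have h0 := notMem_tsupport_iff_eventuallyEq.1 hx
    have hd : ∀ {b : E d → ℂ}, b =ᶠ[nhds x] 0 → dirD v b x = 0 := by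
      intro b hb
      rw [dirD, hb.fderiv_eq]; simp
    rw [hd h0, hd (h0.mono fun y hy => by simp [hy]), image_eq_zero_of_notMem_tsupport hx]
    simp

/-- Differentiating g / A^m gives a term with numerator g·A' and denominator A^(m+1); the new
numerator bound V W over W^(m+1) is again V / W^m, so the induction needs all m. The lower bound on
A is only needed on the support of g. -/
theorem FamBound.div_pow {g A : T → E d → ℂ} {V W : T → ℝ} (hg : FamBound V g) (hA : FamBound W A)
    (hV : ∀ t, 0 ≤ V t) (hW : ∀ t, 0 < W t) {c : ℝ} (hc : 0 < c)
    (hle : ∀ t, ∀ x ∈ tsupport (g t), c * W t ≤ ‖A t x‖) (m : ℕ) :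
    FamBound (fun t => V t / W t ^ m) (fun t x => g t x / A t x ^ m) := by
  have hne : ∀ t, ∀ x ∈ tsupport (g t), A t x ≠ 0 := fun t x hx h0 => by
    have := hle t x hx
    rw [h0, norm_zero] at this
    have := mul_pos hc (hW t)
    linarith
  refine ⟨fun t => contDiff_div_pow (hg.smooth t) (hA.smooth t) (hne t) m, fun l => ?_⟩
  have h1g : ∀ x : E d, 1 ≤ 1 + ‖x‖ := one_le_one_add_norm
  induction l generalizing g V m with
  | nil =>
    obtain ⟨K, C, hC, hb⟩ := hg.norm_le
    refine ⟨K, C / c ^ m, by positivity, fun t x => ?_⟩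
    simp only [List.map_nil, dirDs]
    have hWt := hW t
    have hVt := hV t
    by_cases hx : x ∈ tsupport (g t)
    · rw [norm_div, norm_pow]
      calc ‖g t x‖ / ‖A t x‖ ^ m ≤ (C * (1 + ‖x‖) ^ K * V t) / (c * W t) ^ m := by
            gcongr
            · exact hb t x
            · exact hle t x hx
        _ = _ := by rw [mul_pow]; field_simp
    · rw [image_eq_zero_of_notMem_tsupport hx, zero_div, norm_zero]
      positivity
  | cons i l ih =>
    have hA' := hA.dirD i
    have hgA : FamBound (fun t => V t * W t)
        (fun t x => -(m : ℂ) * (g t x * dirD ((stdCoord d).vec i) (A t) x)) := by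
      have h1 := (DerivBound.const (κ := stdCoord d) (g := fun x => 1 + ‖x‖) (T := T)
        (-(m : ℂ))).mul (hg.mul hA' h1g (fun t _ => hV t) (fun t _ => (hW t).le)) h1g
        (fun _ _ => zero_le_one) (fun t _ => mul_nonneg (hV t) (hW t).le)
      simpa only [one_mul] using h1
    have hsub : ∀ t, tsupport (fun x => -(m : ℂ) * (g t x * dirD ((stdCoord d).vec i) (A t) x)) ⊆
        tsupport (g t) := fun t => by
      refine closure_mono fun x hx => ?_
      rw [Function.mem_support] at hx ⊢
      intro h0
      exact hx (by rw [h0]; ring)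
    have hsub' : ∀ t, tsupport (dirD ((stdCoord d).vec i) (g t)) ⊆ tsupport (g t) := fun t =>
      tsupport_dirD_subset _ _
    obtain ⟨K, C, hC, hb⟩ := ih (hg.dirD i) hV (fun t x hx => hle t x (hsub' t hx)) m
      (fun t x hx => hne t x (hsub' t hx))
    obtain ⟨K', C', hC', hb'⟩ := ih hgA (fun t => mul_nonneg (hV t) (hW t).le)
      (fun t x hx => hle t x (hsub t hx)) (m + 1) (fun t x hx => hne t x (hsub t hx))
    refine ⟨K + K', C + C', by positivity, fun t x => ?_⟩
    simp only [List.map_cons, dirDs]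
    rw [dirD_div_pow (hg.smooth t) (hA.smooth t) (hne t),
      dirDs_add (contDiff_div_pow ((hg.dirD i).smooth t) (hA.smooth t)
          (fun x hx => hne t x (hsub' t hx)) m)
        (contDiff_div_pow (hgA.smooth t) (hA.smooth t) (fun x hx => hne t x (hsub t hx)) (m + 1))]
    have hWt := hW t
    have hVt := hV t
    have hx1 := h1g x
    calc _ ≤ _ := norm_add_le _ _
      _ ≤ C * (1 + ‖x‖) ^ K * (V t / W t ^ m) + C' * (1 + ‖x‖) ^ K' * (V t * W t / W t ^ (m + 1)) :=
          add_le_add (hb t x) (hb' t x)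
      _ = C * (1 + ‖x‖) ^ K * (V t / W t ^ m) + C' * (1 + ‖x‖) ^ K' * (V t / W t ^ m) := by
          congr 2
          rw [pow_succ]; field_simp
      _ ≤ C * (1 + ‖x‖) ^ (K + K') * (V t / W t ^ m) +
          C' * (1 + ‖x‖) ^ (K + K') * (V t / W t ^ m) := by
          gcongr <;> first | exact hx1 | omega
      _ = _ := by ring

theorem FamBound.comp {b : T → E d → ℂ} {V : T → ℝ} (h : FamBound V b) {T' : Type*} (s : T' → T) :
    FamBound (fun t => V (s t)) (fun t => b (s t)) :=
  ⟨fun t => h.smooth (s t), fun l => by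
    obtain ⟨K, C, hC, hb⟩ := h.bound l
    exact ⟨K, C, hC, fun t p => hb (s t) p⟩⟩

/-- On a common compact support the powers of 1 + |x| are constants, so every continuous seminorm is
linear in V t. -/
theorem FamBound.exists_seminorm_le {b : T → E d → ℂ} {V : T → ℝ} (h : FamBound V b)
    (hV : ∀ t, 0 ≤ V t) {R : ℝ} (hR : ∀ t x, R ≤ ‖x‖ → b t x = 0)
    {q : Seminorm ℂ 𝓢(E d, ℂ)} (hq : Continuous q) :
    ∃ C : ℝ, 0 ≤ C ∧ ∀ t (u : 𝓢(E d, ℂ)), (∀ x, u x = b t x) → q u ≤ C * V t := by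
  obtain ⟨s, C, hC, hs⟩ := exists_sup_seminorm_le hq
  have key : ∀ k n : ℕ, ∃ D : ℝ, 0 ≤ D ∧ ∀ t (u : 𝓢(E d, ℂ)), (∀ x, u x = b t x) →
      SchwartzMap.seminorm ℂ k n u ≤ D * V t := by
    intro k n
    obtain ⟨Cn, hCn, hn⟩ := norm_iteratedFDeriv_le_of_dirDs (stdCoord d) n
    choose K D hD hb using h.bound
    have hfin : Finite {l : List (Fin d) // l.length = n} := (inferInstance : Finite (List.Vector (Fin d) n))
    have := Fintype.ofFinite {l : List (Fin d) // l.length = n}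
    let D₀ := ∑ l : {l : List (Fin d) // l.length = n}, D l.1 * (1 + |R|) ^ K l.1
    have hD₀ : 0 ≤ D₀ := Finset.sum_nonneg fun l _ => by have := hD l.1; positivity
    refine ⟨|R| ^ k * (Cn * D₀), by positivity, fun t u hu => ?_⟩
    have hVt := hV t
    refine SchwartzMap.seminorm_le_bound ℂ k n u (by positivity) fun x => ?_
    have he : (u : E d → ℂ) = b t := funext hu
    rw [he]
    by_cases hx : ‖x‖ ≤ |R|
    · have h1 := hn (b t) (h.smooth t) x (D₀ * V t) fun l hl => by
        refine (hb l t x).trans ?_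
        have h2 : D l * (1 + |R|) ^ K l ≤ D₀ := Finset.single_le_sum
          (f := fun l : {l : List (Fin d) // l.length = n} => D l.1 * (1 + |R|) ^ K l.1)
          (fun l _ => by have := hD l.1; positivity) (Finset.mem_univ ⟨l, hl⟩)
        have := hD l
        calc D l * (1 + ‖x‖) ^ K l * V t ≤ D l * (1 + |R|) ^ K l * V t := by gcongr
          _ ≤ D₀ * V t := by gcongr
      calc _ ≤ |R| ^ k * (Cn * (D₀ * V t)) := by gcongr
        _ = _ := by ring
    · have hev : b t =ᶠ[nhds x] 0 := by
        have : {y : E d | |R| < ‖y‖} ∈ nhds x :=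
          (isOpen_lt continuous_const continuous_norm).mem_nhds (not_le.1 hx)
        filter_upwards [this] with y hy
        exact hR t y ((le_abs_self R).trans hy.le)
      have : iteratedFDeriv ℝ n (b t) x = 0 := by
        rw [(Filter.EventuallyEq.iteratedFDeriv ℝ hev n).eq_of_nhds]
        simp
      rw [this, norm_zero, mul_zero]
      positivity
  choose D hD hk using key
  refine ⟨C * ∑ i ∈ s, D i.1 i.2, mul_nonneg hC (Finset.sum_nonneg fun i _ => hD _ _),
    fun t u hu => (hs u).trans ?_⟩
  rw [mul_assoc, Finset.sum_mul]
  refine mul_le_mul_of_nonneg_left ?_ hC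
  refine Seminorm.finset_sup_apply_le (Finset.sum_nonneg fun i _ => mul_nonneg (hD _ _) (hV t))
    fun i hi => (hk i.1 i.2 t u hu).trans ?_
  exact Finset.single_le_sum (f := fun i : ℕ × ℕ => D i.1 i.2 * V t)
    (fun i _ => mul_nonneg (hD _ _) (hV t)) hi

end Quotients

end FourierBF

end

noncomputable section

namespace FourierBF

open scoped ContDiff FourierTransform

/-! ### Estimates for localized operators -/

section Estimates

variable {d : ℕ}

theorem exists_FS_eq (h : 𝓢(E d, ℂ)) :
    ∃ g : 𝓢(E d, ℂ), FS g = h ∧ ∀ η, g η = cFS d * ∫ x, h x * chr x η := by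
  let g : 𝓢(E d, ℂ) := cFS d • SchwartzMap.compCLMOfContinuousLinearEquiv ℂ
    (ContinuousLinearEquiv.neg ℝ (M := E d)) (FS h)
  have hg : ∀ η, g η = cFS d * FS h (-η) := fun η => rfl
  refine ⟨g, ?_, fun η => by rw [hg, FS_apply, neg_neg]⟩
  ext x
  rw [FS_apply, ← integral_neg_eq_self]
  have : ∀ η, g (-η) * chr (-η) (-x) = cFS d * (FS h η * chr η x) := fun η => by
    rw [hg, neg_neg, chr_neg_left, neg_neg]; ring
  simp_rw [this]
  rw [integral_const_mul]
  have e : ∀ η, FS h η * chr η x = FS h η * chr x η := fun η => by rw [chr_comm]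
  simp_rw [e]
  rw [integral_FS_mul_chr, ← mul_assoc, cFS_mul, one_mul]

theorem exists_integrable_dec_locF (f : 𝓢'(E d, ℂ)) (ψ : 𝓢(E d, ℂ)) (hψ : HasCompactSupport ψ)
    {V : E d → ℝ} (hV : IsPolyModerate V) : ∃ L₀ : ℕ, ∀ L ≥ L₀, ∀ ξ,
      Integrable fun η => dec L (ξ - η) * (‖locF f ψ hψ η‖ * V η) := by
  obtain ⟨N, C, hC, hN⟩ := exists_norm_locF_le f ψ hψ
  obtain ⟨N', C', hC', hN'⟩ := hV.exists_le_pow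
  refine ⟨d + 1 + (N + N'), fun L hL ξ => ?_⟩
  refine ((integrable_dec (Nat.lt_succ_self d)).const_mul
    (C * C' * (1 + ‖ξ‖) ^ (d + 1 + (N + N')))).mono' ?_ (ae_of_all _ fun η => ?_)
  · exact (((measurable_dec_sub L).comp measurable_prodMk_left).mul
      ((measurable_locF f ψ hψ).norm.mul hV.measurable)).aestronglyMeasurable
  · have h0 := dec_nonneg L (ξ - η)
    have h1 := hV.pos η
    rw [Real.norm_of_nonneg (by positivity)]
    have h2 : dec L (ξ - η) ≤ dec (d + 1 + (N + N')) η * (1 + ‖ξ‖) ^ (d + 1 + (N + N')) := by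
      rw [dec_sub_comm]
      exact (dec_anti hL _).trans (dec_le_of_sub _ _ _)
    have h3 := dec_nonneg (d + 1 + (N + N')) η
    calc dec L (ξ - η) * (‖locF f ψ hψ η‖ * V η)
        ≤ (dec (d + 1 + (N + N')) η * (1 + ‖ξ‖) ^ (d + 1 + (N + N'))) *
          ((C * (1 + ‖η‖) ^ N) * (C' * (1 + ‖η‖) ^ N')) := by
          gcongr
          · exact hN η
          · exact hN' η
      _ = (C * C' * (1 + ‖ξ‖) ^ (d + 1 + (N + N'))) *
          (dec (d + 1 + (N + N')) η * (1 + ‖η‖) ^ (N + N')) := by ring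
      _ = _ := by rw [dec_add_mul_pow]

theorem norm_integral_locF_le {f : 𝓢'(E d, ℂ)} {ψ : 𝓢(E d, ℂ)} {hψ : HasCompactSupport ψ}
    {V : E d → ℝ} {L : ℕ} {ξ : E d}
    (hi : Integrable fun η => dec L (ξ - η) * (‖locF f ψ hψ η‖ * V η)) {g : E d → ℂ} {C : ℝ}
    (hg : ∀ η, ‖g η‖ ≤ C * (dec L (ξ - η) * V η)) :
    ‖∫ η, locF f ψ hψ η * g η‖ ≤ C * decConv L (fun η => ‖locF f ψ hψ η‖ * V η) ξ := by
  rw [decConv, ← integral_const_mul]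
  refine norm_integral_le_of_norm_le (hi.const_mul C) (ae_of_all _ fun η => ?_)
  rw [norm_mul]
  calc _ ≤ ‖locF f ψ hψ η‖ * (C * (dec L (ξ - η) * V η)) := by gcongr; exact hg η
    _ = _ := by ring

theorem famBound_schwartz {T : Type*} (θ : 𝓢(E d, ℂ)) : FamBound (fun _ : T => 1) (fun _ => θ) := by
  refine ⟨fun _ => θ.smooth ⊤, fun l => ?_⟩
  suffices h : ∃ C : ℝ, 0 ≤ C ∧ ∀ x, ‖dirDs (l.map (stdCoord d).vec) θ x‖ ≤ C by
    obtain ⟨C, hC, h⟩ := h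
    exact ⟨0, C, hC, fun t x => by simpa using h x⟩
  induction l generalizing θ with
  | nil =>
    obtain ⟨C, hC, h⟩ := exists_norm_le_dec θ 0
    exact ⟨C, hC, fun x => (h x).trans (mul_le_of_le_one_right hC (dec_le_one _ _))⟩
  | cons i l ih =>
    have e : dirD ((stdCoord d).vec i) θ = sD i θ := funext fun x => (sD_apply i θ x).symm
    simp only [List.map_cons, dirDs, e]
    exact ih (sD i θ)

variable {ρ : ℝ} {W : E d → ℝ} {a : E d × E d → ℂ} {T : 𝓢(E d, ℂ) →L[ℂ] 𝓢(E d, ℂ)}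
  {f g : 𝓢'(E d, ℂ)}

/-- Split FS(T θ_ξ) with ψ and 1 − ψ: the first part is an integral against `locF f ψ`, the second
is pseudolocally negligible. -/
theorem SymBound.exists_localized (ha : SymBound ρ W a) (hρ : 0 < ρ) (hW : IsPolyModerate W)
    (hT : ∀ θ η, T θ η = oscInt a θ 0 η) (f : 𝓢'(E d, ℂ)) (ψ : 𝓢(E d, ℂ)) (hψ : HasCompactSupport ψ)
    {ε : ℝ} (hε : 0 < ε) (L : ℕ) :
    ∃ q : Seminorm ℂ 𝓢(E d, ℂ), Continuous q ∧ ∀ (θ : 𝓢(E d, ℂ)) (hθ : HasCompactSupport θ) (ξ : E d),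
      (∀ x y, θ x ≠ 0 → ‖x - y‖ < ε → ψ y = 1) →
      ‖f (FS (T (modulate θ hθ ξ))) - ∫ η, locF f ψ hψ η * T (modulate θ hθ ξ) η‖ ≤ dec L ξ * q θ := by
  obtain ⟨q, hq, hq'⟩ := ha.exists_pseudolocal hρ hW f ψ hε L
  refine ⟨q, hq, fun θ hθ ξ h => ?_⟩
  let g := T (modulate θ hθ ξ)
  let Φ₁ := SchwartzMap.smulLeftCLM ℂ (ψ : E d → ℂ) (FS g)
  have hΦ₁ : ∀ y, Φ₁ y = ψ y * FS g y := fun y => by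
    simp only [Φ₁, SchwartzMap.smulLeftCLM_apply_apply ψ.hasTemperateGrowth, smul_eq_mul]
  rw [← apply_eq_integral_locF f ψ hψ (g := g) hΦ₁, ← map_sub]
  refine hq' θ hθ ξ h g (FS g - Φ₁) (fun η => ?_) fun y => ?_
  · rw [hT, oscInt_modulate]
  · rw [← hΦ₁]; rfl

/-- T(φ e^{-i⟨·,ξ⟩})(η) has size W(η) and decays rapidly in η − ξ, so integrating it against `locF f
ψ` is a convolution estimate. -/
theorem SymBound.exists_direct_bound (ha : SymBound ρ W a) (hρ : 0 < ρ) (hW : IsPolyModerate W)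
    (hT : ∀ θ η, T θ η = oscInt a θ 0 η) (hg : ∀ φ, g φ = cFS d * f (FS (T φ)))
    (ψ : 𝓢(E d, ℂ)) (hψ : HasCompactSupport ψ) (φ : 𝓢(E d, ℂ)) (hφ : HasCompactSupport φ) {ε : ℝ}
    (hε : 0 < ε) (hψφ : ∀ x y, φ x ≠ 0 → ‖x - y‖ < ε → ψ y = 1) :
    ∃ L₀ : ℕ, ∀ L ≥ L₀, ∃ C : ℝ, 0 ≤ C ∧ ∀ ξ, ‖locF g φ hφ ξ‖ ≤
      C * (decConv L (fun η => ‖locF f ψ hψ η‖ * W η) ξ + dec L ξ) := by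
  obtain ⟨L₀, hL₀⟩ := exists_integrable_dec_locF f ψ hψ hW
  refine ⟨L₀, fun L hL => ?_⟩
  have hW0 : ∀ η, 0 ≤ W η := fun η => (hW.pos η).le
  obtain ⟨q₁, -, hq₁⟩ := ha.exists_localized hρ hW hT f ψ hψ hε L
  obtain ⟨q₂, -, hq₂⟩ := exists_norm_oscInt_le (ha.ampBound hρ.le hW0) hW0 L
  have h1 : 0 ≤ q₁ φ := apply_nonneg _ _
  have h2 : 0 ≤ q₂ φ := apply_nonneg _ _
  refine ⟨‖cFS d‖ * (q₁ φ + q₂ φ), by positivity, fun ξ => ?_⟩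
  have h3 := hq₁ φ hφ ξ hψφ
  have h4 := norm_integral_locF_le (hL₀ L hL ξ) (g := T (modulate φ hφ ξ)) (C := q₂ φ) fun η => by
    rw [hT, oscInt_modulate, dec_sub_comm]
    exact (hq₂ φ ξ η).trans (le_of_eq (by ring))
  have h5 : 0 ≤ decConv L (fun η => ‖locF f ψ hψ η‖ * W η) ξ :=
    integral_nonneg fun η => mul_nonneg (dec_nonneg _ _) (mul_nonneg (norm_nonneg _) (hW0 η))
  have h6 := dec_nonneg L ξ
  rw [locF, hg, norm_mul, mul_assoc]
  gcongr
  calc ‖f (FS (T (modulate φ hφ ξ)))‖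
      ≤ ‖f (FS (T (modulate φ hφ ξ))) - ∫ η, locF f ψ hψ η * T (modulate φ hφ ξ) η‖ +
        ‖∫ η, locF f ψ hψ η * T (modulate φ hφ ξ) η‖ := by
        simpa using norm_add_le (f (FS (T (modulate φ hφ ξ))) -
          ∫ η, locF f ψ hψ η * T (modulate φ hφ ξ) η) (∫ η, locF f ψ hψ η * T (modulate φ hφ ξ) η)
    _ ≤ dec L ξ * q₁ φ + q₂ φ * decConv L (fun η => ‖locF f ψ hψ η‖ * W η) ξ := add_le_add h3 h4
    _ ≤ _ := by nlinarith [mul_nonneg h1 h5, mul_nonneg h2 h6]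

/-- Derivatives in x preserve the symbol order, so the gain from a frequency difference survives
them all. The pair of frequencies is the family parameter. -/
theorem SymBound.famBound_sub (ha : SymBound ρ W a) (hW : IsPolyModerate W) :
    ∃ N : ℕ, FamBound (fun p : E d × E d => W p.1 * (1 + ‖p.1‖) ^ (-ρ) * (1 + ‖p.1 - p.2‖) ^ N)
      (fun p x => a (x, p.1) - a (x, p.2)) := by
  obtain ⟨N, C₀, hC₀, hN⟩ := (hW.mul_rpow (-ρ)).exists_le
  have hsm : ∀ η : E d, ContDiff ℝ ∞ fun x => a (x, η) := fun η =>
    ha.smooth.comp (contDiff_id.prodMk contDiff_const)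
  refine ⟨N + 1, fun p => (hsm _).sub (hsm _), fun l => ?_⟩
  have h1 := ha.dirDs l []
  simp only [List.length_nil, Nat.cast_zero, mul_zero, Real.rpow_zero, mul_one] at h1
  obtain ⟨K, C, hC, hb⟩ := h1.sub_le hW.pos hC₀ hN
  refine ⟨K, C, hC, fun p x => ?_⟩
  rw [dirDs_sub (hsm _) (hsm _)]
  beta_reduce
  rw [dirDs_slice ha.smooth, dirDs_slice ha.smooth, List.map_map]
  refine le_trans (le_of_eq ?_) ((hb x p.1 p.2).trans (le_of_eq (by ring)))
  simp only [List.map_nil, List.append_nil]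
  rfl

/-- For large ξ, g is tested on u e^{-i⟨·,ξ⟩} with u = χ / a(·,ξ). Transposition brings in u(x)
a(x,η) = χ(x) a(x,η)/a(x,ξ); at η = ξ this is χ, whose contribution is `locF f χ ξ`. The three terms
on the right come from g itself, from freezing η at ξ, and from localization and small ξ. -/
theorem SymBound.exists_parametrix_bound (ha : SymBound ρ W a) (hρ : 0 < ρ) (hW : IsPolyModerate W)
    (hT : ∀ θ η, T θ η = oscInt a θ 0 η) (hg : ∀ φ, g φ = cFS d * f (FS (T φ)))
    (ψ : 𝓢(E d, ℂ)) (hψ : HasCompactSupport ψ) (φ : 𝓢(E d, ℂ)) (hφ : HasCompactSupport φ)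
    (χ : 𝓢(E d, ℂ)) (hχ : HasCompactSupport χ) {ε : ℝ}
    (hε : 0 < ε) (hψχ : ∀ x y, χ x ≠ 0 → ‖x - y‖ < ε → ψ y = 1) (hφχ : ∀ x, χ x ≠ 0 → φ x = 1)
    {c R : ℝ} (hc : 0 < c) (hell : ∀ x ∈ tsupport χ, ∀ ξ, R ≤ ‖ξ‖ → c * W ξ ≤ ‖a (x, ξ)‖) :
    ∃ L₀ : ℕ, ∀ L ≥ L₀, ∃ C : ℝ, 0 ≤ C ∧ ∀ ξ, ‖locF f χ hχ ξ‖ ≤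
      C * (decConv L (fun η => ‖locF g φ hφ η‖ * 1) ξ / W ξ +
        decConv L (fun η => ‖locF f ψ hψ η‖ * 1) ξ * (1 + ‖ξ‖) ^ (-ρ) + dec L ξ) := by
  have h1mod : IsPolyModerate (fun _ : E d => (1 : ℝ)) := by
    simpa using isPolyModerate_one_add_norm_rpow (V := E d) 0
  obtain ⟨L₁, hL₁⟩ := exists_integrable_dec_locF f ψ hψ h1mod
  obtain ⟨L₂, hL₂⟩ := exists_integrable_dec_locF g φ hφ h1mod
  refine ⟨max L₁ L₂, fun L hL => ?_⟩
  have hLL₁ : L₁ ≤ L := (le_max_left _ _).trans hL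
  have hLL₂ : L₂ ≤ L := (le_max_right _ _).trans hL
  have hW0 : ∀ η, 0 ≤ W η := fun η => (hW.pos η).le
  have hg1 : ∀ x : E d, 1 ≤ 1 + ‖x‖ := one_le_one_add_norm
  obtain ⟨r, hr, hχr⟩ := exists_pos_eq_zero hχ
  let T₁ := {ξ : E d // R ≤ ‖ξ‖}
  have famA : FamBound (fun ξ : T₁ => W ξ) (fun ξ x => a (x, ξ)) :=
    FamBound.comp (ha.ampBound hρ.le hW0).slice Subtype.val
  have famU := (famBound_schwartz (T := T₁) χ).div_pow famA (fun _ => zero_le_one)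
    (fun ξ => hW.pos ξ) hc (fun ξ x hx => hell x hx ξ ξ.2) 1
  obtain ⟨N, famD⟩ := ha.famBound_sub hW
  let T₂ := {p : E d × E d // R ≤ ‖p.1‖}
  have famB := (famU.comp (fun p : T₂ => (⟨p.1.1, p.2⟩ : T₁))).mul (famD.comp (fun p : T₂ => p.1)) hg1
    (fun p _ => by have := hW0 p.1.1; positivity) (fun p _ => by have := hW0 p.1.1; positivity)
  -- The N extra orders absorb the factor (1 + |ξ − η|)^N from `famBound_sub`. The weight 1/W(ξ) of
  -- the quotient cancels W(ξ), leaving (1 + |ξ|)^{-ρ}.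
  obtain ⟨q₁, -, hq₁⟩ := exists_seminorm_oscillatory (fun p : T₂ => by
    have := hW0 p.1.1; positivity) (L + N) famB
  have hU0 : ∀ ξ : T₁, 0 ≤ 1 / W ξ ^ 1 := fun ξ => by have := hW0 ξ; positivity
  have hUr : ∀ (ξ : T₁) x, r ≤ ‖x‖ → χ x / a (x, ξ) ^ 1 = 0 := fun ξ x hx => by rw [hχr x hx, zero_div]
  have hUex : ∀ ξ : T₁, ∃ u : 𝓢(E d, ℂ), HasCompactSupport u ∧ ∀ x, u x = χ x / a (x, ξ) ^ 1 := by
    intro ξ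
    have hcs : HasCompactSupport fun x => χ x / a (x, ξ) ^ 1 := hχ.mono fun x hx => by
      rw [Function.mem_support] at hx ⊢
      exact fun h0 => hx (by rw [h0, zero_div])
    exact ⟨hcs.toSchwartzMap (famU.smooth ξ), hcs, fun x => rfl⟩
  choose u hu huv using hUex
  -- Seminorms of u are O(1/W(ξ)), hence polynomially bounded; N₀ extra orders of decay in the
  -- pseudolocal error compensate.
  obtain ⟨N₀, C₀, hC₀, hN₀⟩ := hW.inv.exists_le_pow
  obtain ⟨q₂, hq₂c, hq₂⟩ := ha.exists_localized hρ hW hT f ψ hψ hε (L + N₀)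
  obtain ⟨C₂, hC₂, hq₂u⟩ := famU.exists_seminorm_le hU0 hUr hq₂c
  obtain ⟨q₃, hq₃c, hq₃⟩ := exists_seminorm_oscillatory (T := Unit) (W := fun _ => 1)
    (fun _ => zero_le_one) L (b := fun _ _ => 1) (DerivBound.const 1)
  obtain ⟨C₃, hC₃, hq₃u⟩ := famU.exists_seminorm_le hU0 hUr hq₃c
  obtain ⟨N₄, C₄, hC₄, hN₄⟩ := exists_norm_locF_le f χ hχ
  -- χ already belongs to the ξ-dependent family, so a fixed κ equal to 1 on its support serves as
  -- the Schwartz factor of the oscillatory integral.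
  let κ := sbump (0 : E d) r hr
  have hκχ : ∀ x, χ x ≠ 0 → κ x = 1 := by
    intro x hx
    refine sbump_eq_one _ _ hr ?_
    rw [mem_closedBall_zero_iff]
    by_contra h
    exact hx (hχr x (not_le.1 h).le)
  have hq₁κ : 0 ≤ q₁ κ := apply_nonneg _ _
  let C := ‖cFS d‖ * (q₁ κ + C₂ * C₀ + C₃) + C₄ * (1 + |R|) ^ N₄ * (1 + |R|) ^ L
  refine ⟨C, by positivity, fun ξ => ?_⟩
  have hG0 : 0 ≤ decConv L (fun η => ‖locF g φ hφ η‖ * 1) ξ / W ξ :=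
    div_nonneg (integral_nonneg fun η => mul_nonneg (dec_nonneg _ _) (by positivity)) (hW0 ξ)
  have hF0 : 0 ≤ decConv L (fun η => ‖locF f ψ hψ η‖ * 1) ξ * (1 + ‖ξ‖) ^ (-ρ) :=
    mul_nonneg (integral_nonneg fun η => mul_nonneg (dec_nonneg _ _) (by positivity)) (by positivity)
  have hd0 := dec_nonneg L ξ
  set G₀ := decConv L (fun η => ‖locF g φ hφ η‖ * 1) ξ / W ξ
  set F₀ := decConv L (fun η => ‖locF f ψ hψ η‖ * 1) ξ * (1 + ‖ξ‖) ^ (-ρ)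
  by_cases hξ : R ≤ ‖ξ‖
  swap
  -- Ellipticity says nothing for small ξ, but there `dec L` is bounded below and `locF` is bounded
  -- above.
  · have hξR : ‖ξ‖ ≤ |R| := (not_le.1 hξ).le.trans (le_abs_self R)
    have h1 : 1 ≤ (1 + |R|) ^ L * dec L ξ := by
      rw [dec, ← div_eq_mul_inv, one_le_div (by positivity)]
      gcongr
    calc ‖locF f χ hχ ξ‖ ≤ C₄ * (1 + |R|) ^ N₄ * 1 := by
          rw [mul_one]; exact (hN₄ ξ).trans (by gcongr)
      _ ≤ C₄ * (1 + |R|) ^ N₄ * ((1 + |R|) ^ L * dec L ξ) := by gcongr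
      _ = C₄ * (1 + |R|) ^ N₄ * (1 + |R|) ^ L * dec L ξ := by ring
      _ ≤ C * dec L ξ := by gcongr; exact le_add_of_nonneg_left (by positivity)
      _ ≤ _ := by
        have : 0 ≤ C := by positivity
        gcongr; linarith
  · let t : T₁ := ⟨ξ, hξ⟩
    let m := modulate (u t) (hu t) ξ
    have hut : ∀ x, u t x = χ x / a (x, ξ) := fun x => by rw [huv, pow_one]
    have hu0 : ∀ x, u t x ≠ 0 → χ x ≠ 0 := fun x hx h0 => hx (by rw [hut, h0, zero_div])
    have hua : ∀ x, u t x * a (x, ξ) = χ x := by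
      intro x
      by_cases hx : χ x = 0
      · rw [hut, hx, zero_div, zero_mul]
      · have h1 := hell x (subset_tsupport _ hx) ξ hξ
        have h2 : a (x, ξ) ≠ 0 := by
          rw [← norm_pos_iff]
          exact (mul_pos hc (hW.pos ξ)).trans_le h1
        rw [hut, div_mul_cancel₀ _ h2]
    have hWξ := hW.pos ξ
    -- Error from replacing f by ψ f.
    have e1 : ‖f (FS (T m)) - ∫ η, locF f ψ hψ η * T m η‖ ≤ C₂ * C₀ * dec L ξ := by
      refine (hq₂ (u t) (hu t) ξ fun x y hx => hψχ x y (hu0 x hx)).trans ?_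
      have h1 := hq₂u t (u t) (huv t)
      have h2 : (1 : ℝ) / W ξ ^ 1 ≤ C₀ * (1 + ‖ξ‖) ^ N₀ := by
        rw [pow_one, one_div]; exact hN₀ ξ
      have h3 := dec_nonneg (L + N₀) ξ
      calc dec (L + N₀) ξ * q₂ (u t) ≤ dec (L + N₀) ξ * (C₂ * (C₀ * (1 + ‖ξ‖) ^ N₀)) := by
            gcongr
            exact h1.trans (by gcongr)
        _ = C₂ * C₀ * (dec (L + N₀) ξ * (1 + ‖ξ‖) ^ N₀) := by ring
        _ = _ := by rw [dec_add_mul_pow]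
    -- φ = 1 where u ≠ 0, so only φ g enters; the inverse transform of m is concentrated at ξ with
    -- size 1/W(ξ).
    have e2 : ‖g m‖ ≤ ‖cFS d‖ * C₃ * G₀ := by
      obtain ⟨g₂, hg₂, hg₂'⟩ := exists_FS_eq m
      have h1 : g m = ∫ η, locF g φ hφ η * g₂ η := by
        refine apply_eq_integral_locF g φ hφ fun x => ?_
        rw [hg₂]
        by_cases hx : u t x = 0
        · simp only [m, modulate_apply, hx, zero_mul, mul_zero]
        · rw [hφχ x (hu0 x hx), one_mul]
      rw [h1]
      have h2 := norm_integral_locF_le (hL₂ L hLL₂ ξ) (g := g₂) (C := ‖cFS d‖ * C₃ / W ξ) fun η => by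
        rw [hg₂', norm_mul]
        have e : ∀ x, m x * chr x η = u t x * 1 * chr x (η - ξ) := fun x => by
          simp only [m, modulate_apply]
          rw [sub_eq_add_neg, chr_add]; ring
        simp_rw [e]
        have h3 := hq₃ (u t) () (η - ξ)
        have h4 := hq₃u t (u t) (huv t)
        rw [one_mul] at h3
        have h5 : ‖∫ x, u t x * 1 * chr x (η - ξ)‖ ≤ dec L (ξ - η) * (C₃ * (1 / W ξ ^ 1)) := by
          rw [dec_sub_comm, dec, ← div_eq_inv_mul, le_div_iff₀ (by positivity), mul_comm]
          exact h3.trans h4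
        calc _ ≤ ‖cFS d‖ * (dec L (ξ - η) * (C₃ * (1 / W ξ ^ 1))) := by gcongr
          _ = _ := by rw [pow_one]; ring
      refine h2.trans (le_of_eq ?_)
      simp only [G₀]; ring
    -- Error from replacing a(x,η) by a(x,ξ), written with the difference of the two symbols.
    have e3 : ‖locF f χ hχ ξ - cFS d * ∫ η, locF f ψ hψ η * T m η‖ ≤ ‖cFS d‖ * q₁ κ * F₀ := by
      obtain ⟨g₃, hg₃, hg₃'⟩ := exists_FS_eq (modulate χ hχ ξ)
      have h1 : locF f χ hχ ξ = ∫ η, locF f ψ hψ η * g₃ η := by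
        refine apply_eq_integral_locF f ψ hψ fun x => ?_
        rw [hg₃]
        by_cases hx : χ x = 0
        · simp only [modulate_apply, hx, zero_mul, mul_zero]
        · rw [hψχ x x hx (by simpa using hε), one_mul]
      have h2 : locF f χ hχ ξ - cFS d * ∫ η, locF f ψ hψ η * T m η =
          ∫ η, locF f ψ hψ η * (g₃ η - cFS d * T m η) := by
        rw [h1, ← integral_const_mul, ← integral_sub (integrable_locF_mul f ψ hψ g₃)
          ((integrable_locF_mul f ψ hψ (T m)).const_mul _)]
        refine integral_congr_ae (ae_of_all _ fun η => ?_)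
        simp only; ring
      rw [h2]
      have h3 := norm_integral_locF_le (hL₁ L hLL₁ ξ) (g := fun η => g₃ η - cFS d * T m η)
        (C := ‖cFS d‖ * q₁ κ * (1 + ‖ξ‖) ^ (-ρ)) fun η => by
        have hi1 : Integrable fun x => χ x * chr x (η - ξ) := integrable_schwartz_mul_chr χ _
        have hi2 : Integrable fun x => u t x * a (x, η) * chr x (η - ξ) :=
          integrable_mul_chr ((ha.ampBound hρ.le hW0).integrable (u t) η) _
        have h4 : g₃ η - cFS d * T m η = cFS d * ∫ x, κ x *
            (χ x / a (x, ξ) ^ 1 * (a (x, ξ) - a (x, η))) * chr x (η - ξ) := by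
          have h5 : ∫ x, modulate χ hχ ξ x * chr x η = ∫ x, χ x * chr x (η - ξ) := by
            refine integral_congr_ae (ae_of_all _ fun x => ?_)
            simp only [modulate_apply]
            rw [sub_eq_add_neg, chr_add]; ring
          rw [hg₃', hT, oscInt_modulate, ← mul_sub, h5, oscInt, ← integral_sub hi1 hi2]
          congr 1
          refine integral_congr_ae (ae_of_all _ fun x => ?_)
          simp only
          rw [pow_one, ← hut, ← hua x]
          by_cases hx : χ x = 0
          · rw [hut, hx]; ring
          · rw [hκχ x hx]; ring
        have h5 := hq₁ κ ⟨(ξ, η), hξ⟩ (η - ξ)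
        simp only [pow_one] at h5
        have h6 : ‖∫ x, κ x * (χ x / a (x, ξ) ^ 1 * (a (x, ξ) - a (x, η))) * chr x (η - ξ)‖ ≤
            dec (L + N) (ξ - η) * ((1 + ‖ξ‖) ^ (-ρ) * (1 + ‖ξ - η‖) ^ N * q₁ κ) := by
          rw [dec_sub_comm, dec, ← div_eq_inv_mul, le_div_iff₀ (by positivity), mul_comm]
          simp only [pow_one]
          refine h5.trans (le_of_eq ?_)
          field_simp
        rw [h4, norm_mul]
        calc _ ≤ ‖cFS d‖ * (dec (L + N) (ξ - η) *
              ((1 + ‖ξ‖) ^ (-ρ) * (1 + ‖ξ - η‖) ^ N * q₁ κ)) := by gcongr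
          _ = ‖cFS d‖ * q₁ κ * (1 + ‖ξ‖) ^ (-ρ) * (dec (L + N) (ξ - η) * (1 + ‖ξ - η‖) ^ N) := by ring
          _ = _ := by rw [dec_add_mul_pow, mul_one]
      refine h3.trans (le_of_eq ?_)
      simp only [F₀]; ring
    have hgm := hg m
    have hsplit : locF f χ hχ ξ = (locF f χ hχ ξ - cFS d * ∫ η, locF f ψ hψ η * T m η) -
        cFS d * (f (FS (T m)) - ∫ η, locF f ψ hψ η * T m η) + g m := by rw [hgm]; ring
    rw [hsplit]
    have hn := norm_nonneg (cFS d)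
    have hC4 : 0 ≤ C₄ * (1 + |R|) ^ N₄ * (1 + |R|) ^ L := by positivity
    calc _ ≤ ‖locF f χ hχ ξ - cFS d * ∫ η, locF f ψ hψ η * T m η‖ +
          ‖cFS d * (f (FS (T m)) - ∫ η, locF f ψ hψ η * T m η)‖ + ‖g m‖ :=
          (norm_add_le _ _).trans (by gcongr; exact norm_sub_le _ _)
      _ ≤ ‖cFS d‖ * q₁ κ * F₀ + ‖cFS d‖ * (C₂ * C₀ * dec L ξ) + ‖cFS d‖ * C₃ * G₀ := by
          rw [norm_mul]
          gcongr
      _ ≤ (C * F₀ + C * dec L ξ) + C * G₀ := by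
          have k1 : ‖cFS d‖ * q₁ κ ≤ C := by
            simp only [C]
            nlinarith [mul_nonneg hn (mul_nonneg hC₂ hC₀.le), mul_nonneg hn hC₃]
          have k2 : ‖cFS d‖ * (C₂ * C₀) ≤ C := by
            simp only [C]
            nlinarith [mul_nonneg hn hq₁κ, mul_nonneg hn hC₃]
          have k3 : ‖cFS d‖ * C₃ ≤ C := by
            simp only [C]
            nlinarith [mul_nonneg hn (mul_nonneg hC₂ hC₀.le), mul_nonneg hn hq₁κ]
          refine add_le_add (add_le_add (mul_le_mul_of_nonneg_right k1 hF0) ?_)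
            (mul_le_mul_of_nonneg_right k3 hG0)
          exact le_of_eq_of_le (mul_assoc _ _ _).symm (mul_le_mul_of_nonneg_right k2 hd0)
      _ = _ := by ring

end Estimates

end FourierBF

end

noncomputable section

namespace FourierBF

open scoped ContDiff FourierTransform

/-! ### Microlocal membership in BF-spaces -/

section Microlocal

variable {d : ℕ} {B : Type*} [NormedAddCommGroup B] [NormedSpace ℂ B]
  {v : E d → ℝ} {ι : B →ₗ[ℂ] (E d →ₘ[volume] ℂ)} {Γ Γ₁ : Set (E d)}

theorem InBF.add {F G : E d → ℂ} (hF : InBF ι Γ F) (hG : InBF ι Γ G) :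
    InBF ι Γ fun ξ => F ξ + G ξ := by
  obtain ⟨b, hb⟩ := hF
  obtain ⟨c, hc⟩ := hG
  refine ⟨b + c, ?_⟩
  rw [map_add]
  filter_upwards [AEEqFun.coeFn_add (ι b) (ι c), hb, hc] with ξ h1 h2 h3
  rw [h1, Pi.add_apply, h2, h3]
  by_cases hξ : ξ ∈ Γ <;> simp [hξ]

theorem InBF.const_mul {F : E d → ℂ} (hF : InBF ι Γ F) (c : ℂ) : InBF ι Γ fun ξ => c * F ξ := by
  obtain ⟨b, hb⟩ := hF
  refine ⟨c • b, ?_⟩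
  rw [map_smul]
  filter_upwards [AEEqFun.coeFn_smul c (ι b), hb] with ξ h1 h2
  rw [h1, Pi.smul_apply, h2, smul_eq_mul, Set.indicator_mul_right]

theorem IsInvariantBFSpace.inBF_of_norm_le (hB : IsInvariantBFSpace v ι) {F H : E d → ℂ}
    (hF : InBF ι Γ F) (hΓ₁ : IsOpenCone Γ₁) (hΓ : Γ₁ ⊆ Γ) (hH : Measurable H) (c : ℝ)
    (hle : ∀ ξ ∈ Γ₁, ‖H ξ‖ ≤ c * ‖F ξ‖) : InBF ι Γ₁ H := by
  obtain ⟨b, hb⟩ := hF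
  refine hB.exists_of_norm_le b (hH.indicator hΓ₁.isOpen.measurableSet).aestronglyMeasurable |c| ?_
  filter_upwards [hb] with ξ h
  by_cases hξ : ξ ∈ Γ₁
  · rw [h, Set.indicator_of_mem hξ, Set.indicator_of_mem (hΓ hξ)]
    exact (hle ξ hξ).trans (mul_le_mul_of_nonneg_right (le_abs_self c) (norm_nonneg _))
  · rw [Set.indicator_of_notMem hξ, norm_zero]
    positivity

theorem IsInvariantBFSpace.exists_inBF_dec (hB : IsInvariantBFSpace v ι) {V : E d → ℝ}
    (hV : IsPolyModerate V) : ∃ M₀ : ℕ, ∀ M ≥ M₀, ∀ Γ : Set (E d), IsOpenCone Γ →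
      InBF ι Γ fun ξ => ((dec M ξ * V ξ : ℝ) : ℂ) := by
  obtain ⟨M₀, hM₀⟩ := hB.exists_dec
  obtain ⟨N, C, hC, hN⟩ := hV.exists_le_pow
  obtain ⟨b, hb⟩ := hM₀ M₀ le_rfl
  refine ⟨M₀ + N, fun M hM Γ hΓ => ?_⟩
  refine hB.inBF_of_norm_le (Γ := Set.univ) (F := fun ξ => ((dec M₀ ξ : ℝ) : ℂ))
    ⟨b, by rwa [Set.indicator_univ]⟩ hΓ (Set.subset_univ _)
    (Complex.measurable_ofReal.comp ((continuous_dec M).measurable.mul hV.measurable)) C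
    fun ξ _ => ?_
  have h1 := dec_nonneg M ξ
  have h2 := dec_nonneg (M₀ + N) ξ
  rw [Complex.norm_real, Complex.norm_real, Real.norm_of_nonneg (mul_nonneg h1 (hV.pos ξ).le),
    Real.norm_of_nonneg (dec_nonneg _ _)]
  calc dec M ξ * V ξ ≤ dec (M₀ + N) ξ * (C * (1 + ‖ξ‖) ^ N) :=
        mul_le_mul (dec_anti hM ξ) (hN ξ) (hV.pos ξ).le h2
    _ = C * (dec (M₀ + N) ξ * (1 + ‖ξ‖) ^ N) := by ring
    _ = _ := by rw [dec_add_mul_pow]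

/-- Moderateness moves the outer weight V from ξ to η inside the convolution, at the cost of N
orders of decay of the kernel. -/
theorem IsInvariantBFSpace.exists_decConv_mul_mem (hB : IsInvariantBFSpace v ι)
    (hΓ₁ : IsOpenCone Γ₁) (hΓ : ConeInside Γ₁ Γ) {f : 𝓢'(E d, ℂ)} {ψ : 𝓢(E d, ℂ)}
    {hψ : HasCompactSupport ψ} {W V : E d → ℝ} (hW : IsPolyModerate W) (hV : IsPolyModerate V)
    (hb : InBF ι Γ fun ξ => locF f ψ hψ ξ * ((W ξ * V ξ : ℝ) : ℂ)) :
    ∃ M₀ : ℕ, ∀ M ≥ M₀,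
      InBF ι Γ₁ fun ξ => ((decConv M (fun η => ‖locF f ψ hψ η‖ * W η) ξ * V ξ : ℝ) : ℂ) := by
  obtain ⟨M₁, hM₁⟩ := hB.exists_decConv_mem hΓ₁ hΓ (hW.mul hV) hb
  obtain ⟨M₂, hM₂⟩ := exists_integrable_dec_locF f ψ hψ (hW.mul hV)
  obtain ⟨N, C, hC, hN⟩ := hV.exists_le
  refine ⟨max M₁ M₂ + N, fun M hM => ?_⟩
  have hL := measurable_locF f ψ hψ
  refine hB.inBF_of_norm_le (hM₁ _ (le_max_left M₁ M₂)) hΓ₁ Subset.rfl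
    (Complex.measurable_ofReal.comp
      ((measurable_decConv M (hL.norm.mul hW.measurable)).mul hV.measurable)) C fun ξ _ => ?_
  have h1 : ∀ η, 0 ≤ dec M (ξ - η) * (‖locF f ψ hψ η‖ * W η) := fun η =>
    mul_nonneg (dec_nonneg _ _) (mul_nonneg (norm_nonneg _) (hW.pos η).le)
  have h2 : ∀ η, 0 ≤ dec (max M₁ M₂) (ξ - η) * (‖locF f ψ hψ η‖ * (W η * V η)) := fun η =>
    mul_nonneg (dec_nonneg _ _) (mul_nonneg (norm_nonneg _) ((hW.mul hV).pos η).le)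
  have p1 : 0 ≤ decConv M (fun η => ‖locF f ψ hψ η‖ * W η) ξ := integral_nonneg h1
  have p2 : 0 ≤ decConv (max M₁ M₂) (fun η => ‖locF f ψ hψ η‖ * (W η * V η)) ξ :=
    integral_nonneg h2
  rw [Complex.norm_real, Complex.norm_real, Real.norm_of_nonneg (mul_nonneg p1 (hV.pos ξ).le),
    Real.norm_of_nonneg p2, decConv, decConv, ← integral_mul_const,
    ← integral_const_mul]
  refine integral_mono_of_nonneg (ae_of_all _ fun η => mul_nonneg (h1 η) (hV.pos ξ).le)
    ((hM₂ _ (le_max_right M₁ M₂) ξ).const_mul C) (ae_of_all _ fun η => ?_)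
  have h3 := hN η (ξ - η)
  rw [add_sub_cancel] at h3
  have h4 := hW.pos η
  have h5 := hV.pos ξ
  have h6 := dec_nonneg (max M₁ M₂ + N) (ξ - η)
  calc dec M (ξ - η) * (‖locF f ψ hψ η‖ * W η) * V ξ
      ≤ dec (max M₁ M₂ + N) (ξ - η) * (‖locF f ψ hψ η‖ * W η) *
        (C * V η * (1 + ‖ξ - η‖) ^ N) := by
        gcongr
        exact dec_anti hM _
    _ = C * ((dec (max M₁ M₂ + N) (ξ - η) * (1 + ‖ξ - η‖) ^ N) *
        (‖locF f ψ hψ η‖ * (W η * V η))) := by ring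
    _ = _ := by rw [dec_add_mul_pow]

/-- Near `(x₀, ξ₀)`, the distribution `f` belongs to the Fourier image of `B` with weight `V`. -/
def LocBF (ι : B →ₗ[ℂ] (E d →ₘ[volume] ℂ)) (f : 𝓢'(E d, ℂ)) (x₀ ξ₀ : E d) (V : E d → ℝ) : Prop :=
  ∃ r > 0, ∃ Γ, IsOpenCone Γ ∧ ξ₀ ∈ Γ ∧ ∀ (χ : 𝓢(E d, ℂ)) (hχ : HasCompactSupport χ),
    tsupport χ ⊆ Metric.ball x₀ r → InBF ι Γ fun ξ => locF f χ hχ ξ * (V ξ : ℂ)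

variable {f g : 𝓢'(E d, ℂ)} {x₀ ξ₀ : E d} {U V W : E d → ℝ}

theorem IsInvariantBFSpace.locBF_mono (hB : IsInvariantBFSpace v ι) (h : LocBF ι f x₀ ξ₀ V)
    (hU : IsPolyModerate U) (hV : IsPolyModerate V) {c : ℝ} (hle : ∀ ξ, U ξ ≤ c * V ξ) :
    LocBF ι f x₀ ξ₀ U := by
  obtain ⟨r, hr, Γ, hΓ, hξ, h⟩ := h
  refine ⟨r, hr, Γ, hΓ, hξ, fun χ hχ hs => hB.inBF_of_norm_le (h χ hχ hs) hΓ Subset.rfl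
    ((measurable_locF f χ hχ).mul (Complex.measurable_ofReal.comp hU.measurable)) c fun ξ _ => ?_⟩
  rw [norm_mul, norm_mul, Complex.norm_real, Complex.norm_real, Real.norm_of_nonneg (hU.pos ξ).le,
    Real.norm_of_nonneg (hV.pos ξ).le]
  calc _ ≤ ‖locF f χ hχ ξ‖ * (c * V ξ) := by gcongr; exact hle ξ
    _ = _ := by ring

/-- Since χ f = κ (φ f), its Fourier transform is a convolution with the rapidly decreasing
transform of κ. -/
theorem exists_norm_locF_le_decConv (f : 𝓢'(E d, ℂ)) {φ χ κ : 𝓢(E d, ℂ)} (hφ : HasCompactSupport φ)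
    (hχ : HasCompactSupport χ) (hκ : HasCompactSupport κ) (h : ∀ x, χ x = φ x * κ x) :
    ∃ L₀ : ℕ, ∀ L ≥ L₀, ∃ C : ℝ, 0 ≤ C ∧ ∀ ξ, ‖locF f χ hχ ξ‖ ≤
      C * decConv L (fun η => ‖locF f φ hφ η‖ * 1) ξ := by
  have h1mod : IsPolyModerate (fun _ : E d => (1 : ℝ)) := by
    simpa using isPolyModerate_one_add_norm_rpow (V := E d) 0
  obtain ⟨L₀, hL₀⟩ := exists_integrable_dec_locF f φ hφ h1mod
  refine ⟨L₀, fun L hL => ?_⟩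
  obtain ⟨C, hC, hdec⟩ := exists_norm_le_dec (FS κ) L
  refine ⟨‖cFS d‖ * C, by positivity, fun ξ => ?_⟩
  obtain ⟨g, hg, hg'⟩ := exists_FS_eq (modulate κ hκ ξ)
  have h1 : locF f χ hχ ξ = ∫ η, locF f φ hφ η * g η := by
    refine apply_eq_integral_locF f φ hφ fun x => ?_
    rw [hg, modulate_apply, modulate_apply, h, mul_assoc]
  rw [h1]
  refine norm_integral_locF_le (hL₀ L hL ξ) fun η => ?_
  have h2 : ∫ x, modulate κ hκ ξ x * chr x η = FS κ (ξ - η) := by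
    rw [FS_apply]
    refine integral_congr_ae (ae_of_all _ fun x => ?_)
    simp only [modulate_apply]
    rw [neg_sub, sub_eq_add_neg, chr_add]
    ring
  rw [hg', h2, norm_mul, mul_one, mul_assoc]
  gcongr
  exact hdec _

theorem exists_quotient {φ χ : 𝓢(E d, ℂ)} (hχ : HasCompactSupport χ)
    (h : ∀ x ∈ tsupport χ, φ x ≠ 0) :
    ∃ κ : 𝓢(E d, ℂ), HasCompactSupport κ ∧ ∀ x, χ x = φ x * κ x := by
  have hs : HasCompactSupport fun x => χ x * (φ x)⁻¹ := hχ.mul_right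
  have hd : ContDiff ℝ ∞ fun x => χ x * (φ x)⁻¹ := by
    rw [contDiff_iff_contDiffAt]
    intro x
    by_cases hx : x ∈ tsupport χ
    · exact (χ.smooth ⊤).contDiffAt.mul ((φ.smooth ⊤).contDiffAt.inv (h x hx))
    · refine (contDiffAt_const (c := (0 : ℂ))).congr_of_eventuallyEq ?_
      filter_upwards [notMem_tsupport_iff_eventuallyEq.1 hx] with y hy
      rw [hy, Pi.zero_apply, zero_mul]
  refine ⟨HasCompactSupport.toSchwartzMap hs hd, hs, fun x => ?_⟩
  change χ x = φ x * (χ x * (φ x)⁻¹)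
  by_cases hx : χ x = 0
  · rw [hx]; ring
  · have := h x (subset_tsupport _ hx)
    field_simp

/-- One good cut-off makes all cut-offs supported near x₀ good: they are multiples of φ, and
multiplication is convolution on the Fourier side. The smaller cone pays for the convolution. -/
theorem IsInvariantBFSpace.locBF_of_inBF (hB : IsInvariantBFSpace v ι) (hV : IsPolyModerate V)
    {φ : 𝓢(E d, ℂ)} (hφ : HasCompactSupport φ) (hx : φ x₀ ≠ 0) (hΓ : IsOpenCone Γ) (hξ : ξ₀ ∈ Γ)
    (h : InBF ι Γ fun ξ => locF f φ hφ ξ * (V ξ : ℂ)) : LocBF ι f x₀ ξ₀ V := by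
  obtain ⟨r, hr, hball⟩ := Metric.isOpen_iff.1 (isOpen_ne_fun φ.continuous continuous_const) x₀ hx
  obtain ⟨Γ₁, hΓ₁, hξ₁, -, hin⟩ := exists_coneInside hΓ hξ
  refine ⟨r, hr, Γ₁, hΓ₁, hξ₁, fun χ hχ hs => ?_⟩
  obtain ⟨κ, hκ, hq⟩ := exists_quotient hχ fun x hx => hball (hs hx)
  have h1mod : IsPolyModerate (fun _ : E d => (1 : ℝ)) := by
    simpa using isPolyModerate_one_add_norm_rpow (V := E d) 0
  obtain ⟨L₁, hL₁⟩ := exists_norm_locF_le_decConv f hφ hχ hκ hq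
  obtain ⟨L₂, hL₂⟩ := hB.exists_decConv_mul_mem hΓ₁ hin h1mod hV (by simpa using h)
  obtain ⟨C, hC, hb⟩ := hL₁ _ (le_max_left L₁ L₂)
  refine hB.inBF_of_norm_le (hL₂ _ (le_max_right L₁ L₂)) hΓ₁ Subset.rfl
    ((measurable_locF f χ hχ).mul (Complex.measurable_ofReal.comp hV.measurable)) C fun ξ _ => ?_
  have h0 : 0 ≤ decConv (max L₁ L₂) (fun η => ‖locF f φ hφ η‖ * 1) ξ :=
    integral_nonneg fun η => mul_nonneg (dec_nonneg _ _) (by positivity)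
  have hVp := hV.pos ξ
  rw [norm_mul, Complex.norm_real, Complex.norm_real, Real.norm_of_nonneg hVp.le,
    Real.norm_of_nonneg (mul_nonneg h0 hVp.le), ← mul_assoc]
  gcongr
  exact hb ξ

theorem tsupport_sbump_subset_ball {r s : ℝ} (hr : 0 < r) (h : 2 * r < s) :
    tsupport (sbump x₀ r hr) ⊆ Metric.ball x₀ s :=
  (tsupport_sbump_subset _ _ _).trans (Metric.closedBall_subset_ball h)

theorem sbump_eq_one_of_tsupport {χ : 𝓢(E d, ℂ)} {r s ε : ℝ} (hr : 0 < r)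
    (hχ : tsupport χ ⊆ Metric.ball x₀ s) (h : s + ε ≤ r) (x y : E d) (hx : χ x ≠ 0)
    (hxy : ‖x - y‖ < ε) : sbump x₀ r hr y = 1 := by
  refine sbump_eq_one _ _ _ ?_
  have h1 := hχ (subset_tsupport _ hx)
  rw [Metric.mem_ball] at h1
  rw [Metric.mem_closedBall]
  have h2 := dist_triangle y x x₀
  rw [dist_comm y x, dist_eq_norm x y] at h2
  linarith

/-! ### Mapping properties of the operator and elliptic regularity. -/

variable {ρ : ℝ} {a : E d × E d → ℂ} {T : 𝓢(E d, ℂ) →L[ℂ] 𝓢(E d, ℂ)}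

/-- The direct bound majorizes each localization of g by a convolution and a decaying term, both of
which belong to B on a smaller cone with weight V. -/
theorem IsInvariantBFSpace.locBF_image (hB : IsInvariantBFSpace v ι) (ha : SymBound ρ W a)
    (hρ : 0 < ρ) (hW : IsPolyModerate W) (hV : IsPolyModerate V)
    (hT : ∀ θ η, T θ η = oscInt a θ 0 η) (hg : ∀ φ, g φ = cFS d * f (FS (T φ)))
    (h : LocBF ι f x₀ ξ₀ fun ξ => W ξ * V ξ) : LocBF ι g x₀ ξ₀ V := by
  obtain ⟨r, hr, Γ, hΓ, hξ, h⟩ := h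
  obtain ⟨Γ₁, hΓ₁, hξ₁, -, hin⟩ := exists_coneInside hΓ hξ
  -- The bump of radius r/4 has support within r/2 < r, and equals 1 on the r/8-neighbourhood of the
  -- ball of radius r/8 that contains supp χ.
  have hr4 : 0 < r / 4 := by positivity
  have hr8 : 0 < r / 8 := by positivity
  refine ⟨r / 8, hr8, Γ₁, hΓ₁, hξ₁, fun χ hχ hs => ?_⟩
  obtain ⟨L₁, hL₁⟩ := ha.exists_direct_bound hρ hW hT hg (sbump x₀ (r / 4) hr4)
    (hasCompactSupport_sbump _ _ _) χ hχ hr8 (sbump_eq_one_of_tsupport hr4 hs (by linarith))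
  obtain ⟨L₂, hL₂⟩ := hB.exists_decConv_mul_mem hΓ₁ hin hW hV
    (h _ (hasCompactSupport_sbump _ _ _) (tsupport_sbump_subset_ball hr4 (by linarith)))
  obtain ⟨L₃, hL₃⟩ := hB.exists_inBF_dec hV
  obtain ⟨C, hC, hb⟩ := hL₁ (max L₁ (max L₂ L₃)) (by simp)
  refine hB.inBF_of_norm_le ((hL₂ (max L₁ (max L₂ L₃)) (by simp)).add
    (hL₃ (max L₁ (max L₂ L₃)) (by simp) Γ₁ hΓ₁)) hΓ₁ Subset.rfl
    ((measurable_locF g χ hχ).mul (Complex.measurable_ofReal.comp hV.measurable)) C fun ξ _ => ?_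
  have h0 : 0 ≤ decConv (max L₁ (max L₂ L₃))
      (fun η => ‖locF f (sbump x₀ (r / 4) hr4) (hasCompactSupport_sbump _ _ _) η‖ * W η) ξ :=
    integral_nonneg fun η => mul_nonneg (dec_nonneg _ _) (mul_nonneg (norm_nonneg _) (hW.pos η).le)
  have hVp := hV.pos ξ
  have hd := dec_nonneg (max L₁ (max L₂ L₃)) ξ
  rw [norm_mul, ← Complex.ofReal_add, Complex.norm_real, Complex.norm_real,
    Real.norm_of_nonneg hVp.le, ← add_mul, Real.norm_of_nonneg (by positivity), ← mul_assoc]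
  gcongr
  exact hb ξ

/-- One round of elliptic regularity: the information on g, and the information on f weaker by ρ,
live on different cones and balls, so both are intersected before the parametrix bound is multiplied
by U. -/
theorem IsInvariantBFSpace.locBF_parametrix_step (hB : IsInvariantBFSpace v ι)
    (ha : SymBound ρ W a) (hρ : 0 < ρ) (hW : IsPolyModerate W) (hU : IsPolyModerate U)
    (hT : ∀ θ η, T θ η = oscInt a θ 0 η) (hg : ∀ φ, g φ = cFS d * f (FS (T φ)))
    {c R : ℝ} (hc : 0 < c)
    (hell : ∀ x ∈ Metric.closedBall x₀ 1, ∀ ξ, R ≤ ‖ξ‖ → c * W ξ ≤ ‖a (x, ξ)‖)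
    (h₁ : LocBF ι g x₀ ξ₀ fun ξ => U ξ / W ξ)
    (h₂ : LocBF ι f x₀ ξ₀ fun ξ => U ξ * (1 + ‖ξ‖) ^ (-ρ)) : LocBF ι f x₀ ξ₀ U := by
  obtain ⟨r₁, hr₁, Γ, hΓ, hξ, h₁⟩ := h₁
  obtain ⟨r₂, hr₂, Γ', hΓ', hξ', h₂⟩ := h₂
  obtain ⟨Γ₁, hΓ₁, hξ₁, -, hin⟩ := exists_coneInside hΓ hξ
  obtain ⟨Γ₂, hΓ₂, hξ₂, -, hin'⟩ := exists_coneInside hΓ' hξ'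
  have hΓ₃ : IsOpenCone (Γ₁ ∩ Γ₂) := ⟨hΓ₁.isOpen.inter hΓ₂.isOpen, fun h => hΓ₁.zero_notMem h.1,
    fun t ht ξ h => ⟨hΓ₁.smul_mem t ht ξ h.1, hΓ₂.smul_mem t ht ξ h.2⟩⟩
  have hin₁ : ConeInside (Γ₁ ∩ Γ₂) Γ := by
    obtain ⟨ε, h1, h2, h3⟩ := hin
    exact ⟨ε, h1, h2, fun ξ h => h3 ξ h.1⟩
  have hin₂ : ConeInside (Γ₁ ∩ Γ₂) Γ' := by
    obtain ⟨ε, h1, h2, h3⟩ := hin'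
    exact ⟨ε, h1, h2, fun ξ h => h3 ξ h.2⟩
  obtain ⟨r, hr, hrr₁, hrr₂, hr1⟩ : ∃ r > 0, r ≤ r₁ ∧ r ≤ r₂ ∧ r ≤ 1 :=
    ⟨min r₁ (min r₂ 1), by positivity, by simp, by simp, by simp⟩
  have hr4 : 0 < r / 4 := by positivity
  have hr8 : 0 < r / 8 := by positivity
  have hsupp := fun s hs => tsupport_sbump_subset_ball (x₀ := x₀) (s := s) hr4 hs
  have h1mod : IsPolyModerate (fun _ : E d => (1 : ℝ)) := by
    simpa using isPolyModerate_one_add_norm_rpow (V := E d) 0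
  refine ⟨r / 8, hr8, Γ₁ ∩ Γ₂, hΓ₃, ⟨hξ₁, hξ₂⟩, fun χ hχ hs => ?_⟩
  have hψχ := sbump_eq_one_of_tsupport hr4 hs (ε := r / 8) (by linarith)
  let ψ := sbump x₀ (r / 4) hr4
  have hψ : HasCompactSupport ψ := hasCompactSupport_sbump _ _ _
  obtain ⟨L₁, hL₁⟩ := ha.exists_parametrix_bound hρ hW hT hg ψ hψ ψ hψ χ hχ hr8 hψχ
    (fun x hx => hψχ x x hx (by simpa using hr8)) hc (fun x hx => hell x
      (Metric.closedBall_subset_closedBall (by linarith) (Metric.ball_subset_closedBall (hs hx))))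
  have hUW := hU.div hW
  have hUρ := hU.mul (isPolyModerate_one_add_norm_rpow (V := E d) (-ρ))
  obtain ⟨L₂, hL₂⟩ := hB.exists_decConv_mul_mem hΓ₃ hin₁ h1mod hUW
    (by simpa only [one_mul] using h₁ ψ hψ (hsupp _ (by linarith)))
  obtain ⟨L₃, hL₃⟩ := hB.exists_decConv_mul_mem hΓ₃ hin₂ h1mod hUρ
    (by simpa only [one_mul] using h₂ ψ hψ (hsupp _ (by linarith)))
  obtain ⟨L₄, hL₄⟩ := hB.exists_inBF_dec hU
  obtain ⟨L, hL1, hL2, hL3, hL4⟩ : ∃ L, L₁ ≤ L ∧ L₂ ≤ L ∧ L₃ ≤ L ∧ L₄ ≤ L :=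
    ⟨L₁ + L₂ + L₃ + L₄, by omega, by omega, by omega, by omega⟩
  obtain ⟨C, hC, hb⟩ := hL₁ L hL1
  refine hB.inBF_of_norm_le (((hL₂ L hL2).add (hL₃ L hL3)).add (hL₄ L hL4 _ hΓ₃)) hΓ₃ Subset.rfl
    ((measurable_locF f χ hχ).mul (Complex.measurable_ofReal.comp hU.measurable)) C fun ξ _ => ?_
  have h0 : ∀ k : 𝓢'(E d, ℂ), 0 ≤ decConv L (fun η => ‖locF k ψ hψ η‖ * 1) ξ := fun k =>
    integral_nonneg fun η => mul_nonneg (dec_nonneg _ _) (by positivity)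
  have h0f := h0 f
  have h0g := h0 g
  have hUp := hU.pos ξ
  have hWp := hW.pos ξ
  have hd := dec_nonneg L ξ
  rw [norm_mul, ← Complex.ofReal_add, ← Complex.ofReal_add, Complex.norm_real, Complex.norm_real,
    Real.norm_of_nonneg hUp.le, Real.norm_of_nonneg (by positivity)]
  refine (mul_le_mul_of_nonneg_right (hb ξ) hUp.le).trans (le_of_eq ?_)
  ring

theorem isOpenCone_compl_singleton_zero : IsOpenCone ({0}ᶜ : Set (E d)) :=
  ⟨isOpen_compl_singleton, by simp, fun t ht ξ hξ => by
    simpa [ht.ne'] using hξ⟩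

/-- The starting point of the bootstrap: polynomial growth of `locF` is beaten by sufficiently many
factors (1 + |ξ|)^{-ρ}. Positivity of ρ is essential here. -/
theorem IsInvariantBFSpace.exists_locBF (hB : IsInvariantBFSpace v ι) (hρ : 0 < ρ)
    (hU : IsPolyModerate U) (f : 𝓢'(E d, ℂ)) (x₀ : E d) (hξ : ξ₀ ≠ 0) :
    ∃ n : ℕ, LocBF ι f x₀ ξ₀ fun ξ => U ξ * (1 + ‖ξ‖) ^ (-(n * ρ)) := by
  obtain ⟨M, hM⟩ := hB.exists_inBF_dec hU
  obtain ⟨N, C, hC, hN⟩ := exists_norm_locF_le f (sbump x₀ 1 one_pos) (hasCompactSupport_sbump _ _ _)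
  obtain ⟨n, hn⟩ := exists_nat_ge (((M + N : ℕ) : ℝ) / ρ)
  have hUn := hU.mul (isPolyModerate_one_add_norm_rpow (V := E d) (-(n * ρ)))
  refine ⟨n, hB.locBF_of_inBF hUn (hasCompactSupport_sbump x₀ 1 one_pos)
    (by rw [sbump_eq_one _ _ _ (by simp)]; exact one_ne_zero) isOpenCone_compl_singleton_zero hξ
    (hB.inBF_of_norm_le (hM M le_rfl _ isOpenCone_compl_singleton_zero)
      isOpenCone_compl_singleton_zero Subset.rfl ((measurable_locF f _ _).mul
        (Complex.measurable_ofReal.comp hUn.measurable)) C fun ξ _ => ?_)⟩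
  have hUp := hU.pos ξ
  have hd := dec_nonneg M ξ
  have h1 : (1 + ‖ξ‖) ^ (-(n * ρ)) ≤ dec (M + N) ξ := by
    rw [dec, Real.rpow_neg (by positivity), ← Real.rpow_natCast]
    refine inv_anti₀ (by positivity) (Real.rpow_le_rpow_of_exponent_le (one_le_one_add_norm ξ) ?_)
    rwa [div_le_iff₀ hρ] at hn
  rw [norm_mul, Complex.norm_real, Complex.norm_real, Real.norm_of_nonneg (hUn.pos ξ).le,
    Real.norm_of_nonneg (by positivity)]
  calc _ ≤ (C * (1 + ‖ξ‖) ^ N) * (U ξ * dec (M + N) ξ) := by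
        gcongr
        exact hN ξ
    _ = C * ((dec (M + N) ξ * (1 + ‖ξ‖) ^ N) * U ξ) := by ring
    _ = _ := by rw [dec_add_mul_pow]

/-- Starting from a weight weakened by nρ, each parametrix step recovers one ρ; the condition on g
at the weaker weights follows from the one at U / W. -/
theorem IsInvariantBFSpace.locBF_of_image (hB : IsInvariantBFSpace v ι)
    (ha : SymBound ρ W a) (hρ : 0 < ρ) (hW : IsPolyModerate W) (hU : IsPolyModerate U)
    (hT : ∀ θ η, T θ η = oscInt a θ 0 η) (hg : ∀ φ, g φ = cFS d * f (FS (T φ)))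
    {c R : ℝ} (hc : 0 < c)
    (hell : ∀ x ∈ Metric.closedBall x₀ 1, ∀ ξ, R ≤ ‖ξ‖ → c * W ξ ≤ ‖a (x, ξ)‖) (hξ : ξ₀ ≠ 0)
    (h : LocBF ι g x₀ ξ₀ fun ξ => U ξ / W ξ) : LocBF ι f x₀ ξ₀ U := by
  obtain ⟨n, hn⟩ := hB.exists_locBF hρ hU f x₀ hξ
  induction n with
  | zero => simpa using hn
  | succ n ih =>
    refine ih ?_
    have hUn := hU.mul (isPolyModerate_one_add_norm_rpow (V := E d) (-(n * ρ)))
    refine hB.locBF_parametrix_step ha hρ hW hUn hT hg hc hell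
      (hB.locBF_mono h (hUn.div hW) (hU.div hW) (c := 1) fun ξ => ?_) ?_
    · have := hU.pos ξ
      have := hW.pos ξ
      rw [one_mul]
      gcongr
      exact mul_le_of_le_one_right (hU.pos ξ).le
        (Real.rpow_le_one_of_one_le_of_nonpos (one_le_one_add_norm ξ) (by
          rw [neg_nonpos]; positivity))
    · convert hn using 1
      funext ξ
      rw [mul_assoc, ← Real.rpow_add (by positivity)]
      congr 2
      push_cast
      ring

/-! ### Translation into wave-front sets. -/

theorem finiteOnCone_iff {w : E d × E d → ℝ} {z : E d} {φ : 𝓢(E d, ℂ)} {hφ : HasCompactSupport φ} :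
    FiniteOnCone ι w z f φ hφ Γ ↔ InBF ι Γ fun ξ => locF f φ hφ ξ * (w (z, ξ) : ℂ) := by
  set c : ℂ := (((2 * Real.pi) ^ (-(d : ℝ) / 2) : ℝ) : ℂ) with hc
  have hc0 : c ≠ 0 := Complex.ofReal_ne_zero.2 (Real.rpow_pos_of_pos Real.two_pi_pos _).ne'
  have e : ∀ ξ, fourierLocal f φ hφ ξ = c * locF f φ hφ ξ := fun ξ => rfl
  constructor
  · intro h
    convert InBF.const_mul (F := fun ξ =>
      fourierLocal f φ hφ ξ * (w (z, ξ) : ℂ)) h c⁻¹ using 1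
    funext ξ
    rw [e]
    field_simp
  · intro h
    change InBF ι Γ _
    convert InBF.const_mul h c using 1
    funext ξ
    rw [e, mul_assoc]

/-- Replaces "some cut-off not vanishing at x₀" by "all cut-offs supported near x₀", and lets the
weight be frozen at any point, in particular at x₀. -/
theorem IsInvariantBFSpace.mem_waveFrontSet_iff (hB : IsInvariantBFSpace v ι)
    {w : E d × E d → ℝ} (hw : IsPolyModerate w) (z z' : E d) :
    (x₀, ξ₀) ∈ waveFrontSet ι w z f ↔ ξ₀ ≠ 0 ∧ ¬ LocBF ι f x₀ ξ₀ fun ξ => w (z', ξ) := by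
  have hz : LocBF ι f x₀ ξ₀ (fun ξ => w (z', ξ)) ↔ LocBF ι f x₀ ξ₀ (fun ξ => w (z, ξ)) := by
    obtain ⟨N, C, -, h⟩ := hw.slice_le
    have key : ∀ y y' : E d, LocBF ι f x₀ ξ₀ (fun ξ => w (y, ξ)) →
        LocBF ι f x₀ ξ₀ (fun ξ => w (y', ξ)) := fun y y' hl =>
      hB.locBF_mono hl (hw.slice y') (hw.slice y) (c := C * (1 + ‖y' - y‖) ^ N) fun ξ =>
        (h y' y ξ).trans (le_of_eq (by ring))
    exact ⟨key _ _, key _ _⟩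
  rw [hz]
  refine and_congr_right fun _ => ⟨?_, ?_⟩
  · rintro h ⟨r, hr, Γ, hΓ, hξ, hl⟩
    have hr4 : 0 < r / 4 := by positivity
    refine h (sbump x₀ (r / 4) hr4) (hasCompactSupport_sbump _ _ _)
      (by rw [sbump_eq_one _ _ _ (by simpa using hr4.le)]; exact one_ne_zero) ⟨Γ, hΓ, hξ, ?_⟩
    exact finiteOnCone_iff.2 (hl _ _ (tsupport_sbump_subset_ball hr4 (by linarith)))
  · rintro h φ hφ hx ⟨Γ, hΓ, hξ, hl⟩
    exact h (hB.locBF_of_inBF (hw.slice z) hφ hx hΓ hξ (finiteOnCone_iff.1 hl))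

end Microlocal

end FourierBF

end

/-! ### Proof of the theorem. -/

theorem mainTheorem2 {d : ℕ} {ρ : ℝ} (hρ : 0 < ρ)
    {ω ω₀ : FourierBF.E d × FourierBF.E d → ℝ}
    (hω : FourierBF.IsPolyModerate ω) (hω₀ : FourierBF.IsSmoothWeight ρ 0 ω₀)
    {a : FourierBF.E d × FourierBF.E d → ℂ} (ha : FourierBF.IsSymbol ρ 0 ω₀ a)
    (hell : FourierBF.IsLocallyElliptic ω₀ a)
    {B : Type*} [NormedAddCommGroup B] [NormedSpace ℂ B]
    {v : FourierBF.E d → ℝ} {ι : B →ₗ[ℂ] (FourierBF.E d →ₘ[volume] ℂ)}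
    (hB : FourierBF.IsInvariantBFSpace v ι) :
    (∃! A : 𝓢'(FourierBF.E d, ℂ) →L[ℂ] 𝓢'(FourierBF.E d, ℂ), FourierBF.IsOpExtension a A) ∧
    ∀ A : 𝓢'(FourierBF.E d, ℂ) →L[ℂ] 𝓢'(FourierBF.E d, ℂ), FourierBF.IsOpExtension a A →
      ∀ (f : 𝓢'(FourierBF.E d, ℂ)) (z z' : FourierBF.E d),
        FourierBF.waveFrontSet ι (fun p => ω p / ω₀ p) z (A f) =
          FourierBF.waveFrontSet ι ω z' f := by
  obtain ⟨hex, T, hT, hTA⟩ := FourierBF.existsUnique_isOpExtension hω₀.polyModerate hρ.le ha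
  refine ⟨hex, fun A hA f z z' => ?_⟩
  have hw := hω₀.polyModerate
  ext ⟨x₀, ξ₀⟩
  -- The weight is frozen at the point x₀ under examination, for both wave-front sets.
  have hS := ha.symBound hw hρ.le x₀
  have hW := hw.slice x₀
  have hg := hTA A hA f
  rw [hB.mem_waveFrontSet_iff (hω.div hw) z x₀, hB.mem_waveFrontSet_iff hω z' x₀]
  refine and_congr_right fun hξ => not_congr ⟨fun h => ?_, fun h => ?_⟩
  · obtain ⟨c, hc, R, -, hcR⟩ := hell (Metric.closedBall x₀ 1) (isCompact_closedBall x₀ 1)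
    obtain ⟨N, C, hC, hN⟩ := hw.slice_le
    -- Ellipticity is given relative to ω₀(x,ξ); on the unit ball around x₀ the passage to ω₀(x₀,ξ)
    -- costs at most C 2^N by moderateness.
    refine hB.locBF_of_image hS hρ hW (hω.slice x₀) hT hg (c := c * (C * 2 ^ N)⁻¹) (R := R)
      (by positivity) (fun x hx ξ hR => le_trans ?_ (hcR x hx ξ hR)) hξ h
    rw [mul_assoc]
    refine mul_le_mul_of_nonneg_left ?_ hc.le
    rw [inv_mul_le_iff₀ (by positivity)]
    have h1 : ‖x₀ - x‖ ≤ 1 := by simpa [dist_eq_norm, norm_sub_rev] using hx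
    have h2 := hw.pos (x, ξ)
    calc ω₀ (x₀, ξ) ≤ C * ω₀ (x, ξ) * (1 + ‖x₀ - x‖) ^ N := hN x₀ x ξ
      _ ≤ C * ω₀ (x, ξ) * 2 ^ N := by gcongr; linarith
      _ = _ := by ring
  · refine hB.locBF_image hS hρ hW ((hω.div hw).slice x₀) hT hg ?_
    convert h using 1
    funext ξ
    have := (hw.pos (x₀, ξ)).ne'
    field_simp
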